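/- Let $\gamma>\alpha>\beta\ge 1$, $m>\beta$, $d\ge 0$, $C\in\mathbb R$ be real numbers, and put $f(u)=u^m|\log u-C|^d$ for $u>0$, $f(0)=0$. For $a\ge 0$ and $r_0>0$, a solution with $u(0)=a$ on $(0,r_0)$ means a function $u\in C^2(0,r_0)\cap C[0,r_0)$ with $u>0$ and $f(u)>0$ on $(0,r_0)$, $u(0)=a$, and $$r^{-(\gamma-1)}\bigl(r^{\alpha}|u'|^{\beta-1}u'\bigr)'=\frac1{f(u)}\qquad\text{for } 0<r<r_0 .$$ Then there exists $r_0>0$ such that the following hold. The problem with $a=0$ has a unique solution $u^*$ on $(0,r_0)$; moreover, for each $r_1\in(0,r_0]$, every solution with $a=0$ on $(0,r_1)$ coincides with $u^*$ on $[0,r_1)$. Furthermore $$u^*(r)=\kappa\left[\frac{r^{\gamma-\alpha+\beta}}{|\log r|^d}\right]^{\frac1{m+\beta}}(1+o(1))\quad\text{as } r\to 0^+,\qquad \kappa=\left[\frac{m+\beta}{\beta\gamma+m(\alpha-\beta)}\Bigl(\frac{m+\beta}{\gamma-\alpha+\beta}\Bigr)^{d+\beta}\right]^{\frac1{m+\beta}}>0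 .$$ Also, $u^*$ is of class $C^1$ at the origin (that is, the right derivative of $u^*$ at $0$ exists and equals $\lim_{r\to0^+}(u^*)'(r)$) if and only if $\gamma\ge m+\alpha$. For all sufficiently small $a>0$ there is a unique (regular) solution $u(\cdot,a)$ with $u(0,a)=a$ on $(0,r_0)$, and: (i) $u(\cdot,a)\to u^*$ in $C^2_{\rm loc}(0,r_0)\cap C_{\rm loc}[0,r_0)$ as $a\to 0^+$. (ii) Let $D=4\bigl(\sqrt{\beta(\beta\gamma+\alpha-\beta)}-\sqrt{\gamma-\alpha+\beta}\bigr)^2-2(\gamma-\alpha+\beta)(\beta+1)^2$, and let $$q_c=\frac12+\frac{(\gamma-\alpha+\beta)(\beta+1)^2}{D}\ \text{ if } D>0,\qquad q_c=+\infty\ \text{ if } D\le 0 .$$ If $\frac m{m-\beta}<q_c$, then for every $\rho\in(0,r_0)$ the number of points $r\in(0,\rho)$ with $u(r,a)=u^*(r)$ tends to $\infty$ as $a\to 0^+$. -/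

import Mathlib

open Set Filter Topology

noncomputable section

namespace MEMS

/-- The nonlinearity `f(u) = u^m |log u - C|^d` for `u > 0`, extended by `0`. -/
def nonlin (m d C : ℝ) (u : ℝ) : ℝ :=
  if 0 < u then u ^ m * |Real.log u - C| ^ d else 0

/-- The flux `r ↦ r^α |u'(r)|^(β-1) u'(r)`. -/
def flux (α β : ℝ) (u : ℝ → ℝ) (r : ℝ) : ℝ :=
  r ^ α * |deriv u r| ^ (β - 1) * deriv u r

/-- `u ∈ C²(0,r₀) ∩ C[0,r₀)` solves
`r^(-(γ-1)) (r^α |u'|^(β-1) u')' = 1 / f(u)`, `u > 0` on `(0,r₀)`, `u(0) = a`.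
The condition `f (u r) > 0` says that `u` takes its values where `1 / f` is meaningful.
For `a = 0` this is the singular problem, for `a > 0` the problem of regular solutions.
Only the values of `u` on `[0,r₀)` matter. -/
structure IsSolution (α β γ : ℝ) (f : ℝ → ℝ) (a r₀ : ℝ) (u : ℝ → ℝ) : Prop where
  contDiffOn : ContDiffOn ℝ 2 u (Ioo 0 r₀)
  continuousOn : ContinuousOn u (Ico 0 r₀)
  pos : ∀ r ∈ Ioo 0 r₀, 0 < u r
  f_pos : ∀ r ∈ Ioo 0 r₀, 0 < f (u r)
  flux_diff : ∀ r ∈ Ioo 0 r₀, DifferentiableAt ℝ (flux α β u) r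
  eqn : ∀ r ∈ Ioo 0 r₀, r ^ (-(γ - 1)) * deriv (flux α β u) r = 1 / f (u r)
  init : u 0 = a

/-- For a function of `r ≥ 0` that is differentiable for small `r > 0`: being of class `C¹` up to
`r = 0`, that is, the right derivative at `0` exists and is the limit of `u'(r)` as `r → 0⁺`. -/
def IsC1AtZero (u : ℝ → ℝ) : Prop :=
  ∃ l : ℝ, HasDerivWithinAt u l (Ici 0) 0 ∧ Tendsto (deriv u) (𝓝[>] 0) (𝓝 l)

/-- `U a → u` in `C²_loc(0,r₀) ∩ C_loc[0,r₀)` as `a → 0⁺`. -/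
def ConvergesC2Loc (U : ℝ → ℝ → ℝ) (u : ℝ → ℝ) (r₀ : ℝ) : Prop :=
  (∀ k ≤ 2, ∀ K ⊆ Ioo 0 r₀, IsCompact K →
    TendstoUniformlyOn (fun a => iteratedDeriv k (U a)) (iteratedDeriv k u) (𝓝[>] 0) K) ∧
  ∀ K ⊆ Ico 0 r₀, IsCompact K → TendstoUniformlyOn U u (𝓝[>] 0) K

/-- The number of zeros of `h` in `I`, possibly `⊤`. -/
def zeroNumber (I : Set ℝ) (h : ℝ → ℝ) : ℕ∞ :=
  {r ∈ I | h r = 0}.encard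

/-- The constant `κ` of the leading term of the singular solution. -/
def kappa (α β γ m d : ℝ) : ℝ :=
  ((m + β) / (β * γ + m * (α - β)) * ((m + β) / (γ - α + β)) ^ (d + β)) ^ (1 / (m + β))

/-- The denominator in the critical exponent. -/
def qcDenom (α β γ : ℝ) : ℝ :=
  4 * (√(β * (β * γ + α - β)) - √(γ - α + β)) ^ 2 - 2 * (γ - α + β) * (β + 1) ^ 2

/-- The critical exponent `q_c`; it is `+∞` when the denominator in its formula is not positive
(for the Laplacian `α = N - 1`, `β = 1`, `γ = N`, this is the range `N ≤ 4 + 2√2`). -/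
def qc (α β γ : ℝ) : EReal :=
  if 0 < qcDenom α β γ then
    ((1 / 2 + (γ - α + β) * (β + 1) ^ 2 / qcDenom α β γ : ℝ) : EReal)
  else ⊤

end MEMS

end

/-!
In the variables `t = log r`, `z = log u`, `w = log φ`, where `φ` is the flux, the logarithms
`x = log (r u' / u)` and `y = log (r φ' / φ)` satisfy the perturbed Lotka–Volterra system

  `x' = (e ^ y - q) / β - (e ^ x - p)`,
  `y' = -m (e ^ x - p) - (e ^ y - q) + d e ^ x / (C - z)`,

whose perturbation is small as long as `u` is. Every statement about solutions is a statement about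
this system near its equilibrium `e ^ x = p`, `e ^ y = q`. A solution starts from a core
`r ^ p < h₀`, where `h₀` is comparable to its value at the origin up to a logarithm; for `a = 0`
there is no core. Monotone quantities confine `(x, y)` to a fixed compact set outside the core
(`Traj.exists_abs_le`), and there the Lyapunov function of the Lotka–Volterra system pulls it towards
the equilibrium, exponentially fast in `t` (`Traj.exists_dist2_le`). Near the equilibrium two
solutions approach each other: a weighted squared distance decays exponentially, and the relation
`β x + y = θ t - (m + β) λ(z)` carries the estimate over to `z`. Hence any two solutions with cores
ending before `s` differ at `t` by at most `K e ^ (-c (t - s))` (`Traj.exists_abs_sub_le`), with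
uniform constants. This one estimate yields

* uniqueness of the singular solution, by `s → -∞` (`Admissible.singular_unique`);
* its existence, since the regular solutions form a Cauchy family as `a → 0`
  (`Admissible.exists_singular`), whose derivatives converge with it;
* the convergence of the regular solutions and of their first two derivatives, which are explicit
  functions of `r`, `u`, `x` and `y` (`Admissible.convergesC2Loc`).

The Lyapunov estimate with `s → -∞` shows that `(e ^ x, e ^ y) → (p, q)` along the singular solution,
and `β x + y = θ t - (m + β) λ(z)` then gives its leading term (`IsSolution.isEquivalent`); since
`u' = (u / r) e ^ x`, the same relation decides whether `u'` has a limit at the origin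
(`IsSolution.isC1AtZero_iff`). For `p = 1`, that is `γ = m + α`, the logarithm in the leading term
makes the derivative tend to `0` if `d > 0`.

If `m / (m - β) < q_c`, the linearization at the equilibrium has non-real eigenvalues
(`Params.disc_of_lt_qc`). The slope `δx / δz` of the difference of two solutions near the equilibrium
then satisfies a Riccati inequality and blows up in bounded time, so that `δz` vanishes in every
interval of `t` of a fixed length (`Traj.exists_length_le`). As `a → 0` the interval on which both
`u(·, a)` and the singular solution are near the equilibrium becomes arbitrarily long.

Regular solutions are fixed points of an integral operator, which is a contraction for a weighted
norm once `1 / f` is truncated to a bounded Lipschitz function (`exists_eq_intOp`); the a priori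
bounds show that the truncation is not felt on `(0, r₀)`, with `r₀` independent of `a`
(`Admissible.exists_regular`).
-/

noncomputable section

namespace MEMS

/-! ### Monotonicity lemmas on half-lines -/

/-- A function with nonnegative derivative on `(-∞, t]` that dominates a function tending to `l`
at `-∞` is at least `l` at `t`. -/
lemma le_of_deriv_nonneg_of_tendsto_atBot {F F' g : ℝ → ℝ} {l t : ℝ}
    (hF : ∀ s ≤ t, HasDerivAt F (F' s) s) (hF' : ∀ s ≤ t, 0 ≤ F' s)
    (hg : Tendsto g atBot (𝓝 l)) (hgF : ∀ s ≤ t, g s ≤ F s) : l ≤ F t := by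
  have hmono : MonotoneOn F (Iic t) := by
    apply monotoneOn_of_deriv_nonneg (convex_Iic t)
    · exact fun s hs => (hF s hs).continuousAt.continuousWithinAt
    · intro s hs
      rw [interior_Iic] at hs
      exact (hF s hs.le).differentiableAt.differentiableWithinAt
    · intro s hs
      rw [interior_Iic] at hs
      rw [(hF s hs.le).deriv]
      exact hF' s hs.le
  refine le_of_tendsto hg ?_
  filter_upwards [eventually_le_atBot t] with s hs
  exact (hgF s hs).trans (hmono hs (mem_Iic.2 le_rfl) hs)

lemma le_of_deriv_nonpos_of_tendsto_atBot {F F' : ℝ → ℝ} {l t : ℝ}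
    (hF : ∀ s ≤ t, HasDerivAt F (F' s) s) (hF' : ∀ s ≤ t, F' s ≤ 0)
    (hl : Tendsto F atBot (𝓝 l)) : F t ≤ l := by
  have h := le_of_deriv_nonneg_of_tendsto_atBot (F := fun s => -F s) (F' := fun s => -F' s)
    (g := fun s => -F s) (l := -l) (t := t) (fun s hs => (hF s hs).neg)
    (fun s hs => neg_nonneg.2 (hF' s hs)) hl.neg (fun s _ => le_rfl)
  linarith

/-- Grönwall's inequality for a decaying quantity: `V' ≤ -c V + k`. -/
lemma le_of_deriv_le_neg_mul_add {V V' : ℝ → ℝ} {c k s t : ℝ} (hc : 0 < c) (hst : s ≤ t)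
    (hV : ∀ τ ∈ Icc s t, HasDerivAt V (V' τ) τ)
    (hV' : ∀ τ ∈ Icc s t, V' τ ≤ -c * V τ + k) :
    V t ≤ V s * Real.exp (-c * (t - s)) + max k 0 / c := by
  have hd : ∀ τ ∈ Icc s t, HasDerivAt (fun τ => Real.exp (c * τ) * (V τ - max k 0 / c))
      (Real.exp (c * τ) * c * (V τ - max k 0 / c) + Real.exp (c * τ) * V' τ) τ := by
    intro τ hτ
    have h1 : HasDerivAt (fun τ => Real.exp (c * τ)) (Real.exp (c * τ) * c) τ := by
      simpa using ((hasDerivAt_id τ).const_mul c).exp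
    exact h1.mul ((hV τ hτ).sub_const _)
  have hanti : AntitoneOn (fun τ => Real.exp (c * τ) * (V τ - max k 0 / c)) (Icc s t) := by
    apply antitoneOn_of_deriv_nonpos (convex_Icc s t)
    · exact fun τ hτ => (hd τ hτ).continuousAt.continuousWithinAt
    · intro τ hτ
      exact (hd τ (interior_subset hτ)).differentiableAt.differentiableWithinAt
    · intro τ hτ
      have hτ' := interior_subset hτ
      rw [(hd τ hτ').deriv]
      have h1 := hV' τ hτ'
      have h2 : c * (max k 0 / c) = max k 0 := by field_simp
      have h3 := le_max_left k 0
      have h4 : Real.exp (c * τ) * c * (V τ - max k 0 / c) + Real.exp (c * τ) * V' τ =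
        Real.exp (c * τ) * (V' τ + c * V τ - max k 0) := by
        linear_combination (-Real.exp (c * τ)) * h2
      rw [h4]
      exact mul_nonpos_of_nonneg_of_nonpos (Real.exp_pos _).le (by linarith)
  have h := hanti (left_mem_Icc.2 hst) (right_mem_Icc.2 hst) hst
  simp only at h
  have hk : 0 ≤ max k 0 / c := div_nonneg (le_max_right _ _) hc.le
  have he : Real.exp (-c * (t - s)) = Real.exp (c * s) / Real.exp (c * t) := by
    rw [← Real.exp_sub]; ring_nf
  rw [he]
  have hp := Real.exp_pos (c * t)
  have h5 : V t - max k 0 / c ≤ Real.exp (c * s) * (V s - max k 0 / c) / Real.exp (c * t) := by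
    rw [le_div_iff₀ hp]; linarith
  have h6 : Real.exp (c * s) * (V s - max k 0 / c) / Real.exp (c * t) ≤
      V s * (Real.exp (c * s) / Real.exp (c * t)) := by
    rw [← mul_div_assoc, mul_comm (V s)]
    gcongr
    linarith
  linarith

/-! ### Parameters and Emden–Fowler variables -/

/-- The parameters of the equation, with the standing assumptions on them. -/
structure Params where
  α : ℝ
  β : ℝ
  γ : ℝ
  m : ℝ
  d : ℝ
  C : ℝ
  one_le_β : 1 ≤ β
  β_lt_α : β < α
  α_lt_γ : α < γ
  β_lt_m : β < m
  d_nonneg : 0 ≤ d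

namespace Params

variable (P : Params)

/-- The number `γ - α + β`. -/
def θ : ℝ := P.γ - P.α + P.β
/-- The exponent of the singular solution: the equilibrium value of `r u' / u`. -/
def p : ℝ := P.θ / (P.m + P.β)
/-- The exponent of the flux of the singular solution: the equilibrium value of
`r φ' / φ`, where `φ` is the flux. -/
def q : ℝ := P.γ - P.m * P.p

lemma β_pos : 0 < P.β := by linarith [P.one_le_β]
lemma m_pos : 0 < P.m := by linarith [P.β_pos, P.β_lt_m]
lemma mβ_pos : 0 < P.m + P.β := by linarith [P.β_pos, P.m_pos]
lemma γ_pos : 0 < P.γ := by linarith [P.β_pos, P.β_lt_α, P.α_lt_γ]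
lemma α_pos : 0 < P.α := by linarith [P.β_pos, P.β_lt_α]
lemma θ_pos : 0 < P.θ := by unfold θ; linarith [P.β_pos, P.α_lt_γ]
lemma p_pos : 0 < P.p := div_pos P.θ_pos P.mβ_pos
lemma p_mul : P.p * (P.m + P.β) = P.θ := div_mul_cancel₀ _ P.mβ_pos.ne'
lemma q_eq : P.q = P.α - P.β + P.β * P.p := by
  have := P.p_mul
  unfold q; unfold θ at this; linarith
lemma q_pos : 0 < P.q := by
  rw [q_eq]; have := mul_pos P.β_pos P.p_pos; linarith [P.β_lt_α]
lemma γ_eq : P.γ = P.m * P.p + P.q := by unfold q; ring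

/-- The logarithm of `r u' / u` in terms of `t = log r`, `z = log u` and the logarithm `w` of the
flux. -/
def xVar (t z w : ℝ) : ℝ := t + (w - P.α * t) / P.β - z
/-- The logarithm of `r φ' / φ = r ^ γ / (f u φ)` for the flux `φ = exp w`, in terms of `t = log r`
and `z = log u`. -/
def yVar (t z w : ℝ) : ℝ := P.γ * t - P.m * z - P.d * Real.log (P.C - z) - w
/-- The logarithm of `(u ^ β f u) ^ (1 / (m + β))` in terms of `z = log u`. -/
def lam (z : ℝ) : ℝ := z + P.d / (P.m + P.β) * Real.log (P.C - z)

lemma xVar_yVar (t z w : ℝ) :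
    P.β * P.xVar t z w + P.yVar t z w = P.θ * t - (P.m + P.β) * P.lam z := by
  have h1 := P.β_pos.ne'
  have h2 := P.mβ_pos.ne'
  unfold xVar yVar lam θ
  field_simp
  ring

end Params

/-- A solution of the equation in the variables `t = log r`, `z = log u`, `w = log φ`, where `φ` is
the flux, for `t < T`; the values of `u` are below `exp (C - L)`, where the nonlinearity is
increasing, and the flux vanishes at the origin. -/
structure Traj (P : Params) (L T : ℝ) (z w : ℝ → ℝ) : Prop where
  L_pos : 0 < L
  d_le : P.d ≤ P.m * L
  le : ∀ t < T, z t ≤ P.C - L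
  hasDerivAt_z : ∀ t < T, HasDerivAt z (Real.exp (P.xVar t (z t) (w t))) t
  hasDerivAt_w : ∀ t < T, HasDerivAt w (Real.exp (P.yVar t (z t) (w t))) t
  tendsto_w : Tendsto (fun t => Real.exp (w t)) atBot (𝓝 0)

namespace Traj

variable {P : Params} {L T : ℝ} {z w : ℝ → ℝ}

lemma C_sub_pos (h : Traj P L T z w) {t : ℝ} (ht : t < T) : 0 < P.C - z t := by
  linarith [h.le t ht, h.L_pos]

/-- The effective exponent `u f'(u) / f(u)` is nonnegative. -/
lemma d_div_le (h : Traj P L T z w) {t : ℝ} (ht : t < T) : P.d / (P.C - z t) ≤ P.m := by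
  rw [div_le_iff₀ (h.C_sub_pos ht)]
  have := h.le t ht
  have := P.m_pos
  nlinarith [h.d_le]

lemma strictMonoOn (h : Traj P L T z w) : StrictMonoOn z (Iio T) := by
  apply strictMonoOn_of_deriv_pos (convex_Iio T)
  · exact fun t ht => (h.hasDerivAt_z t ht).continuousAt.continuousWithinAt
  · intro t ht
    rw [interior_Iio] at ht
    rw [(h.hasDerivAt_z t ht).deriv]
    exact Real.exp_pos _

lemma hasDerivAt_log (h : Traj P L T z w) {t : ℝ} (ht : t < T) :
    HasDerivAt (fun t => Real.log (P.C - z t))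
      (-(Real.exp (P.xVar t (z t) (w t)) / (P.C - z t))) t := by
  have := ((h.hasDerivAt_z t ht).const_sub P.C).log (h.C_sub_pos ht).ne'
  rwa [neg_div] at this

lemma hasDerivAt_x (h : Traj P L T z w) {t : ℝ} (ht : t < T) :
    HasDerivAt (fun t => P.xVar t (z t) (w t))
      ((Real.exp (P.yVar t (z t) (w t)) - P.q) / P.β -
        (Real.exp (P.xVar t (z t) (w t)) - P.p)) t := by
  have h1 := (((hasDerivAt_id t).add (((h.hasDerivAt_w t ht).sub
    ((hasDerivAt_id t).const_mul P.α)).div_const P.β)).sub (h.hasDerivAt_z t ht))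
  refine h1.congr_deriv ?_
  have := P.β_pos.ne'
  rw [P.q_eq]
  field_simp
  ring

lemma hasDerivAt_y (h : Traj P L T z w) {t : ℝ} (ht : t < T) :
    HasDerivAt (fun t => P.yVar t (z t) (w t))
      (-P.m * (Real.exp (P.xVar t (z t) (w t)) - P.p) -
        (Real.exp (P.yVar t (z t) (w t)) - P.q) +
        P.d / (P.C - z t) * Real.exp (P.xVar t (z t) (w t))) t := by
  have h1 := ((((hasDerivAt_id t).const_mul P.γ).sub ((h.hasDerivAt_z t ht).const_mul P.m)).sub
    ((h.hasDerivAt_log ht).const_mul P.d)).sub (h.hasDerivAt_w t ht)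
  refine h1.congr_deriv ?_
  rw [P.γ_eq]
  ring

lemma hasDerivAt_lam (h : Traj P L T z w) {t : ℝ} (ht : t < T) :
    HasDerivAt (fun t => P.lam (z t))
      (Real.exp (P.xVar t (z t) (w t)) * (1 - P.d / (P.m + P.β) / (P.C - z t))) t := by
  have h1 := (h.hasDerivAt_z t ht).add ((h.hasDerivAt_log ht).const_mul (P.d / (P.m + P.β)))
  refine h1.congr_deriv ?_
  ring

end Traj

/-! ### A priori bounds -/

namespace Traj

variable {P : Params} {L T : ℝ} {z w : ℝ → ℝ}

/-- In the original variables, `r φ' ≤ γ φ`. This holds because `u` and `f` are increasing: the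
function `e ^ (γ t) (e ^ (-y) - 1 / γ)` is nondecreasing and tends to a nonnegative limit. -/
lemma exp_y_le (h : Traj P L T z w) {t : ℝ} (ht : t < T) :
    Real.exp (P.yVar t (z t) (w t)) ≤ P.γ := by
  have hγ := P.γ_pos
  have key := le_of_deriv_nonneg_of_tendsto_atBot (t := t) (l := 0)
    (F := fun s => Real.exp (P.γ * s) * (Real.exp (-P.yVar s (z s) (w s)) - 1 / P.γ))
    (F' := fun s => Real.exp (P.γ * s) * (Real.exp (-P.yVar s (z s) (w s)) *
      ((P.m - P.d / (P.C - z s)) * Real.exp (P.xVar s (z s) (w s)))))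
    (g := fun s => -(Real.exp (P.γ * s) / P.γ)) ?_ ?_ ?_ ?_
  · have h1 : 0 ≤ Real.exp (-P.yVar t (z t) (w t)) - 1 / P.γ :=
      nonneg_of_mul_nonneg_right key (Real.exp_pos _)
    rw [Real.exp_neg, sub_nonneg, one_div] at h1
    exact (inv_le_inv₀ hγ (Real.exp_pos _)).1 h1
  · intro s hs
    have h1 : HasDerivAt (fun s => Real.exp (P.γ * s)) (Real.exp (P.γ * s) * P.γ) s := by
      simpa using ((hasDerivAt_id s).const_mul P.γ).exp
    have h2 := (h.hasDerivAt_y (hs.trans_lt ht)).neg.exp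
    refine (h1.mul (h2.sub_const (1 / P.γ))).congr_deriv ?_
    have h3 : Real.exp (-P.yVar s (z s) (w s)) * Real.exp (P.yVar s (z s) (w s)) = 1 := by
      rw [← Real.exp_add]; simp
    have h4 : P.γ * (1 / P.γ) = 1 := by field_simp
    rw [Pi.neg_apply]
    linear_combination (Real.exp (P.γ * s)) * h3 - Real.exp (P.γ * s) * h4
      + Real.exp (P.γ * s) * Real.exp (-P.yVar s (z s) (w s)) * P.γ_eq
  · intro s hs
    have := h.d_div_le (hs.trans_lt ht)
    have : 0 ≤ P.m - P.d / (P.C - z s) := by linarith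
    positivity
  · have : Tendsto (fun s => Real.exp (P.γ * s)) atBot (𝓝 0) :=
      Real.tendsto_exp_atBot.comp (tendsto_id.const_mul_atBot hγ)
    simpa using (this.div_const P.γ).neg
  · intro s _
    have := mul_pos (Real.exp_pos (P.γ * s)) (Real.exp_pos (-P.yVar s (z s) (w s)))
    have h2 : Real.exp (P.γ * s) / P.γ = Real.exp (P.γ * s) * (1 / P.γ) := by ring
    rw [h2]; linarith

/-- In the original variables this is the lower bound `u ^ β f u ≥ const * r ^ θ`. -/
lemma exists_βx_add_y_le (P : Params) : ∃ k : ℝ, ∀ {L T : ℝ} {z w : ℝ → ℝ},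
    Traj P L T z w → ∀ t < T, P.β * P.xVar t (z t) (w t) + P.yVar t (z t) (w t) ≤ k := by
  have hγ := P.γ_pos
  have hβ := P.β_pos
  have hθ := P.θ_pos
  set c : ℝ := P.β * Real.exp (-(Real.log P.γ / P.β)) / P.θ with hc
  have hcpos : 0 < c := by positivity
  have hcθ : c * P.θ / P.β = Real.exp (-(Real.log P.γ / P.β)) := by
    rw [hc]; field_simp
  refine ⟨P.β * (-Real.log c), fun {L T z w} h t ht => ?_⟩
  have key := le_of_deriv_nonneg_of_tendsto_atBot (t := t) (l := 0)
    (F := fun s => Real.exp (P.θ / P.β * s) *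
      (Real.exp (-(P.xVar s (z s) (w s) + P.yVar s (z s) (w s) / P.β)) - c))
    (F' := fun s => Real.exp (P.θ / P.β * s) *
      ((1 + (P.m - P.d / (P.C - z s)) / P.β) * Real.exp (-(P.yVar s (z s) (w s) / P.β))
        - c * P.θ / P.β))
    (g := fun s => -(c * Real.exp (P.θ / P.β * s))) ?_ ?_ ?_ ?_
  · have h1 : 0 ≤ Real.exp (-(P.xVar t (z t) (w t) + P.yVar t (z t) (w t) / P.β)) - c :=
      nonneg_of_mul_nonneg_right key (Real.exp_pos _)
    have h2 := Real.log_le_log hcpos (sub_nonneg.1 h1)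
    rw [Real.log_exp] at h2
    have h3 : P.β * P.xVar t (z t) (w t) + P.yVar t (z t) (w t) =
        P.β * (P.xVar t (z t) (w t) + P.yVar t (z t) (w t) / P.β) := by field_simp
    rw [h3]
    exact mul_le_mul_of_nonneg_left (by linarith) hβ.le
  · intro s hs
    have h1 : HasDerivAt (fun s => Real.exp (P.θ / P.β * s))
        (Real.exp (P.θ / P.β * s) * (P.θ / P.β)) s := by
      simpa using ((hasDerivAt_id s).const_mul (P.θ / P.β)).exp
    have hs' := hs.trans_lt ht
    have h2 := ((h.hasDerivAt_x hs').add ((h.hasDerivAt_y hs').div_const P.β)).neg.exp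
    refine (h1.mul (h2.sub_const c)).congr_deriv ?_
    have h3 : Real.exp (-(P.yVar s (z s) (w s) / P.β)) =
        Real.exp (-(P.xVar s (z s) (w s) + P.yVar s (z s) (w s) / P.β)) *
        Real.exp (P.xVar s (z s) (w s)) := by
      rw [← Real.exp_add]; ring_nf
    have h4 : P.θ = P.β * P.p + P.m * P.p := by rw [← P.p_mul]; ring
    simp only [Pi.neg_apply, Pi.add_apply]
    rw [h3, h4]
    field_simp
    ring
  · intro s hs
    have hs' := hs.trans_lt ht
    have h1 := h.d_div_le hs'
    have h2 : 0 ≤ (P.m - P.d / (P.C - z s)) / P.β := div_nonneg (by linarith) hβ.le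
    have h3 : c * P.θ / P.β ≤ Real.exp (-(P.yVar s (z s) (w s) / P.β)) := by
      rw [hcθ]
      have h4 : P.yVar s (z s) (w s) ≤ Real.log P.γ := by
        rw [Real.le_log_iff_exp_le hγ]; exact h.exp_y_le hs'
      gcongr
    refine mul_nonneg (Real.exp_pos _).le ?_
    have := mul_nonneg h2 (Real.exp_pos (-(P.yVar s (z s) (w s) / P.β))).le
    linarith
  · have : Tendsto (fun s => Real.exp (P.θ / P.β * s)) atBot (𝓝 0) :=
      Real.tendsto_exp_atBot.comp (tendsto_id.const_mul_atBot (by positivity))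
    simpa using (this.const_mul c).neg
  · intro s _
    have := mul_pos (Real.exp_pos (P.θ / P.β * s))
      (Real.exp_pos (-(P.xVar s (z s) (w s) + P.yVar s (z s) (w s) / P.β)))
    linarith

/-- The flux is bounded by integrating the equation, using the lower bound on `u`. -/
lemma exists_x_add_lam_le (P : Params) : ∃ k : ℝ, ∀ {L T : ℝ} {z w : ℝ → ℝ},
    Traj P L T z w → ∀ t < T, P.xVar t (z t) (w t) + P.lam (z t) ≤ P.p * t + k := by
  obtain ⟨k1, hk1⟩ := exists_βx_add_y_le P
  have hβ := P.β_pos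
  have hm := P.m_pos
  have hmβ := P.mβ_pos
  have hq := P.q_pos
  have hd := P.d_nonneg
  refine ⟨(P.m * (k1 / (P.m + P.β)) - Real.log P.q) / P.β, fun {L T z w} h t ht => ?_⟩
  set b : ℝ := P.β * P.d / (P.m + P.β) * Real.log (P.C - z t) with hb
  set K : ℝ := Real.exp (P.m * (k1 / (P.m + P.β)) - b) with hK
  have key := le_of_deriv_nonpos_of_tendsto_atBot (t := t) (l := 0)
    (F := fun s => Real.exp (w s) - K / P.q * Real.exp (P.q * s))
    (F' := fun s => Real.exp (w s) * Real.exp (P.yVar s (z s) (w s)) - K * Real.exp (P.q * s))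
    ?_ ?_ ?_
  · have h1 : Real.exp (w t) ≤ Real.exp (P.m * (k1 / (P.m + P.β)) - b - Real.log P.q + P.q * t) := by
      rw [Real.exp_add, Real.exp_sub _ (Real.log P.q), Real.exp_log hq]
      linarith
    rw [Real.exp_le_exp] at h1
    have h2 : P.xVar t (z t) (w t) + P.lam (z t) = P.p * t + (w t + b - P.q * t) / P.β := by
      unfold Params.xVar Params.lam
      rw [hb, P.q_eq]
      field_simp
      ring
    have h3 : w t + b - P.q * t ≤ P.m * (k1 / (P.m + P.β)) - Real.log P.q := by linarith
    have h4 := div_le_div_of_nonneg_right h3 hβ.le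
    linarith
  · intro s hs
    have h1 : HasDerivAt (fun s => Real.exp (P.q * s)) (Real.exp (P.q * s) * P.q) s := by
      simpa using ((hasDerivAt_id s).const_mul P.q).exp
    refine ((h.hasDerivAt_w s (hs.trans_lt ht)).exp.sub (h1.const_mul (K / P.q))).congr_deriv ?_
    field_simp
  · intro s hs
    have hs' := hs.trans_lt ht
    rw [hK, ← Real.exp_add, ← Real.exp_add, sub_nonpos, Real.exp_le_exp]
    have h1 := hk1 h s hs'
    rw [P.xVar_yVar] at h1
    have h2 : P.p * s - k1 / (P.m + P.β) ≤ P.lam (z s) := by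
      have : P.p * s - k1 / (P.m + P.β) = (P.θ * s - k1) / (P.m + P.β) := by
        rw [← P.p_mul]; field_simp
      rw [this, div_le_iff₀ hmβ]; linarith
    have h3 : w s + P.yVar s (z s) (w s) = P.γ * s - P.m * P.lam (z s) -
        P.β * P.d / (P.m + P.β) * Real.log (P.C - z s) := by
      unfold Params.yVar Params.lam
      field_simp
      ring
    have h4 : b ≤ P.β * P.d / (P.m + P.β) * Real.log (P.C - z s) := by
      rw [hb]
      have := h.strictMonoOn.monotoneOn hs' ht hs
      have := h.C_sub_pos ht
      gcongr
    rw [h3]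
    have := mul_le_mul_of_nonneg_left h2 hm.le
    have h5 : P.γ * s = P.m * (P.p * s) + P.q * s := by rw [P.γ_eq]; ring
    linarith
  · have : Tendsto (fun s => Real.exp (P.q * s)) atBot (𝓝 0) :=
      Real.tendsto_exp_atBot.comp (tendsto_id.const_mul_atBot hq)
    simpa using h.tendsto_w.sub (this.const_mul (K / P.q))

/-- An upper bound for the growth of `u` from its value at the origin, with a constant that does not
depend on that value. -/
lemma exists_exp_lam_le (P : Params) : ∃ k : ℝ, 0 < k ∧ ∀ {L T h₀ : ℝ} {z w : ℝ → ℝ},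
    Traj P L T z w → Tendsto (fun t => Real.exp (P.lam (z t))) atBot (𝓝 h₀) →
    ∀ t < T, Real.exp (P.lam (z t)) ≤ h₀ + k * Real.exp (P.p * t) := by
  obtain ⟨k2, hk2⟩ := exists_x_add_lam_le P
  have hp := P.p_pos
  refine ⟨Real.exp k2 / P.p, by positivity, fun {L T h₀ z w} h hlim t ht => ?_⟩
  have key := le_of_deriv_nonpos_of_tendsto_atBot (t := t) (l := h₀)
    (F := fun s => Real.exp (P.lam (z s)) - Real.exp k2 / P.p * Real.exp (P.p * s))
    (F' := fun s => Real.exp (P.lam (z s)) * (Real.exp (P.xVar s (z s) (w s)) *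
      (1 - P.d / (P.m + P.β) / (P.C - z s))) - Real.exp k2 * Real.exp (P.p * s))
    ?_ ?_ ?_
  · linarith
  · intro s hs
    have h1 : HasDerivAt (fun s => Real.exp (P.p * s)) (Real.exp (P.p * s) * P.p) s := by
      simpa using ((hasDerivAt_id s).const_mul P.p).exp
    refine ((h.hasDerivAt_lam (hs.trans_lt ht)).exp.sub
      (h1.const_mul (Real.exp k2 / P.p))).congr_deriv ?_
    field_simp
  · intro s hs
    have hs' := hs.trans_lt ht
    have h1 := hk2 h s hs'
    have h2 : Real.exp (P.lam (z s)) * Real.exp (P.xVar s (z s) (w s)) ≤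
        Real.exp k2 * Real.exp (P.p * s) := by
      rw [← Real.exp_add, ← Real.exp_add, Real.exp_le_exp]; linarith
    have h3 : 0 ≤ P.d / (P.m + P.β) / (P.C - z s) := by
      have := P.d_nonneg; have := P.mβ_pos; have := h.C_sub_pos hs'
      positivity
    have h4 := mul_pos (Real.exp_pos (P.lam (z s))) (Real.exp_pos (P.xVar s (z s) (w s)))
    nlinarith
  · have : Tendsto (fun s => Real.exp (P.p * s)) atBot (𝓝 0) :=
      Real.tendsto_exp_atBot.comp (tendsto_id.const_mul_atBot hp)
    simpa using hlim.sub (this.const_mul (Real.exp k2 / P.p))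

/-- Outside the core `r ^ p < h₀` of a solution, where `h₀` measures its value at the origin, the
point `(x, y)` stays in a fixed compact set. -/
lemma exists_abs_le (P : Params) : ∃ B : ℝ, ∀ {L T h₀ : ℝ} {z w : ℝ → ℝ},
    Traj P L T z w → Tendsto (fun t => Real.exp (P.lam (z t))) atBot (𝓝 h₀) →
    ∀ t < T, h₀ ≤ Real.exp (P.p * t) →
      |P.xVar t (z t) (w t)| ≤ B ∧ |P.yVar t (z t) (w t)| ≤ B := by
  obtain ⟨k1, hk1⟩ := exists_βx_add_y_le P
  obtain ⟨k2, hk2⟩ := exists_x_add_lam_le P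
  obtain ⟨k3, hk3, hk3'⟩ := exists_exp_lam_le P
  have hβ := P.β_pos
  have hmβ := P.mβ_pos
  have hγ := P.γ_pos
  set k4 := Real.log (1 + k3) with hk4
  set xu := k2 + k1 / (P.m + P.β) with hxu
  set xl := (-((P.m + P.β) * k4) - Real.log P.γ) / P.β with hxl
  set yl := -((P.m + P.β) * k4) - P.β * xu with hyl
  refine ⟨max (max |xu| |xl|) (max |Real.log P.γ| |yl|), fun {L T h₀ z w} h hlim t ht hh => ?_⟩
  have e1 := hk1 h t ht
  have e2 := hk2 h t ht
  have e3 : P.lam (z t) ≤ k4 + P.p * t := by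
    have h1 := hk3' h hlim t ht
    have h2 : Real.exp (P.lam (z t)) ≤ Real.exp (k4 + P.p * t) := by
      rw [Real.exp_add, hk4, Real.exp_log (by linarith)]; linarith
    exact Real.exp_le_exp.1 h2
  have e4 : P.yVar t (z t) (w t) ≤ Real.log P.γ := by
    rw [Real.le_log_iff_exp_le hγ]; exact h.exp_y_le ht
  have e5 := P.xVar_yVar t (z t) (w t)
  set x := P.xVar t (z t) (w t)
  set y := P.yVar t (z t) (w t)
  have e6 : P.θ * t = (P.m + P.β) * (P.p * t) := by rw [← P.p_mul]; ring
  have e7 : -((P.m + P.β) * k4) ≤ P.β * x + y := by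
    have := mul_le_mul_of_nonneg_left e3 hmβ.le
    linarith
  have hx1 : x ≤ xu := by
    have : P.lam (z t) - P.p * t = -(P.β * x + y) / (P.m + P.β) := by
      rw [e5, e6]; field_simp; ring
    have h2 : (P.β * x + y) / (P.m + P.β) ≤ k1 / (P.m + P.β) := by gcongr
    rw [neg_div] at this
    linarith
  have hx2 : xl ≤ x := by
    rw [hxl, div_le_iff₀ hβ]; linarith
  have hy2 : yl ≤ y := by
    have := mul_le_mul_of_nonneg_left hx1 hβ.le
    linarith
  constructor
  · refine (abs_le_max_abs_abs hx2 hx1).trans ?_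
    rw [max_comm |xl|]
    exact le_max_left _ _
  · refine (abs_le_max_abs_abs hy2 e4).trans ?_
    rw [max_comm |yl|]
    exact le_max_right _ _

end Traj

/-! ### The Lyapunov function of the Lotka–Volterra system -/

/-- The convex function `x ↦ e ^ x - a - a (x - log a)`, which vanishes exactly at `log a`. -/
def relEntropy (a x : ℝ) : ℝ := Real.exp x - a - a * (x - Real.log a)

lemma relEntropy_le {a : ℝ} (ha : 0 < a) (x : ℝ) :
    relEntropy a x ≤ (Real.exp x - a) ^ 2 * Real.exp (-x) := by
  have h1 : 1 - Real.exp (-(x - Real.log a)) ≤ x - Real.log a := by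
    linarith [Real.add_one_le_exp (-(x - Real.log a))]
  have h2 : Real.exp (-(x - Real.log a)) = a * Real.exp (-x) := by
    rw [neg_sub, sub_eq_add_neg, Real.exp_add, Real.exp_log ha]
  have h3 : Real.exp x * Real.exp (-x) = 1 := by rw [← Real.exp_add]; simp
  rw [h2] at h1
  have h4 := mul_le_mul_of_nonneg_left h1 ha.le
  have h5 : (Real.exp x - a) ^ 2 * Real.exp (-x) =
      Real.exp x - 2 * a + a ^ 2 * Real.exp (-x) := by
    linear_combination (Real.exp x - 2 * a) * h3
  rw [h5, relEntropy]
  nlinarith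

lemma sq_le_relEntropy {a : ℝ} (ha : 0 < a) (x : ℝ) :
    (Real.exp x - a) ^ 2 ≤ 2 * (Real.exp x + a) * relEntropy a x := by
  set b := Real.exp (Real.log a / 2) with hb
  set v := Real.exp (x / 2) with hv
  have hb2 : a = b ^ 2 := by
    rw [hb, ← Real.exp_nat_mul]; push_cast; rw [mul_div_cancel₀ _ two_ne_zero, Real.exp_log ha]
  have hv2 : Real.exp x = v ^ 2 := by
    rw [hv, ← Real.exp_nat_mul]; push_cast; rw [mul_div_cancel₀ _ two_ne_zero]
  have hbp : 0 < b := Real.exp_pos _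
  have h1 : (x - Real.log a) / 2 ≤ v / b - 1 := by
    have := Real.add_one_le_exp ((x - Real.log a) / 2)
    rw [sub_div, Real.exp_sub] at this
    rw [sub_div]; linarith
  have h2 : a * (x - Real.log a) ≤ 2 * b * v - 2 * b ^ 2 := by
    have h3 := mul_le_mul_of_nonneg_left h1 (show 0 ≤ 2 * a by positivity)
    have h4 : 2 * a * (v / b - 1) = 2 * b * v - 2 * b ^ 2 := by rw [hb2]; field_simp
    linarith
  have h5 : (v - b) ^ 2 ≤ relEntropy a x := by
    unfold relEntropy; rw [hv2]; nlinarith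
  have h6 : (Real.exp x - a) ^ 2 ≤ 2 * (Real.exp x + a) * (v - b) ^ 2 := by
    rw [hv2, hb2]
    nlinarith [mul_nonneg (sq_nonneg (v - b)) (sq_nonneg (v - b))]
  refine h6.trans ?_
  have := Real.exp_pos x
  gcongr

lemma hasDerivAt_relEntropy {a x' t : ℝ} {x : ℝ → ℝ} (h : HasDerivAt x x' t) :
    HasDerivAt (fun t => relEntropy a (x t)) ((Real.exp (x t) - a) * x') t := by
  have h1 := (h.exp.sub_const a).sub ((h.sub_const (Real.log a)).const_mul a)
  refine h1.congr_deriv ?_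
  ring

namespace Traj

variable {P : Params} {L T : ℝ} {z w : ℝ → ℝ}

/-- The squared distance of `(e ^ x, e ^ y)` from the equilibrium `(p, q)`. -/
def dist2 (P : Params) (t z w : ℝ) : ℝ :=
  (Real.exp (P.xVar t z w) - P.p) ^ 2 + (Real.exp (P.yVar t z w) - P.q) ^ 2

/-- The Lyapunov function of the autonomous system decays exponentially, up to the perturbation
`d / (C - z)` caused by the logarithm. -/
lemma exists_dist2_le_of_abs_le (P : Params) (B : ℝ) : ∃ K c : ℝ, 0 < K ∧ 0 < c ∧
    ∀ {L T : ℝ} {z w : ℝ → ℝ}, Traj P L T z w → ∀ {s t : ℝ}, s ≤ t → t < T →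
    (∀ τ ∈ Icc s t, |P.xVar τ (z τ) (w τ)| ≤ B ∧ |P.yVar τ (z τ) (w τ)| ≤ B) →
    dist2 P t (z t) (w t) ≤ K * Real.exp (-c * (t - s)) + K / (P.C - z t) := by
  have hβ := P.β_pos
  have hm := P.m_pos
  have hp := P.p_pos
  have hq := P.q_pos
  have hd := P.d_nonneg
  set μ := P.m * P.β with hμ
  have hμ0 : 0 < μ := by positivity
  set E := Real.exp B with hE
  have hE0 : 0 < E := Real.exp_pos B
  set c := Real.exp (-B) with hc
  have hc0 : 0 < c := Real.exp_pos _
  set K1 := 2 * (E + P.p) / μ + 2 * (E + P.q) with hK1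
  have hK1' : 0 < K1 := by positivity
  set V0 := E * (μ * (E + P.p) ^ 2 + (E + P.q) ^ 2) with hV0
  have hV0' : 0 < V0 := by positivity
  set N := (E + P.q) * (P.d * E) with hN
  refine ⟨K1 * (V0 + N / c), c, by positivity, hc0, fun {L T z w} h {s t} hst ht hB => ?_⟩
  have hbd : ∀ v : ℝ, |v| ≤ B → Real.exp v ≤ E ∧ Real.exp (-v) ≤ E ∧ c ≤ Real.exp v := by
    intro v hv
    have := abs_le.1 hv
    refine ⟨Real.exp_le_exp.2 this.2, Real.exp_le_exp.2 (by linarith), Real.exp_le_exp.2 this.1⟩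
  have hsq : ∀ v a : ℝ, 0 < a → |v| ≤ B → (Real.exp v - a) ^ 2 ≤ (E + a) ^ 2 := by
    intro v a ha hv
    have := hbd v hv
    have := Real.exp_pos v
    apply sq_le_sq'
    · linarith
    · linarith
  set V : ℝ → ℝ := fun τ => μ * relEntropy P.p (P.xVar τ (z τ) (w τ)) +
    relEntropy P.q (P.yVar τ (z τ) (w τ)) with hV
  have hVle : ∀ τ ∈ Icc s t, V τ ≤ E * (μ * (Real.exp (P.xVar τ (z τ) (w τ)) - P.p) ^ 2 +
      (Real.exp (P.yVar τ (z τ) (w τ)) - P.q) ^ 2) := by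
    intro τ hτ
    obtain ⟨hx, hy⟩ := hB τ hτ
    have h1 := relEntropy_le hp (P.xVar τ (z τ) (w τ))
    have h2 := relEntropy_le hq (P.yVar τ (z τ) (w τ))
    have h3 := mul_le_mul_of_nonneg_left (hbd _ hx).2.1
      (sq_nonneg (Real.exp (P.xVar τ (z τ) (w τ)) - P.p))
    have h4 := mul_le_mul_of_nonneg_left (hbd _ hy).2.1
      (sq_nonneg (Real.exp (P.yVar τ (z τ) (w τ)) - P.q))
    have h5 := mul_le_mul_of_nonneg_left (h1.trans h3) hμ0.le
    simp only [hV]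
    linarith
  have hCt := h.C_sub_pos ht
  have key := le_of_deriv_le_neg_mul_add (V := V) (c := c) (k := N / (P.C - z t)) hc0 hst
    (fun τ hτ => ((hasDerivAt_relEntropy (a := P.p)
      (h.hasDerivAt_x (hτ.2.trans_lt ht))).const_mul μ).add
      (hasDerivAt_relEntropy (a := P.q) (h.hasDerivAt_y (hτ.2.trans_lt ht)))) ?_
  · have hs := left_mem_Icc.2 hst
    have hVs : V s ≤ V0 := by
      refine (hVle s hs).trans ?_
      rw [hV0]
      have h1 := hsq _ _ hp (hB s hs).1
      have h2 := hsq _ _ hq (hB s hs).2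
      gcongr
    have ht' := right_mem_Icc.2 hst
    obtain ⟨hx, hy⟩ := hB t ht'
    have hW : dist2 P t (z t) (w t) ≤ K1 * V t := by
      have h1 := sq_le_relEntropy hp (P.xVar t (z t) (w t))
      have h2 := sq_le_relEntropy hq (P.yVar t (z t) (w t))
      have e1 := (hbd _ hx).1
      have e2 := (hbd _ hy).1
      set x := P.xVar t (z t) (w t)
      set y := P.yVar t (z t) (w t)
      have p1 : 0 ≤ relEntropy P.p x := by
        by_contra! hneg
        have := mul_neg_of_pos_of_neg (show 0 < 2 * (Real.exp x + P.p) by positivity) hneg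
        linarith [sq_nonneg (Real.exp x - P.p)]
      have p2 : 0 ≤ relEntropy P.q y := by
        by_contra! hneg
        have := mul_neg_of_pos_of_neg (show 0 < 2 * (Real.exp y + P.q) by positivity) hneg
        linarith [sq_nonneg (Real.exp y - P.q)]
      have f1 : 2 * (Real.exp x + P.p) * relEntropy P.p x ≤ 2 * (E + P.p) * relEntropy P.p x := by
        gcongr
      have f2 : 2 * (Real.exp y + P.q) * relEntropy P.q y ≤ 2 * (E + P.q) * relEntropy P.q y := by
        gcongr
      have f3 : K1 * V t = 2 * (E + P.p) * relEntropy P.p x + 2 * (E + P.q) * relEntropy P.q y +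
          (2 * (E + P.p) / μ * relEntropy P.q y + 2 * (E + P.q) * μ * relEntropy P.p x) := by
        simp only [hV, hK1]
        field_simp
        ring
      have f4 : 0 ≤ 2 * (E + P.p) / μ * relEntropy P.q y + 2 * (E + P.q) * μ * relEntropy P.p x := by
        positivity
      rw [f3]
      unfold dist2
      linarith
    refine hW.trans ?_
    have hmax : max (N / (P.C - z t)) 0 = N / (P.C - z t) := max_eq_left (by positivity)
    rw [hmax] at key
    have g1 : V s * Real.exp (-c * (t - s)) ≤ (V0 + N / c) * Real.exp (-c * (t - s)) := by
      have : 0 ≤ N / c := by positivity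
      gcongr
      linarith
    have g2 : N / (P.C - z t) / c ≤ (V0 + N / c) / (P.C - z t) := by
      rw [div_right_comm]
      gcongr
      linarith
    have := mul_le_mul_of_nonneg_left (key.trans (add_le_add g1 g2)) hK1'.le
    refine this.trans (le_of_eq ?_)
    ring
  · intro τ hτ
    have hτT := hτ.2.trans_lt ht
    obtain ⟨hx, hy⟩ := hB τ hτ
    have h1 := hVle τ hτ
    have hcE : c * E = 1 := by rw [hc, hE, ← Real.exp_add]; simp
    have h2 := mul_le_mul_of_nonneg_left h1 hc0.le
    rw [← mul_assoc, hcE, one_mul] at h2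
    have hCτ := h.C_sub_pos hτT
    have hz : z τ ≤ z t := h.strictMonoOn.monotoneOn hτT ht hτ.2
    have h3 : (Real.exp (P.yVar τ (z τ) (w τ)) - P.q) *
        (P.d / (P.C - z τ) * Real.exp (P.xVar τ (z τ) (w τ))) ≤ N / (P.C - z t) := by
      have e1 : Real.exp (P.yVar τ (z τ) (w τ)) - P.q ≤ E + P.q := by linarith [(hbd _ hy).1]
      have e2 : P.d / (P.C - z τ) * Real.exp (P.xVar τ (z τ) (w τ)) ≤ P.d / (P.C - z t) * E := by
        have := (hbd _ hx).1
        gcongr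
      calc _ ≤ (E + P.q) * (P.d / (P.C - z τ) * Real.exp (P.xVar τ (z τ) (w τ))) := by
            gcongr
        _ ≤ (E + P.q) * (P.d / (P.C - z t) * E) := by gcongr
        _ = N / (P.C - z t) := by rw [hN]; ring
    have h4 : μ * ((Real.exp (P.xVar τ (z τ) (w τ)) - P.p) *
        ((Real.exp (P.yVar τ (z τ) (w τ)) - P.q) / P.β -
        (Real.exp (P.xVar τ (z τ) (w τ)) - P.p))) =
        P.m * (Real.exp (P.xVar τ (z τ) (w τ)) - P.p) * (Real.exp (P.yVar τ (z τ) (w τ)) - P.q) -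
        μ * (Real.exp (P.xVar τ (z τ) (w τ)) - P.p) ^ 2 := by
      rw [hμ]; field_simp
    rw [h4]
    linarith

/-- Outside its core a solution approaches the equilibrium exponentially fast in `t = log r`,
up to an error of order `1 / (C - log u)`. -/
lemma exists_dist2_le (P : Params) : ∃ K c : ℝ, 0 < K ∧ 0 < c ∧
    ∀ {L T h₀ : ℝ} {z w : ℝ → ℝ}, Traj P L T z w →
    Tendsto (fun t => Real.exp (P.lam (z t))) atBot (𝓝 h₀) →
    ∀ {s t : ℝ}, s ≤ t → t < T → h₀ ≤ Real.exp (P.p * s) →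
    dist2 P t (z t) (w t) ≤ K * Real.exp (-c * (t - s)) + K / (P.C - z t) := by
  obtain ⟨B, hB⟩ := exists_abs_le P
  obtain ⟨K, c, hK, hc, H⟩ := exists_dist2_le_of_abs_le P B
  refine ⟨K, c, hK, hc, fun {L T h₀ z w} h hlim {s t} hst ht hs => H h hst ht fun τ hτ => ?_⟩
  refine hB h hlim τ (hτ.2.trans_lt ht) (hs.trans ?_)
  have := P.p_pos
  have := hτ.1
  gcongr

end Traj

/-! ### Contraction of the distance between two solutions -/

lemma exists_mem_uIcc_sub_eq {f f' : ℝ → ℝ} {a b : ℝ} (hf : ∀ x ∈ uIcc a b, HasDerivAt f (f' x) x) :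
    ∃ ξ ∈ uIcc a b, f b - f a = f' ξ * (b - a) := by
  rcases lt_trichotomy a b with hab | hab | hab
  · rw [uIcc_of_le hab.le] at *
    obtain ⟨ξ, hξ, h⟩ := exists_hasDerivAt_eq_slope f f' hab
      (fun x hx => (hf x hx).continuousAt.continuousWithinAt)
      (fun x hx => hf x (Ioo_subset_Icc_self hx))
    refine ⟨ξ, Ioo_subset_Icc_self hξ, ?_⟩
    rw [h, div_mul_cancel₀ _ (sub_pos.2 hab).ne']
  · subst hab
    exact ⟨a, left_mem_uIcc, by simp⟩
  · rw [uIcc_of_ge hab.le] at *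
    obtain ⟨ξ, hξ, h⟩ := exists_hasDerivAt_eq_slope f f' hab
      (fun x hx => (hf x hx).continuousAt.continuousWithinAt)
      (fun x hx => hf x (Ioo_subset_Icc_self hx))
    refine ⟨ξ, Ioo_subset_Icc_self hξ, ?_⟩
    rw [h, ← neg_sub a b, mul_neg, div_mul_cancel₀ _ (sub_pos.2 hab).ne', neg_sub]

lemma exists_exp_sub_exp_eq {a η x₁ x₂ : ℝ} (h₁ : |Real.exp x₁ - a| ≤ η)
    (h₂ : |Real.exp x₂ - a| ≤ η) :
    ∃ g, |g - a| ≤ η ∧ Real.exp x₂ - Real.exp x₁ = g * (x₂ - x₁) := by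
  obtain ⟨ξ, hξ, h⟩ := exists_mem_uIcc_sub_eq (f := Real.exp) (f' := Real.exp) (a := x₁) (b := x₂)
    fun x _ => Real.hasDerivAt_exp x
  refine ⟨Real.exp ξ, ?_, h⟩
  rw [abs_le] at *
  rcases mem_uIcc.1 hξ with ⟨h3, h4⟩ | ⟨h3, h4⟩ <;>
  · have := Real.exp_le_exp.2 h3
    have := Real.exp_le_exp.2 h4
    constructor <;> linarith

namespace Params

variable (P : Params)

lemma exists_lam_sub_eq {L z₁ z₂ : ℝ} (hL : 0 < L) (h₁ : z₁ ≤ P.C - L) (h₂ : z₂ ≤ P.C - L) :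
    ∃ τ, 0 ≤ τ ∧ τ ≤ P.d / (P.m + P.β) / L ∧ P.lam z₂ - P.lam z₁ = (1 - τ) * (z₂ - z₁) := by
  have hle : ∀ z ∈ uIcc z₁ z₂, z ≤ P.C - L := by
    intro z hz
    exact hz.2.trans (max_le h₁ h₂)
  have hderiv : ∀ z ∈ uIcc z₁ z₂,
      HasDerivAt P.lam (1 - P.d / (P.m + P.β) / (P.C - z)) z := by
    intro z hz
    have h0 := hle z hz
    have h1 := ((hasDerivAt_id z).const_sub P.C).log (x := z) (by simp; linarith)
    refine ((hasDerivAt_id z).add (h1.const_mul (P.d / (P.m + P.β)))).congr_deriv ?_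
    simp only [id]
    ring
  obtain ⟨ξ, hξ, h⟩ := exists_mem_uIcc_sub_eq hderiv
  have h0 := hle ξ hξ
  have hmβ := P.mβ_pos
  have hd := P.d_nonneg
  have h3 : 0 < P.C - ξ := by linarith
  refine ⟨P.d / (P.m + P.β) / (P.C - ξ), by positivity, ?_, h⟩
  gcongr
  linarith

end Params

namespace Traj

/-- The distance in `z = log u` is controlled by the distances in `x` and `y`. -/
lemma abs_z_sub_le {P : Params} {L z₁ z₂ w₁ w₂ t : ℝ} (hL : 0 < L)
    (hL' : P.d / (P.m + P.β) / L ≤ 1 / 2) (h₁ : z₁ ≤ P.C - L) (h₂ : z₂ ≤ P.C - L) :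
    |z₂ - z₁| ≤ 2 * (|P.xVar t z₂ w₂ - P.xVar t z₁ w₁| + |P.yVar t z₂ w₂ - P.yVar t z₁ w₁|) := by
  obtain ⟨τ, hτ0, hτ, hlam⟩ := P.exists_lam_sub_eq hL h₁ h₂
  have e1 := P.xVar_yVar t z₁ w₁
  have e2 := P.xVar_yVar t z₂ w₂
  have hβ := P.β_pos
  have hβ1 := P.one_le_β
  have hm := P.β_lt_m
  set δx := P.xVar t z₂ w₂ - P.xVar t z₁ w₁ with hδx
  set δy := P.yVar t z₂ w₂ - P.yVar t z₁ w₁ with hδy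
  have e3 : (P.m + P.β) * (1 - τ) * (z₂ - z₁) = -(P.β * δx + δy) := by
    have : (P.m + P.β) * (P.lam z₂ - P.lam z₁) = -(P.β * δx + δy) := by rw [hδx, hδy]; linarith
    rw [← this, hlam]; ring
  have e4 : (P.m + P.β) * (1 - τ) * |z₂ - z₁| ≤ P.β * |δx| + |δy| := by
    have h1 : 0 ≤ (P.m + P.β) * (1 - τ) := mul_nonneg (by linarith) (by linarith)
    have h2 := congrArg abs e3
    rw [abs_mul, abs_of_nonneg h1, abs_neg] at h2
    rw [h2]
    refine (abs_add_le _ _).trans ?_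
    rw [abs_mul, abs_of_pos hβ]
  have h5 : P.β * |z₂ - z₁| ≤ (P.m + P.β) * (1 - τ) * |z₂ - z₁| := by
    gcongr
    nlinarith
  have h6 : P.β * |z₂ - z₁| ≤ P.β * (|δx| + |δy|) := by
    have := mul_le_mul_of_nonneg_right hβ1 (abs_nonneg δy)
    linarith
  have h7 := le_of_mul_le_mul_left h6 hβ
  have := abs_nonneg δx
  have := abs_nonneg δy
  linarith

/-- Weighted squared distance of two solutions in the `(x, y)`-plane; the weight makes the
linearization at the equilibrium dissipative. -/
def sep (P : Params) (t z₁ w₁ z₂ w₂ : ℝ) : ℝ :=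
  (P.m * P.p * P.β / P.q * (P.xVar t z₂ w₂ - P.xVar t z₁ w₁) ^ 2 +
    (P.yVar t z₂ w₂ - P.yVar t z₁ w₁) ^ 2) / 2

lemma abs_sub_le_of_dist2_le {P : Params} {t z w η : ℝ} (hη : 0 ≤ η)
    (h : dist2 P t z w ≤ η ^ 2) :
    |Real.exp (P.xVar t z w) - P.p| ≤ η ∧ |Real.exp (P.yVar t z w) - P.q| ≤ η := by
  unfold dist2 at h
  have h1 := sq_nonneg (Real.exp (P.xVar t z w) - P.p)
  have h2 := sq_nonneg (Real.exp (P.yVar t z w) - P.q)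
  exact ⟨abs_le_of_sq_le_sq (by linarith) hη, abs_le_of_sq_le_sq (by linarith) hη⟩

/-- Lipschitz bound for the perturbation `d / (C - z) * e ^ x`. -/
lemma abs_perturbation_sub_le {d L κ p a b e₁ e₂ g X Y Z : ℝ} (hd : 0 ≤ d) (hp : 0 ≤ p)
    (hκ : 0 ≤ κ) (hL : 1 ≤ L) (ha : L ≤ a) (hb : L ≤ b) (he : 0 ≤ e₁) (he' : e₁ ≤ p + 1)
    (hg : |g| ≤ p + 1) (hgX : e₂ - e₁ = g * X) (hZ : a - b = Z) (hZ' : |Z| ≤ 2 * (|X| + |Y|))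
    (hdL : 24 * d * (p + 1) ≤ κ * L) :
    |d / b * e₂ - d / a * e₁| ≤ κ / 8 * (|X| + |Y|) := by
  have hL0 : 0 < L := by linarith
  have ha0 : 0 < a := by linarith
  have hb0 : 0 < b := by linarith
  have h1 : d / b * e₂ - d / a * e₁ = d / b * (g * X) + d / (a * b) * e₁ * Z := by
    rw [← hgX, ← hZ]
    field_simp
    ring
  have b1 : |d / b * (g * X)| ≤ d / L * ((p + 1) * |X|) := by
    rw [abs_mul, abs_mul, abs_of_nonneg (show 0 ≤ d / b by positivity)]
    gcongr
  have b2 : |d / (a * b) * e₁ * Z| ≤ d / L * (p + 1) * (2 * (|X| + |Y|)) := by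
    rw [abs_mul, abs_of_nonneg (show 0 ≤ d / (a * b) * e₁ by positivity)]
    have : L ≤ a * b := by
      calc L ≤ a := ha
        _ ≤ a * b := le_mul_of_one_le_right ha0.le (by linarith)
    gcongr
  have b3 : d / L * (p + 1) ≤ κ / 24 := by
    rw [div_mul_eq_mul_div, div_le_iff₀ hL0]
    linarith
  have b5 : 0 ≤ κ * |Y| := by positivity
  rw [h1]
  refine (abs_add_le _ _).trans ((add_le_add b1 b2).trans ?_)
  calc _ = d / L * (p + 1) * (|X| + 2 * (|X| + |Y|)) := by ring
    _ ≤ κ / 24 * (|X| + 2 * (|X| + |Y|)) := by gcongr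
    _ ≤ κ / 8 * (|X| + |Y|) := by linarith

/-- The pointwise dissipation inequality behind the contraction of `sep`. -/
lemma dissipation {A p q β m η ε κ g k X Y R : ℝ} (hβ : 0 < β) (hm : 0 < m) (hp : 0 < p)
    (hq : 0 < q) (hA : A = m * p * β / q) (hκ1 : κ ≤ A * p / 2) (hκ2 : κ ≤ q / 2)
    (hηp : η ≤ p / 2) (hηq : η ≤ q / 2) (hη : m * (p / q + 1) * η ≤ κ / 4)
    (hε : ε ≤ κ / 8) (hg : |g - p| ≤ η) (hk : |k - q| ≤ η) (hR : |R| ≤ ε * (|X| + |Y|)) :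
    A * X * (k * Y / β - g * X) + Y * (-m * (g * X) - k * Y + R) ≤ -(κ / 2) * (X ^ 2 + Y ^ 2) := by
  have hApos : 0 < A := by rw [hA]; positivity
  have hη0 : 0 ≤ η := (abs_nonneg _).trans hg
  have e1 : A * X * (k * Y / β - g * X) + Y * (-m * (g * X) - k * Y + R) =
      -(A * g * X ^ 2) - k * Y ^ 2 + m * (p / q * (k - q) - (g - p)) * (X * Y) + Y * R := by
    rw [hA]; field_simp; ring
  have hg' := abs_le.1 hg
  have hk' := abs_le.1 hk
  have e2 : κ * X ^ 2 ≤ A * g * X ^ 2 := by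
    have : A * (p / 2) ≤ A * g := by gcongr; linarith
    have : κ ≤ A * g := by linarith
    gcongr
  have e3 : κ * Y ^ 2 ≤ k * Y ^ 2 := by
    have : κ ≤ k := by linarith
    gcongr
  have hXY : |X| * |Y| ≤ (X ^ 2 + Y ^ 2) / 2 := by
    have := sq_nonneg (|X| - |Y|)
    rw [sub_sq, sq_abs, sq_abs] at this
    linarith
  have e4 : m * (p / q * (k - q) - (g - p)) * (X * Y) ≤ κ / 8 * (X ^ 2 + Y ^ 2) := by
    have h1 : |p / q * (k - q) - (g - p)| ≤ (p / q + 1) * η := by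
      refine (abs_sub _ _).trans ?_
      rw [abs_mul, abs_of_pos (show 0 < p / q by positivity)]
      have : p / q * |k - q| ≤ p / q * η := by gcongr
      linarith
    calc m * (p / q * (k - q) - (g - p)) * (X * Y)
        ≤ |m * (p / q * (k - q) - (g - p)) * (X * Y)| := le_abs_self _
      _ = m * |p / q * (k - q) - (g - p)| * (|X| * |Y|) := by
          rw [abs_mul, abs_mul, abs_mul, abs_of_pos hm]
      _ ≤ m * ((p / q + 1) * η) * ((X ^ 2 + Y ^ 2) / 2) := by gcongr
      _ ≤ κ / 4 * ((X ^ 2 + Y ^ 2) / 2) := by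
          gcongr
          linarith
      _ = κ / 8 * (X ^ 2 + Y ^ 2) := by ring
  have e5 : Y * R ≤ κ / 4 * (X ^ 2 + Y ^ 2) := by
    have hκ0 : 0 ≤ κ := by
      have : 0 ≤ m * (p / q + 1) * η := by positivity
      linarith
    calc Y * R ≤ |Y * R| := le_abs_self _
      _ = |Y| * |R| := abs_mul _ _
      _ ≤ |Y| * (κ / 8 * (|X| + |Y|)) := by
          gcongr
          exact hR.trans (by gcongr)
      _ = κ / 8 * (|X| * |Y| + Y ^ 2) := by rw [← sq_abs Y]; ring
      _ ≤ κ / 8 * (2 * (X ^ 2 + Y ^ 2)) := by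
          gcongr
          linarith [sq_nonneg X, sq_nonneg Y]
      _ = κ / 4 * (X ^ 2 + Y ^ 2) := by ring
  rw [e1]
  have : 0 ≤ κ * (X ^ 2 + Y ^ 2) := by
    have hκ0 : 0 ≤ κ := by
      have : 0 ≤ m * (p / q + 1) * η := by positivity
      linarith
    positivity
  linarith

/-- Near the equilibrium, and for small values of `u`, two solutions approach each other
exponentially fast in `t = log r`. -/
lemma exists_sep_le_of_near (P : Params) : ∃ η L₀ c : ℝ, 0 < η ∧ 0 < L₀ ∧
    P.d / (P.m + P.β) / L₀ ≤ 1 / 2 ∧ 0 < c ∧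
    ∀ {L T : ℝ} {z₁ w₁ z₂ w₂ : ℝ → ℝ}, L₀ ≤ L → Traj P L T z₁ w₁ → Traj P L T z₂ w₂ →
    ∀ {s t : ℝ}, s ≤ t → t < T →
    (∀ τ ∈ Icc s t, dist2 P τ (z₁ τ) (w₁ τ) ≤ η ^ 2 ∧ dist2 P τ (z₂ τ) (w₂ τ) ≤ η ^ 2) →
    sep P t (z₁ t) (w₁ t) (z₂ t) (w₂ t) ≤
      sep P s (z₁ s) (w₁ s) (z₂ s) (w₂ s) * Real.exp (-c * (t - s)) := by
  have hβ := P.β_pos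
  have hm := P.m_pos
  have hp := P.p_pos
  have hq := P.q_pos
  have hd := P.d_nonneg
  set A := P.m * P.p * P.β / P.q with hA
  have hA0 : 0 < A := by positivity
  set κ := min (A * P.p / 2) (P.q / 2) with hκ
  have hκ0 : 0 < κ := lt_min (by positivity) (by positivity)
  set D := P.m * (P.p / P.q + 1) with hD
  have hD0 : 0 < D := by positivity
  set η := min (min 1 (κ / (4 * D))) (min (P.p / 2) (P.q / 2)) with hη
  have hη0 : 0 < η := by
    refine lt_min (lt_min one_pos (by positivity)) (lt_min (by positivity) (by positivity))
  have hη1 : η ≤ 1 := (min_le_left _ _).trans (min_le_left _ _)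
  have hηκ : D * η ≤ κ / 4 := by
    have : η ≤ κ / (4 * D) := (min_le_left _ _).trans (min_le_right _ _)
    calc D * η ≤ D * (κ / (4 * D)) := by gcongr
      _ = κ / 4 := by field_simp
  have hηp : η ≤ P.p / 2 := (min_le_right _ _).trans (min_le_left _ _)
  have hηq : η ≤ P.q / 2 := (min_le_right _ _).trans (min_le_right _ _)
  set L₀ := max (max 1 (2 * (P.d / (P.m + P.β)))) (24 * P.d * (P.p + 1) / κ) with hL₀
  have hL1 : 1 ≤ L₀ := (le_max_left _ _).trans (le_max_left _ _)
  have hL2 : 2 * (P.d / (P.m + P.β)) ≤ L₀ := (le_max_right _ _).trans (le_max_left _ _)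
  have hL3 : 24 * P.d * (P.p + 1) / κ ≤ L₀ := le_max_right _ _
  have hL₀p : 0 < L₀ := by linarith
  set c := κ / max A 1 with hc
  have hc0 : 0 < c := by positivity
  have hτL : P.d / (P.m + P.β) / L₀ ≤ 1 / 2 := by
    rw [div_le_iff₀ hL₀p]; linarith
  refine ⟨η, L₀, c, hη0, hL₀p, hτL, hc0, fun {L T z₁ w₁ z₂ w₂} hL h₁ h₂ {s t} hst ht hnear => ?_⟩
  have hLp : 0 < L := h₁.L_pos
  have hτL' : P.d / (P.m + P.β) / L ≤ 1 / 2 := by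
    refine le_trans ?_ hτL
    gcongr
  have key := le_of_deriv_le_neg_mul_add (k := 0) hc0 hst
    (V := fun τ => sep P τ (z₁ τ) (w₁ τ) (z₂ τ) (w₂ τ))
    (fun τ hτ => by
      have hτT := hτ.2.trans_lt ht
      exact ((((((h₂.hasDerivAt_x hτT).sub (h₁.hasDerivAt_x hτT)).pow 2).const_mul A).add
        (((h₂.hasDerivAt_y hτT).sub (h₁.hasDerivAt_y hτT)).pow 2)).div_const 2)) ?_
  · simpa using key
  · intro τ hτ
    have hτT := hτ.2.trans_lt ht
    obtain ⟨hn1, hn2⟩ := hnear τ hτ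
    obtain ⟨hx1, hy1⟩ := abs_sub_le_of_dist2_le hη0.le hn1
    obtain ⟨hx2, hy2⟩ := abs_sub_le_of_dist2_le hη0.le hn2
    have hz1 := h₁.le τ hτT
    have hz2 := h₂.le τ hτT
    have hzz := abs_z_sub_le (w₁ := w₁ τ) (w₂ := w₂ τ) (t := τ) hLp hτL' hz1 hz2
    obtain ⟨g, hg, hgx⟩ := exists_exp_sub_exp_eq hx1 hx2
    obtain ⟨k, hk, hky⟩ := exists_exp_sub_exp_eq hy1 hy2
    have hxbd := abs_le.1 hx1
    simp only [sep, Pi.sub_apply, ← hA]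
    set x₁ := P.xVar τ (z₁ τ) (w₁ τ)
    set x₂ := P.xVar τ (z₂ τ) (w₂ τ)
    set y₁ := P.yVar τ (z₁ τ) (w₁ τ)
    set y₂ := P.yVar τ (z₂ τ) (w₂ τ)
    set R := P.d / (P.C - z₂ τ) * Real.exp x₂ - P.d / (P.C - z₁ τ) * Real.exp x₁ with hR
    have hC1 : L ≤ P.C - z₁ τ := by linarith
    have hC2 : L ≤ P.C - z₂ τ := by linarith
    have hRle : |R| ≤ κ / 8 * (|x₂ - x₁| + |y₂ - y₁|) := by
      refine abs_perturbation_sub_le (Z := z₂ τ - z₁ τ) hd hp.le hκ0.le (hL1.trans hL) hC1 hC2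
        (Real.exp_pos _).le (by linarith) ?_ hgx (by ring) hzz ?_
      · have := abs_le.1 hg
        rw [abs_le]; constructor <;> linarith
      · rw [div_le_iff₀ hκ0] at hL3
        exact hL3.trans ((mul_le_mul_of_nonneg_right hL hκ0.le).trans (le_of_eq (mul_comm _ _)))
    have hdis := dissipation (X := x₂ - x₁) (Y := y₂ - y₁) hβ hm hp hq hA (min_le_left _ _)
      (min_le_right _ _) hηp hηq hηκ le_rfl hg hk hRle
    have hE : c * ((A * (x₂ - x₁) ^ 2 + (y₂ - y₁) ^ 2) / 2) ≤
        κ / 2 * ((x₂ - x₁) ^ 2 + (y₂ - y₁) ^ 2) := by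
      have h1 : A * (x₂ - x₁) ^ 2 ≤ max A 1 * (x₂ - x₁) ^ 2 := by
        gcongr; exact le_max_left _ _
      have h2 : 1 * (y₂ - y₁) ^ 2 ≤ max A 1 * (y₂ - y₁) ^ 2 := by
        gcongr; exact le_max_right _ _
      calc c * ((A * (x₂ - x₁) ^ 2 + (y₂ - y₁) ^ 2) / 2)
          ≤ c * ((max A 1 * (x₂ - x₁) ^ 2 + max A 1 * (y₂ - y₁) ^ 2) / 2) := by
            gcongr
            linarith
        _ = κ / 2 * ((x₂ - x₁) ^ 2 + (y₂ - y₁) ^ 2) := by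
            rw [hc]; field_simp
    have hkey : A * (x₂ - x₁) * (k * (y₂ - y₁) / P.β - g * (x₂ - x₁)) +
        (y₂ - y₁) * (-P.m * (g * (x₂ - x₁)) - k * (y₂ - y₁) + R) ≤
        -c * ((A * (x₂ - x₁) ^ 2 + (y₂ - y₁) ^ 2) / 2) + 0 := by linarith
    refine le_trans (le_of_eq ?_) hkey
    rw [← hgx, ← hky, hR]
    push_cast
    ring

lemma abs_le_of_weighted_sq_le {A M e X Y : ℝ} (hA : 0 < A) (hM : 0 ≤ M) (he : 0 ≤ e)
    (h : (A * X ^ 2 + Y ^ 2) / 2 ≤ M * e ^ 2) :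
    |X| ≤ (√(2 * M / A) + √(2 * M)) * e ∧ |Y| ≤ (√(2 * M / A) + √(2 * M)) * e := by
  have h1 := Real.sqrt_nonneg (2 * M / A)
  have h2 := Real.sqrt_nonneg (2 * M)
  have hX2 : 0 ≤ A * X ^ 2 := by positivity
  have hY2 := sq_nonneg Y
  constructor
  · have : X ^ 2 ≤ (√(2 * M / A) * e) ^ 2 := by
      rw [mul_pow, Real.sq_sqrt (by positivity), div_mul_eq_mul_div, le_div_iff₀ hA]
      linarith
    refine (abs_le_of_sq_le_sq this (by positivity)).trans ?_
    gcongr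
    linarith
  · have : Y ^ 2 ≤ (√(2 * M) * e) ^ 2 := by
      rw [mul_pow, Real.sq_sqrt (by positivity)]
      linarith
    refine (abs_le_of_sq_le_sq this (by positivity)).trans ?_
    gcongr
    linarith

/-- Two solutions approach each other exponentially fast in `t = log r` outside their cores. -/
lemma exists_abs_sub_le (P : Params) : ∃ L₀ K c : ℝ, 0 < L₀ ∧ 0 < K ∧ 0 < c ∧
    ∀ {L T h₁ h₂ : ℝ} {z₁ w₁ z₂ w₂ : ℝ → ℝ}, L₀ ≤ L → Traj P L T z₁ w₁ → Traj P L T z₂ w₂ →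
    Tendsto (fun t => Real.exp (P.lam (z₁ t))) atBot (𝓝 h₁) →
    Tendsto (fun t => Real.exp (P.lam (z₂ t))) atBot (𝓝 h₂) →
    ∀ {s t : ℝ}, s ≤ t → t < T → h₁ ≤ Real.exp (P.p * s) → h₂ ≤ Real.exp (P.p * s) →
    |P.xVar t (z₂ t) (w₂ t) - P.xVar t (z₁ t) (w₁ t)| ≤ K * Real.exp (-c * (t - s)) ∧
    |P.yVar t (z₂ t) (w₂ t) - P.yVar t (z₁ t) (w₁ t)| ≤ K * Real.exp (-c * (t - s)) ∧
    |z₂ t - z₁ t| ≤ K * Real.exp (-c * (t - s)) := by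
  obtain ⟨B, hB⟩ := exists_abs_le P
  obtain ⟨K3, c3, hK3, hc3, hdist⟩ := exists_dist2_le P
  obtain ⟨η, L1, c, hη, hL1, hτL, hc, hsep⟩ := exists_sep_le_of_near P
  have hp := P.p_pos
  have hβ := P.β_pos
  have hm := P.m_pos
  have hq := P.q_pos
  have hd := P.d_nonneg
  set A := P.m * P.p * P.β / P.q with hA
  have hA0 : 0 < A := by positivity
  -- after the waiting time `R` the exponential term of the Lyapunov estimate is negligible
  obtain ⟨R, hR0, hR⟩ : ∃ R : ℝ, 0 ≤ R ∧ K3 * Real.exp (-c3 * R) ≤ η ^ 2 / 2 := by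
    have h1 : Tendsto (fun R : ℝ => K3 * Real.exp (-c3 * R)) atTop (𝓝 (K3 * 0)) :=
      (Real.tendsto_exp_atBot.comp (tendsto_id.const_mul_atTop_of_neg (by linarith))).const_mul K3
    rw [mul_zero] at h1
    obtain ⟨R, hR⟩ := ((h1.eventually_lt_const (show 0 < η ^ 2 / 2 by positivity)).and
      (eventually_ge_atTop 0)).exists
    exact ⟨R, hR.2, hR.1.le⟩
  set L₀ := max L1 (2 * K3 / η ^ 2) with hL₀
  set M := (A + 1) / 2 * (2 * |B|) ^ 2 * Real.exp (c * R) with hM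
  have hM0 : 0 ≤ M := by positivity
  set S := Real.sqrt (2 * M / A) + Real.sqrt (2 * M) with hS
  refine ⟨L₀, 4 * S + 1, c / 2, lt_max_of_lt_left hL1, by positivity, by positivity,
    fun {L T h₁ h₂ z₁ w₁ z₂ w₂} hL H₁ H₂ hl₁ hl₂ {s t} hst ht hs₁ hs₂ => ?_⟩
  have hmono : ∀ {τ}, s ≤ τ → Real.exp (P.p * s) ≤ Real.exp (P.p * τ) := fun hτ => by gcongr
  have hLp : 0 < L := H₁.L_pos
  have hLL1 : L1 ≤ L := (le_max_left _ _).trans hL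
  have hτL' : P.d / (P.m + P.β) / L ≤ 1 / 2 := by
    refine le_trans ?_ hτL
    gcongr
  have hcrude : ∀ τ, s ≤ τ → τ < T →
      sep P τ (z₁ τ) (w₁ τ) (z₂ τ) (w₂ τ) ≤ (A + 1) / 2 * (2 * |B|) ^ 2 := by
    intro τ hsτ hτ
    obtain ⟨a1, a2⟩ := hB H₁ hl₁ τ hτ (hs₁.trans (hmono hsτ))
    obtain ⟨a3, a4⟩ := hB H₂ hl₂ τ hτ (hs₂.trans (hmono hsτ))
    have hBB := le_abs_self B
    have b1 : (P.xVar τ (z₂ τ) (w₂ τ) - P.xVar τ (z₁ τ) (w₁ τ)) ^ 2 ≤ (2 * |B|) ^ 2 := by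
      rw [← sq_abs]
      gcongr
      exact (abs_sub _ _).trans (by linarith)
    have b2 : (P.yVar τ (z₂ τ) (w₂ τ) - P.yVar τ (z₁ τ) (w₁ τ)) ^ 2 ≤ (2 * |B|) ^ 2 := by
      rw [← sq_abs]
      gcongr
      exact (abs_sub _ _).trans (by linarith)
    unfold sep
    rw [← hA]
    have := mul_le_mul_of_nonneg_left b1 hA0.le
    linarith
  have hη2 : ∀ {z w : ℝ → ℝ} {h₀ : ℝ}, Traj P L T z w →
      Tendsto (fun t => Real.exp (P.lam (z t))) atBot (𝓝 h₀) → h₀ ≤ Real.exp (P.p * s) →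
      ∀ τ, s + R ≤ τ → τ < T → dist2 P τ (z τ) (w τ) ≤ η ^ 2 := by
    intro z w h₀ H hl hs τ hτ hτT
    refine (hdist H hl (by linarith) hτT hs).trans ?_
    have e1 : K3 * Real.exp (-c3 * (τ - s)) ≤ η ^ 2 / 2 := by
      refine le_trans ?_ hR
      gcongr K3 * Real.exp ?_
      nlinarith
    have e2 : K3 / (P.C - z τ) ≤ η ^ 2 / 2 := by
      have h2 : 2 * K3 / η ^ 2 ≤ P.C - z τ := by
        have := (le_max_right L1 (2 * K3 / η ^ 2)).trans hL
        linarith [H.le τ hτT]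
      rw [div_le_iff₀ (by positivity)] at h2
      rw [div_le_iff₀ (H.C_sub_pos hτT)]
      linarith
    linarith
  have hE : sep P t (z₁ t) (w₁ t) (z₂ t) (w₂ t) ≤ M * Real.exp (-c * (t - s)) := by
    have e0 : M * Real.exp (-c * (t - s)) =
        (A + 1) / 2 * (2 * |B|) ^ 2 * Real.exp (-c * (t - (s + R))) := by
      rw [hM, mul_assoc, ← Real.exp_add]; ring_nf
    rw [e0]
    rcases le_total (s + R) t with h | h
    · refine (hsep hLL1 H₁ H₂ h ht fun τ hτ => ⟨hη2 H₁ hl₁ hs₁ τ hτ.1 (hτ.2.trans_lt ht),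
        hη2 H₂ hl₂ hs₂ τ hτ.1 (hτ.2.trans_lt ht)⟩).trans ?_
      gcongr
      exact hcrude _ (by linarith) (by linarith)
    · refine (hcrude t hst ht).trans ?_
      have h1 : 1 ≤ Real.exp (-c * (t - (s + R))) := Real.one_le_exp (by nlinarith)
      exact le_mul_of_one_le_right (by positivity) h1
  have hroot : Real.exp (-c * (t - s)) = Real.exp (-(c / 2) * (t - s)) ^ 2 := by
    rw [← Real.exp_nat_mul]; push_cast; ring_nf
  rw [hroot] at hE
  set e := Real.exp (-(c / 2) * (t - s))
  have he0 : 0 < e := Real.exp_pos _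
  unfold sep at hE
  rw [← hA] at hE
  have hz := abs_z_sub_le (w₁ := w₁ t) (w₂ := w₂ t) (t := t) hLp hτL' (H₁.le t ht) (H₂.le t ht)
  obtain ⟨hX, hY⟩ := abs_le_of_weighted_sq_le hA0 hM0 he0.le hE
  rw [← hS] at hX hY
  have hSe : 0 ≤ S * e := by positivity
  have h4 : (4 * S + 1) * e = 4 * (S * e) + e := by ring
  rw [h4]
  exact ⟨by linarith, by linarith, by linarith⟩

end Traj

/-! ### Rotation of the difference of two solutions -/

/-- A quadratic form with negative discriminant is positive definite, and stays so under small
perturbations of its coefficients. -/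
lemma rotation_le {a b c ω η ν g h c' σ : ℝ} (ha : 0 < a) (hc : 0 < c)
    (hω : ω = (4 * a * c - b ^ 2) / (8 * (a + c))) (hω0 : 0 < ω) (hη : η ≤ ω / 4)
    (hg : |g - a| ≤ η) (hh : |h - b| ≤ 2 * η) (hc' : |c' - c| ≤ ν) (hν : ν ≤ ω / 2) :
    ω * (1 + σ ^ 2) ≤ g * σ ^ 2 + h * σ + c' := by
  have e1 : 8 * (a + c) * ω = 4 * a * c - b ^ 2 := by rw [hω]; field_simp
  have e2 : 0 < a - 2 * ω := by
    by_contra! hneg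
    have : 4 * (a + c) * a ≤ 8 * (a + c) * ω := by nlinarith
    nlinarith [sq_nonneg b]
  have e3 : 2 * ω * (1 + σ ^ 2) ≤ a * σ ^ 2 + b * σ + c := by
    have h1 : b ^ 2 ≤ 4 * (a - 2 * ω) * (c - 2 * ω) := by nlinarith [sq_nonneg ω]
    have h2 : 0 ≤ (a - 2 * ω) * ((a - 2 * ω) * σ ^ 2 + b * σ + (c - 2 * ω)) := by
      nlinarith [sq_nonneg (2 * (a - 2 * ω) * σ + b)]
    have h3 := nonneg_of_mul_nonneg_right h2 e2
    linarith
  have hη0 : 0 ≤ η := (abs_nonneg _).trans hg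
  have f1 : -(η * σ ^ 2) ≤ (g - a) * σ ^ 2 := by
    have := mul_le_mul_of_nonneg_right (neg_le_of_abs_le hg) (sq_nonneg σ)
    linarith
  have f2 : -(η * (1 + σ ^ 2)) ≤ (h - b) * σ := by
    have h1 : |(h - b) * σ| ≤ 2 * η * |σ| := by rw [abs_mul]; gcongr
    have h2 : 2 * |σ| ≤ 1 + σ ^ 2 := by
      rw [← sq_abs]; linarith [sq_nonneg (|σ| - 1), sub_sq |σ| 1]
    have h3 := neg_le_of_abs_le h1
    have h4 := mul_le_mul_of_nonneg_left h2 hη0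
    linarith
  have f3 := neg_le_of_abs_le hc'
  have f4 : η * (1 + σ ^ 2) ≤ ω / 4 * (1 + σ ^ 2) := by gcongr
  linarith [mul_nonneg hω0.le (sq_nonneg σ)]

namespace Traj

/-- If the linearization at the equilibrium has non-real eigenvalues, two solutions near the
equilibrium cannot stay apart on a long interval of `t = log r`: the slope of `(δz, δx)`
satisfies a Riccati inequality and blows up. -/
lemma exists_length_le (P : Params)
    (hdisc : (P.q + P.p) ^ 2 < 4 * P.p * (P.q * (P.m + P.β) / P.β)) :
    ∃ η L₀ Λ : ℝ, 0 < η ∧ 0 < L₀ ∧ 0 < Λ ∧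
    ∀ {L T : ℝ} {z₁ w₁ z₂ w₂ : ℝ → ℝ}, Traj P L T z₁ w₁ → Traj P L T z₂ w₂ →
    ∀ {s t : ℝ}, s ≤ t → t < T →
    (∀ τ ∈ Icc s t, dist2 P τ (z₁ τ) (w₁ τ) ≤ η ^ 2 ∧ dist2 P τ (z₂ τ) (w₂ τ) ≤ η ^ 2 ∧
      z₁ τ ≤ P.C - L₀ ∧ z₂ τ ≤ P.C - L₀ ∧ z₂ τ ≠ z₁ τ) →
    t - s ≤ Λ := by
  have hβ := P.β_pos
  have hm := P.m_pos
  have hp := P.p_pos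
  have hq := P.q_pos
  set c := P.q * (P.m + P.β) / P.β with hc
  have hc0 : 0 < c := by positivity
  set ω := (4 * P.p * c - (P.q + P.p) ^ 2) / (8 * (P.p + c)) with hω
  have hω0 : 0 < ω := div_pos (by linarith) (by positivity)
  set N := (P.m + P.β) / P.β with hN
  have hN0 : 0 < N := by positivity
  set η := min (min 1 (ω / 4)) (ω / (4 * N)) with hη
  have hη0 : 0 < η := lt_min (lt_min one_pos (by positivity)) (by positivity)
  have hη1 : η ≤ 1 := (min_le_left _ _).trans (min_le_left _ _)
  have hη2 : η ≤ ω / 4 := (min_le_left _ _).trans (min_le_right _ _)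
  have hη3 : η * N ≤ ω / 4 := by
    have : η ≤ ω / (4 * N) := min_le_right _ _
    calc η * N ≤ ω / (4 * N) * N := by gcongr
      _ = ω / 4 := by field_simp
  set L₀ := max 1 (4 * ((P.q + 1) * (P.d / P.β)) / ω) with hL₀
  have hL₀p : 0 < L₀ := lt_max_of_lt_left one_pos
  have hL₀' : (P.q + 1) * (P.d / (P.m + P.β) / L₀) * N ≤ ω / 4 := by
    have h1 : 4 * ((P.q + 1) * (P.d / P.β)) / ω ≤ L₀ := le_max_right _ _
    rw [div_le_iff₀ hω0] at h1
    have h2 : (P.q + 1) * (P.d / (P.m + P.β) / L₀) * N = (P.q + 1) * (P.d / P.β) / L₀ := by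
      rw [hN]; field_simp
    rw [h2, div_le_iff₀ hL₀p]
    linarith
  refine ⟨η, L₀, Real.pi / ω, hη0, hL₀p, div_pos Real.pi_pos hω0,
    fun {L T z₁ w₁ z₂ w₂} h₁ h₂ {s t} hst ht hnear => ?_⟩
  set σ : ℝ → ℝ := fun τ => (P.xVar τ (z₂ τ) (w₂ τ) - P.xVar τ (z₁ τ) (w₁ τ)) / (z₂ τ - z₁ τ) with hσ
  have hder : ∀ τ ∈ Icc s t, ∃ σ', HasDerivAt σ σ' τ ∧ σ' ≤ -ω * (1 + σ τ ^ 2) := by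
    intro τ hτ
    have hτT := hτ.2.trans_lt ht
    obtain ⟨hn1, hn2, hz1, hz2, hne⟩ := hnear τ hτ
    obtain ⟨hx1, hy1⟩ := abs_sub_le_of_dist2_le hη0.le hn1
    obtain ⟨hx2, hy2⟩ := abs_sub_le_of_dist2_le hη0.le hn2
    obtain ⟨g, hg, hgx⟩ := exists_exp_sub_exp_eq hx1 hx2
    obtain ⟨k, hk, hky⟩ := exists_exp_sub_exp_eq hy1 hy2
    obtain ⟨κ, hκ0, hκ, hlam⟩ := P.exists_lam_sub_eq hL₀p hz1 hz2
    have hne' : z₂ τ - z₁ τ ≠ 0 := sub_ne_zero.2 hne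
    refine ⟨_, ((h₂.hasDerivAt_x hτT).sub (h₁.hasDerivAt_x hτT)).div
      ((h₂.hasDerivAt_z τ hτT).sub (h₁.hasDerivAt_z τ hτT)) hne', ?_⟩
    have e1 := P.xVar_yVar τ (z₁ τ) (w₁ τ)
    have e2 := P.xVar_yVar τ (z₂ τ) (w₂ τ)
    have hc' : |k * (1 - κ) * N - c| ≤ (η + (P.q + 1) * (P.d / (P.m + P.β) / L₀)) * N := by
      have h1 : k * (1 - κ) * N - c = ((k - P.q) - k * κ) * N := by rw [hc, hN]; ring
      have hk' : |k| ≤ P.q + 1 := by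
        have := abs_le.1 hk
        rw [abs_le]; constructor <;> linarith
      rw [h1, abs_mul, abs_of_pos hN0]
      refine mul_le_mul_of_nonneg_right ((abs_sub _ _).trans (add_le_add hk ?_)) hN0.le
      rw [abs_mul, abs_of_nonneg hκ0]
      gcongr
    have hgk : |k + g - (P.q + P.p)| ≤ 2 * η := by
      have := abs_le.1 hg
      have := abs_le.1 hk
      rw [abs_le]; constructor <;> linarith
    have hrot := rotation_le (σ := σ τ) hp hc0 hω hω0 hη2 hg hgk hc' (by linarith)
    simp only [Pi.sub_apply]
    rw [hσ] at hrot ⊢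
    simp only at hrot ⊢
    set X := P.xVar τ (z₂ τ) (w₂ τ) - P.xVar τ (z₁ τ) (w₁ τ) with hX
    set Z := z₂ τ - z₁ τ with hZ
    have e3 : P.yVar τ (z₂ τ) (w₂ τ) - P.yVar τ (z₁ τ) (w₁ τ) =
        -(P.β * X) - (P.m + P.β) * ((1 - κ) * Z) := by
      rw [← hlam, hX]; linarith
    rw [e3] at hky
    have e4 : (Real.exp (P.yVar τ (z₂ τ) (w₂ τ)) - P.q) / P.β -
        (Real.exp (P.xVar τ (z₂ τ) (w₂ τ)) - P.p) -
        ((Real.exp (P.yVar τ (z₁ τ) (w₁ τ)) - P.q) / P.β -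
          (Real.exp (P.xVar τ (z₁ τ) (w₁ τ)) - P.p)) =
        k * (-(P.β * X) - (P.m + P.β) * ((1 - κ) * Z)) / P.β - g * X := by
      rw [← hgx, ← hky]; ring
    rw [e4, hgx]
    have e5 : ((k * (-(P.β * X) - (P.m + P.β) * ((1 - κ) * Z)) / P.β - g * X) * Z - X * (g * X)) /
        Z ^ 2 = -(g * (X / Z) ^ 2 + (k + g) * (X / Z) + k * (1 - κ) * N) := by
      rw [hN]; field_simp; ring
    rw [e5]
    linarith
  choose! σ' hσ' hσle using hder
  have hd2 : ∀ τ ∈ Icc s t, HasDerivAt (fun τ => Real.arctan (σ τ) + ω * τ)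
      (1 / (1 + σ τ ^ 2) * σ' τ + ω) τ := by
    intro τ hτ
    refine ((hσ' τ hτ).arctan.add ((hasDerivAt_id τ).const_mul ω)).congr_deriv ?_
    ring
  have hanti : AntitoneOn (fun τ => Real.arctan (σ τ) + ω * τ) (Icc s t) := by
    apply antitoneOn_of_deriv_nonpos (convex_Icc s t)
    · exact fun τ hτ => (hd2 τ hτ).continuousAt.continuousWithinAt
    · exact fun τ hτ => (hd2 τ (interior_subset hτ)).differentiableAt.differentiableWithinAt
    · intro τ hτ
      have hτ' := interior_subset hτ
      rw [(hd2 τ hτ').deriv]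
      have h1 := hσle τ hτ'
      have h2 : 0 < 1 + σ τ ^ 2 := by positivity
      have h3 : 1 / (1 + σ τ ^ 2) * σ' τ ≤ -ω := by
        rw [one_div_mul_eq_div, div_le_iff₀ h2]; exact h1
      linarith
  have h := hanti (left_mem_Icc.2 hst) (right_mem_Icc.2 hst) hst
  simp only at h
  have h1 := Real.arctan_lt_pi_div_two (σ s)
  have h2 := Real.neg_pi_div_two_lt_arctan (σ t)
  rw [le_div_iff₀ hω0]
  linarith

end Traj

/-! ### The critical exponent -/

/-- Below the critical exponent the linearization `δx' = (q / β) δy - p δx`,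
`δy' = -m p δx - q δy` of the Lotka–Volterra system at its equilibrium has non-real eigenvalues:
the right-hand side of the conclusion is four times its determinant, the left-hand side the square
of its trace. -/
lemma Params.disc_of_lt_qc (P : Params)
    (h : ((P.m / (P.m - P.β) : ℝ) : EReal) < qc P.α P.β P.γ) :
    (P.q + P.p) ^ 2 < 4 * P.p * (P.q * (P.m + P.β) / P.β) := by
  have hβ := P.β_pos
  have hm := P.β_lt_m
  have hmβ := P.mβ_pos
  have hp := P.p_pos
  have hq := P.q_pos
  have hθ := P.θ_pos
  have hγ := P.γ_pos
  have hα := P.β_lt_α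
  set D := qcDenom P.α P.β P.γ with hD
  set S := √(P.β * (P.β * P.γ + P.α - P.β)) with hS
  set R := √P.θ with hR
  have hDe : D = 4 * (S - R) ^ 2 - 2 * P.θ * (P.β + 1) ^ 2 := rfl
  have hS2 : S ^ 2 = P.β * (P.β * P.γ + P.α - P.β) := by
    rw [hS, Real.sq_sqrt]
    have := mul_pos hβ hγ
    have : 0 ≤ P.β * P.γ + P.α - P.β := by linarith
    positivity
  have hR2 : R ^ 2 = P.θ := Real.sq_sqrt hθ.le
  have hS0 : 0 ≤ S := Real.sqrt_nonneg _
  have hmain : D * (P.m + P.β) < 2 * P.θ * (P.β + 1) ^ 2 * (P.m - P.β) := by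
    have hmβ' : 0 < P.m - P.β := by linarith
    have hpos : 0 < 2 * P.θ * (P.β + 1) ^ 2 * (P.m - P.β) := by positivity
    by_cases hD0 : 0 < D
    · rw [qc, if_pos hD0, EReal.coe_lt_coe_iff] at h
      have h1 : P.m / (P.m - P.β) - 1 / 2 = (P.m + P.β) / (2 * (P.m - P.β)) := by
        field_simp; ring
      have h2 : (P.m + P.β) / (2 * (P.m - P.β)) < P.θ * (P.β + 1) ^ 2 / D := by
        rw [← h1]
        have : P.θ * (P.β + 1) ^ 2 / D =
          (P.γ - P.α + P.β) * (P.β + 1) ^ 2 / qcDenom P.α P.β P.γ := rfl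
        rw [this]; linarith
      rw [div_lt_div_iff₀ (by positivity) hD0] at h2
      linarith
    · have : D * (P.m + P.β) ≤ 0 := mul_nonpos_of_nonpos_of_nonneg (not_lt.1 hD0) hmβ.le
      linarith
  -- with `Y = p + q`, the claim is a quadratic inequality for `Y`, and `hmain` says that
  -- `Y` is smaller than the positive root
  set Y := P.q + P.p with hY
  have hpm := P.p_mul
  have hqe := P.q_eq
  have hpY : (P.β + 1) * P.p = Y - (P.α - P.β) := by rw [hY, hqe]; ring
  have he : P.β * (P.β + 1) * (P.α - P.β) = S ^ 2 - P.β ^ 2 * R ^ 2 := by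
    rw [hS2, hR2, Params.θ]; ring
  have h1 : (S - R) ^ 2 < (P.β + 1) ^ 2 * (R ^ 2 - P.β * P.p) := by
    have e1 : P.θ * (P.m - P.β) = (P.θ - 2 * P.β * P.p) * (P.m + P.β) := by
      rw [sub_mul, mul_assoc, hpm]; ring
    have e2 : D * (P.m + P.β) < 2 * (P.β + 1) ^ 2 * (P.θ - 2 * P.β * P.p) * (P.m + P.β) := by
      calc D * (P.m + P.β) < 2 * P.θ * (P.β + 1) ^ 2 * (P.m - P.β) := hmain
        _ = 2 * (P.β + 1) ^ 2 * (P.θ * (P.m - P.β)) := by ring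
        _ = _ := by rw [e1]; ring
    have e3 := lt_of_mul_lt_mul_right e2 hmβ.le
    rw [hDe] at e3
    rw [hR2]
    linarith
  have h2 : (P.β + 1) * (P.β * Y) < 2 * P.β * R ^ 2 + 2 * S * R := by
    have : (P.β + 1) ^ 2 * (P.β * P.p) = (P.β + 1) * (P.β * Y) - P.β * (P.β + 1) * (P.α - P.β) := by
      linear_combination (P.β + 1) * P.β * hpY
    nlinarith
  have h3 : ((P.β + 1) * (P.β * Y) - 2 * P.β * R ^ 2) ^ 2 < (2 * S * R) ^ 2 := by
    apply sq_lt_sq'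
    · have hSβ : P.β * R < S := by
        apply lt_of_pow_lt_pow_left₀ 2 hS0
        have : 0 < P.β * (P.β + 1) * (P.α - P.β) := by
          have : 0 < P.α - P.β := by linarith
          positivity
        rw [mul_pow]; linarith
      have : P.β * R * R ≤ S * R := by gcongr
      have : 0 < (P.β + 1) * (P.β * Y) := by positivity
      nlinarith
    · linarith
  have h4 : 4 * P.p * (P.q * (P.m + P.β) / P.β) = 4 * R ^ 2 * P.q / P.β := by
    rw [hR2, ← hpm]; ring
  have h5 : (P.β + 1) * P.q = P.α - P.β + P.β * Y := by rw [hY, hqe]; ring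
  rw [h4, lt_div_iff₀ hβ]
  have h6 : P.β * (P.β + 1) ^ 2 * (Y ^ 2 * P.β) < P.β * (P.β + 1) ^ 2 * (4 * R ^ 2 * P.q) := by
    have e1 : P.β * (P.β + 1) ^ 2 * (4 * R ^ 2 * P.q) =
        4 * R ^ 2 * (P.β * (P.β + 1) * (P.α - P.β) + P.β * (P.β + 1) * (P.β * Y)) := by
      linear_combination 4 * R ^ 2 * (P.β * (P.β + 1)) * h5
    rw [e1, he]
    linarith
  exact lt_of_mul_lt_mul_left h6 (by positivity)

/-! ### Solutions and their fluxes -/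

/-- A function with `s v'(s) ≥ c > 0` is unbounded near the origin. -/
lemma not_tendsto_of_le_mul_deriv {v v' : ℝ → ℝ} {l c s₀ : ℝ} (hc : 0 < c) (hs₀ : 0 < s₀)
    (hv : ∀ s ∈ Ioo 0 s₀, HasDerivAt v (v' s) s) (hv' : ∀ s ∈ Ioo 0 s₀, c ≤ s * v' s) :
    ¬ Tendsto v (𝓝[>] 0) (𝓝 l) := by
  intro hl
  have hd : ∀ s ∈ Ioo 0 s₀, HasDerivAt (fun s => v s - c * Real.log s) (v' s - c * s⁻¹) s :=
    fun s hs => (hv s hs).sub ((Real.hasDerivAt_log hs.1.ne').const_mul c)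
  have hmono : MonotoneOn (fun s => v s - c * Real.log s) (Ioo 0 s₀) := by
    apply monotoneOn_of_deriv_nonneg (convex_Ioo 0 s₀)
    · exact fun s hs => (hd s hs).continuousAt.continuousWithinAt
    · exact fun s hs => (hd s (interior_subset hs)).differentiableAt.differentiableWithinAt
    · intro s hs
      have hs' := interior_subset hs
      rw [(hd s hs').deriv, sub_nonneg, ← div_eq_mul_inv, div_le_iff₀ hs'.1, mul_comm]
      exact hv' s hs'
  have h1 : Tendsto (fun s => v s - c * Real.log s) (𝓝[>] 0) atTop := by
    have h2 : Tendsto (fun s => -c * Real.log s) (𝓝[>] 0) atTop :=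
      Real.tendsto_log_nhdsGT_zero.const_mul_atBot_of_neg (by linarith)
    refine (hl.add_atTop h2).congr fun s => ?_
    ring
  have hmid : s₀ / 2 ∈ Ioo 0 s₀ := ⟨by linarith, by linarith⟩
  obtain ⟨s, hs1, hs2⟩ := ((h1.eventually_gt_atTop
    (v (s₀ / 2) - c * Real.log (s₀ / 2))).and (Ioo_mem_nhdsGT hmid.1)).exists
  have := hmono ⟨hs2.1, hs2.2.trans hmid.2⟩ hmid hs2.2.le
  simp only at this
  linarith

namespace IsSolution

variable {α β γ a r₁ : ℝ} {f u : ℝ → ℝ}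

lemma mono {r₂ : ℝ} (h : IsSolution α β γ f a r₁ u) (hr : r₂ ≤ r₁) :
    IsSolution α β γ f a r₂ u := by
  have hsub : Ioo 0 r₂ ⊆ Ioo 0 r₁ := Ioo_subset_Ioo_right hr
  exact ⟨h.contDiffOn.mono hsub, h.continuousOn.mono (Ico_subset_Ico_right hr),
    fun r hr => h.pos r (hsub hr), fun r hr => h.f_pos r (hsub hr),
    fun r hr => h.flux_diff r (hsub hr), fun r hr => h.eqn r (hsub hr), h.init⟩

lemma hasDerivAt (h : IsSolution α β γ f a r₁ u) {r : ℝ} (hr : r ∈ Ioo 0 r₁) :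
    HasDerivAt u (deriv u r) r :=
  ((h.contDiffOn.differentiableOn two_ne_zero).differentiableAt
    (isOpen_Ioo.mem_nhds hr)).hasDerivAt

lemma hasDerivAt_flux (h : IsSolution α β γ f a r₁ u) {r : ℝ} (hr : r ∈ Ioo 0 r₁) :
    HasDerivAt (flux α β u) (r ^ (γ - 1) / f (u r)) r := by
  have h1 := (h.flux_diff r hr).hasDerivAt
  have h2 := h.eqn r hr
  have h3 : deriv (flux α β u) r = r ^ (γ - 1) / f (u r) := by
    rw [Real.rpow_neg hr.1.le] at h2
    have := (Real.rpow_pos_of_pos hr.1 (γ - 1)).ne'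
    field_simp at h2
    rw [h2]
  rwa [h3] at h1

lemma strictMonoOn_flux (h : IsSolution α β γ f a r₁ u) :
    StrictMonoOn (flux α β u) (Ioo 0 r₁) := by
  apply strictMonoOn_of_deriv_pos (convex_Ioo 0 r₁)
  · exact fun s hs => (h.hasDerivAt_flux hs).continuousAt.continuousWithinAt
  · intro s hs
    rw [interior_Ioo] at hs
    rw [(h.hasDerivAt_flux hs).deriv]
    exact div_pos (Real.rpow_pos_of_pos hs.1 _) (h.f_pos s hs)

lemma tendsto_zero (h : IsSolution α β γ f a r₁ u) (hr₁ : 0 < r₁) :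
    Tendsto u (𝓝[>] 0) (𝓝 a) := by
  have h1 := h.continuousOn 0 ⟨le_rfl, hr₁⟩
  have h2 : Tendsto u (𝓝[Ico 0 r₁] 0) (𝓝 a) := by
    have := h1.tendsto; rwa [h.init] at this
  rw [← nhdsWithin_Ioo_eq_nhdsGT hr₁]
  exact h2.mono_left (nhdsWithin_mono _ Ioo_subset_Ico_self)

end IsSolution

lemma abs_flux_eq {α β : ℝ} (hβ : 1 ≤ β) (u : ℝ → ℝ) {r : ℝ} (hr : 0 < r) :
    |flux α β u r| = r ^ α * |deriv u r| ^ β := by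
  unfold flux
  rw [abs_mul, abs_mul, abs_of_pos (Real.rpow_pos_of_pos hr α),
    abs_of_nonneg (Real.rpow_nonneg (abs_nonneg _) _), mul_assoc]
  congr 1
  rcases eq_or_ne (deriv u r) 0 with h | h
  · rw [h, abs_zero, mul_zero, Real.zero_rpow (by linarith)]
  · rw [← Real.rpow_add_one (abs_pos.2 h).ne']
    ring_nf

/-- A flux bounded away from zero forces logarithmic growth of `u` at least, as `α ≥ β`. -/
lemma rpow_le_mul_abs_deriv {α β c : ℝ} (hβ : 1 ≤ β) (hα : β ≤ α) (hc : 0 < c) {u : ℝ → ℝ} {r : ℝ}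
    (hr : 0 < r) (hr1 : r ≤ 1) (h : c ≤ |flux α β u r|) : c ^ (1 / β) ≤ r * |deriv u r| := by
  have hβ0 : 0 < β := by linarith
  rw [abs_flux_eq hβ u hr] at h
  have h1 : r ^ α * |deriv u r| ^ β ≤ (r * |deriv u r|) ^ β := by
    rw [Real.mul_rpow hr.le (abs_nonneg _)]
    have := Real.rpow_le_rpow_of_exponent_ge hr hr1 hα
    gcongr
  have h2 := Real.rpow_le_rpow hc.le (h.trans h1) (one_div_pos.2 hβ0).le
  rwa [← Real.rpow_mul (by positivity), mul_one_div_cancel hβ0.ne', Real.rpow_one] at h2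

lemma deriv_pos_of_flux_pos {α β : ℝ} {u : ℝ → ℝ} {r : ℝ} (hr : 0 < r)
    (h : 0 < flux α β u r) : 0 < deriv u r := by
  have : 0 ≤ r ^ α * |deriv u r| ^ (β - 1) :=
    mul_nonneg (Real.rpow_nonneg hr.le _) (Real.rpow_nonneg (abs_nonneg _) _)
  exact pos_of_mul_pos_right h this

lemma deriv_neg_of_flux_neg {α β : ℝ} {u : ℝ → ℝ} {r : ℝ} (hr : 0 < r)
    (h : flux α β u r < 0) : deriv u r < 0 := by
  by_contra! hd
  have : 0 ≤ r ^ α * |deriv u r| ^ (β - 1) :=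
    mul_nonneg (Real.rpow_nonneg hr.le _) (Real.rpow_nonneg (abs_nonneg _) _)
  have := mul_nonneg this hd
  unfold flux at h
  linarith

namespace IsSolution

variable {α β γ a r₁ : ℝ} {f u : ℝ → ℝ}

lemma flux_pos (h : IsSolution α β γ f a r₁ u) (hβ : 1 ≤ β) (hα : β ≤ α) {r : ℝ}
    (hr : r ∈ Ioo 0 r₁) : 0 < flux α β u r := by
  by_contra! hneg
  set s₀ := min (r / 2) 1
  have hs₀p : 0 < s₀ := lt_min (by linarith [hr.1]) one_pos
  have hs₀r : s₀ < r := (min_le_left _ _).trans_lt (by linarith [hr.1])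
  have hs₀m : s₀ ∈ Ioo 0 r₁ := ⟨hs₀p, hs₀r.trans hr.2⟩
  have hc : 0 < -flux α β u s₀ := by
    have := h.strictMonoOn_flux hs₀m hr hs₀r
    linarith
  refine not_tendsto_of_le_mul_deriv (v := fun s => -u s) (v' := fun s => -deriv u s) (l := -a)
    (Real.rpow_pos_of_pos hc (1 / β)) hs₀p
    (fun s hs => (h.hasDerivAt ⟨hs.1, hs.2.trans hs₀m.2⟩).neg) ?_
    (h.tendsto_zero (hr.1.trans hr.2)).neg
  intro s hs
  have hlt := h.strictMonoOn_flux ⟨hs.1, hs.2.trans hs₀m.2⟩ hs₀m hs.2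
  have hn : flux α β u s < 0 := by linarith
  have h1 := rpow_le_mul_abs_deriv hβ hα hc hs.1 (hs.2.le.trans (min_le_right _ _))
    (u := u) (by rw [abs_of_neg hn]; linarith)
  rwa [abs_of_neg (deriv_neg_of_flux_neg hs.1 hn)] at h1

lemma deriv_pos (h : IsSolution α β γ f a r₁ u) (hβ : 1 ≤ β) (hα : β ≤ α) {r : ℝ}
    (hr : r ∈ Ioo 0 r₁) : 0 < deriv u r :=
  deriv_pos_of_flux_pos hr.1 (h.flux_pos hβ hα hr)

lemma tendsto_flux (h : IsSolution α β γ f a r₁ u) (hβ : 1 ≤ β) (hα : β ≤ α) (hr₁ : 0 < r₁) :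
    Tendsto (flux α β u) (𝓝[>] 0) (𝓝 0) := by
  have key : ∀ ε > 0, ∃ s ∈ Ioo 0 r₁, flux α β u s < ε := by
    intro ε hε
    by_contra! hcon
    have hs₀ : 0 < min r₁ 1 := lt_min hr₁ one_pos
    refine not_tendsto_of_le_mul_deriv (v := u) (v' := deriv u) (l := a)
      (Real.rpow_pos_of_pos hε (1 / β)) hs₀
      (fun s hs => h.hasDerivAt ⟨hs.1, hs.2.trans_le (min_le_left _ _)⟩) ?_ (h.tendsto_zero hr₁)
    intro s hs
    have hs' : s ∈ Ioo 0 r₁ := ⟨hs.1, hs.2.trans_le (min_le_left _ _)⟩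
    have h1 := rpow_le_mul_abs_deriv hβ hα hε hs.1 (hs.2.le.trans (min_le_right _ _))
      (u := u) ((hcon s hs').trans (le_abs_self _))
    rwa [abs_of_pos (h.deriv_pos hβ hα hs')] at h1
  rw [Metric.tendsto_nhds]
  intro ε hε
  obtain ⟨s, hs, hsε⟩ := key ε hε
  filter_upwards [Ioo_mem_nhdsGT hs.1] with r hr
  have hr' : r ∈ Ioo 0 r₁ := ⟨hr.1, hr.2.trans hs.2⟩
  rw [Real.dist_eq, sub_zero, abs_of_pos (h.flux_pos hβ hα hr')]
  exact (h.strictMonoOn_flux hr' hs hr.2).trans hsε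

lemma strictMonoOn (h : IsSolution α β γ f a r₁ u) (hβ : 1 ≤ β) (hα : β ≤ α) :
    StrictMonoOn u (Ico 0 r₁) := by
  apply strictMonoOn_of_deriv_pos (convex_Ico 0 r₁) h.continuousOn
  intro s hs
  rw [interior_Ico] at hs
  exact h.deriv_pos hβ hα hs

lemma deriv_eq (h : IsSolution α β γ f a r₁ u) (hβ : 1 ≤ β) (hα : β ≤ α) {r : ℝ}
    (hr : r ∈ Ioo 0 r₁) : deriv u r = (flux α β u r / r ^ α) ^ (1 / β) := by
  have hβ0 : 0 < β := by linarith
  have h1 := abs_flux_eq (α := α) hβ u hr.1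
  have hd := h.deriv_pos hβ hα hr
  rw [abs_of_pos (h.flux_pos hβ hα hr), abs_of_pos hd] at h1
  rw [h1, mul_div_cancel_left₀ _ (Real.rpow_pos_of_pos hr.1 α).ne', ← Real.rpow_mul hd.le,
    mul_one_div_cancel hβ0.ne', Real.rpow_one]

end IsSolution

lemma continuousAt_nonlin {m d C u : ℝ} (hd : 0 ≤ d) (hu : 0 < u) :
    ContinuousAt (nonlin m d C) u := by
  have h1 : ContinuousAt (fun u => u ^ m * |Real.log u - C| ^ d) u :=
    (Real.continuousAt_rpow_const u m (Or.inl hu.ne')).mul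
      ((((Real.continuousAt_log hu.ne').sub continuousAt_const).abs).rpow_const (Or.inr hd))
  refine h1.congr ?_
  filter_upwards [lt_mem_nhds hu] with v hv
  rw [nonlin, if_pos hv]

lemma nonlin_pos {m d C u : ℝ} (hu : 0 < u) (huC : Real.log u < C) : 0 < nonlin m d C u := by
  rw [nonlin, if_pos hu]
  have : Real.log u - C ≠ 0 := by linarith
  positivity

lemma nonlin_eq {m d C u : ℝ} (hu : 0 < u) (huC : Real.log u < C) :
    nonlin m d C u = Real.exp (m * Real.log u + d * Real.log (C - Real.log u)) := by
  rw [nonlin, if_pos hu, abs_sub_comm, abs_of_pos (by linarith), Real.exp_add,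
    Real.rpow_def_of_pos hu, Real.rpow_def_of_pos (by linarith)]
  ring_nf

namespace Params

variable (P : Params)

/-- The nonlinearity of the equation. -/
abbrev f : ℝ → ℝ := nonlin P.m P.d P.C

/-- The equation written as a first-order system for `u` and its flux `φ`. -/
structure IsSystem (φ u : ℝ → ℝ) (r : ℝ) : Prop where
  pos : 0 < u r
  log_lt : Real.log (u r) < P.C
  flux_pos : 0 < φ r
  hasDerivAt : HasDerivAt u ((φ r / r ^ P.α) ^ (1 / P.β)) r
  hasDerivAt_flux : HasDerivAt φ (r ^ (P.γ - 1) / P.f (u r)) r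

variable {P}

lemma IsSystem.flux_eq {φ u : ℝ → ℝ} {r : ℝ} (h : P.IsSystem φ u r) (hr : 0 < r) :
    flux P.α P.β u r = φ r := by
  have hβ := P.β_pos
  have hp : 0 < φ r / r ^ P.α := div_pos h.flux_pos (Real.rpow_pos_of_pos hr _)
  have hp' : 0 < (φ r / r ^ P.α) ^ (1 / P.β) := Real.rpow_pos_of_pos hp _
  rw [flux, h.hasDerivAt.deriv, abs_of_pos hp', mul_assoc, ← Real.rpow_add_one hp'.ne',
    sub_add_cancel, ← Real.rpow_mul hp.le, one_div_mul_cancel hβ.ne', Real.rpow_one]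
  have := (Real.rpow_pos_of_pos hr P.α).ne'
  field_simp

/-- A solution of the first-order system is a solution in the classical sense. -/
lemma isSolution_of_isSystem {φ u : ℝ → ℝ} {a r₁ : ℝ} (h : ∀ r ∈ Ioo 0 r₁, P.IsSystem φ u r)
    (hcont : ContinuousOn u (Ico 0 r₁)) (h0 : u 0 = a) :
    IsSolution P.α P.β P.γ P.f a r₁ u := by
  have hflux : ∀ r ∈ Ioo 0 r₁, flux P.α P.β u =ᶠ[𝓝 r] φ := by
    intro r hr
    filter_upwards [isOpen_Ioo.mem_nhds hr] with s hs
    exact (h s hs).flux_eq hs.1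
  have hflux' : ∀ r ∈ Ioo 0 r₁, HasDerivAt (flux P.α P.β u) (r ^ (P.γ - 1) / P.f (u r)) r :=
    fun r hr => (h r hr).hasDerivAt_flux.congr_of_eventuallyEq (hflux r hr)
  have hfpos : ∀ r ∈ Ioo 0 r₁, 0 < P.f (u r) := fun r hr =>
    nonlin_pos (h r hr).pos (h r hr).log_lt
  refine ⟨?_, hcont, fun r hr => (h r hr).pos, hfpos, fun r hr => (hflux' r hr).differentiableAt,
    fun r hr => ?_, h0⟩
  · have hφ : ContDiffOn ℝ 1 φ (Ioo 0 r₁) := by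
      have : (1 : WithTop ℕ∞) = 0 + 1 := by norm_num
      rw [this, contDiffOn_succ_iff_deriv_of_isOpen isOpen_Ioo]
      refine ⟨fun r hr => (h r hr).hasDerivAt_flux.differentiableAt.differentiableWithinAt,
        by simp, ?_⟩
      rw [contDiffOn_zero]
      have : ContinuousOn (fun r => r ^ (P.γ - 1) / P.f (u r)) (Ioo 0 r₁) := by
        intro r hr
        have h1 := (continuousAt_nonlin (m := P.m) (C := P.C) P.d_nonneg (h r hr).pos).comp
          (h r hr).hasDerivAt.continuousAt
        exact ((Real.continuousAt_rpow_const r _ (Or.inl hr.1.ne')).div h1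
          (hfpos r hr).ne').continuousWithinAt
      exact this.congr fun r hr => (h r hr).hasDerivAt_flux.deriv
    have h2 : (2 : WithTop ℕ∞) = 1 + 1 := by norm_num
    rw [h2, contDiffOn_succ_iff_deriv_of_isOpen isOpen_Ioo]
    refine ⟨fun r hr => (h r hr).hasDerivAt.differentiableAt.differentiableWithinAt,
      by simp, ?_⟩
    have : ContDiffOn ℝ 1 (fun r => (φ r / r ^ P.α) ^ (1 / P.β)) (Ioo 0 r₁) := by
      intro r hr
      have e1 : ContDiffWithinAt ℝ 1 (fun r : ℝ => r ^ P.α) (Ioo 0 r₁) r :=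
        (contDiffAt_id.rpow_const_of_ne hr.1.ne').contDiffWithinAt
      have e2 := (hφ r hr).div e1 (Real.rpow_pos_of_pos hr.1 _).ne'
      exact e2.rpow_const_of_ne
        (div_pos (h r hr).flux_pos (Real.rpow_pos_of_pos hr.1 _)).ne'
    exact this.congr fun r hr => (h r hr).hasDerivAt.deriv
  · rw [(hflux' r hr).deriv, Real.rpow_neg hr.1.le]
    have := (Real.rpow_pos_of_pos hr.1 (P.γ - 1)).ne'
    field_simp

/-- The initial size of a solution with `u 0 = a`, that is, `(u ^ β f u) ^ (1 / (m + β))` at the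
origin; it vanishes for `a = 0`. -/
def core (P : Params) (a : ℝ) : ℝ := a * (P.C - Real.log a) ^ (P.d / (P.m + P.β))

lemma exp_lam_log {a : ℝ} (ha : 0 < a) (haC : Real.log a < P.C) :
    Real.exp (P.lam (Real.log a)) = P.core a := by
  rw [lam, core, Real.exp_add, Real.exp_log ha, Real.rpow_def_of_pos (by linarith)]
  ring_nf

lemma tendsto_lam_atBot (P : Params) : Tendsto P.lam atBot atBot := by
  set κ := P.d / (P.m + P.β)
  have hκ0 : 0 ≤ κ := div_nonneg P.d_nonneg P.mβ_pos.le
  set k := κ + 1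
  have h1 : Tendsto (fun z : ℝ => z / 2 + (P.C / 2 + k * Real.log (2 * k))) atBot atBot :=
    tendsto_atBot_add_const_right _ _ (tendsto_id.atBot_div_const two_pos)
  refine tendsto_atBot_mono' _ ?_ h1
  filter_upwards [eventually_le_atBot (P.C - 1)] with z hz
  have h2 : 0 ≤ Real.log (P.C - z) := Real.log_nonneg (by linarith)
  have h3 : Real.log ((P.C - z) / (2 * k)) ≤ (P.C - z) / (2 * k) - 1 :=
    Real.log_le_sub_one_of_pos (by apply div_pos <;> linarith)
  rw [Real.log_div (by linarith) (by linarith)] at h3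
  have h4 := mul_le_mul_of_nonneg_left h3 (show 0 ≤ k by linarith)
  have h5 : k * ((P.C - z) / (2 * k) - 1) = (P.C - z) / 2 - k := by
    have : k ≠ 0 := by linarith
    field_simp
  unfold lam
  linarith

lemma tendsto_core (P : Params) : Tendsto P.core (𝓝[>] 0) (𝓝 0) := by
  have h1 := (Real.tendsto_exp_atBot.comp P.tendsto_lam_atBot).comp Real.tendsto_log_nhdsGT_zero
  refine h1.congr' ?_
  have h2 : ∀ᶠ a : ℝ in 𝓝[>] 0, Real.log a < P.C :=
    Real.tendsto_log_nhdsGT_zero.eventually_lt_atBot _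
  filter_upwards [h2, self_mem_nhdsWithin] with a ha ha0
  exact exp_lam_log ha0 ha

end Params

/-! ### Passing to logarithmic variables and back -/

/-- `log u` as a function of `t = log r`. -/
def logOf (u : ℝ → ℝ) (t : ℝ) : ℝ := Real.log (u (Real.exp t))

lemma exp_mem_Ioo {t r₁ : ℝ} (hr₁ : 0 < r₁) (ht : t < Real.log r₁) : Real.exp t ∈ Ioo 0 r₁ :=
  ⟨Real.exp_pos t, (Real.lt_log_iff_exp_lt hr₁).1 ht⟩

namespace IsSolution

variable {P : Params} {a r₁ L : ℝ} {u : ℝ → ℝ}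

lemma tendsto_exp_atBot : Tendsto Real.exp atBot (𝓝[>] (0 : ℝ)) :=
  tendsto_nhdsWithin_iff.2 ⟨Real.tendsto_exp_atBot, Eventually.of_forall Real.exp_pos⟩

lemma traj (h : IsSolution P.α P.β P.γ P.f a r₁ u) (hr₁ : 0 < r₁) (hL : 0 < L)
    (hdL : P.d ≤ P.m * L) (hu : ∀ r ∈ Ioo 0 r₁, u r ≤ Real.exp (P.C - L)) :
    Traj P L (Real.log r₁) (logOf u) (logOf (flux P.α P.β u)) := by
  have hβ := P.one_le_β
  have hα := P.β_lt_α.le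
  have hle : ∀ t < Real.log r₁, logOf u t ≤ P.C - L := by
    intro t ht
    have hm := exp_mem_Ioo hr₁ ht
    rw [logOf, Real.log_le_iff_le_exp (h.pos _ hm)]
    exact hu _ hm
  refine ⟨hL, hdL, hle, ?_, ?_, ?_⟩
  · intro t ht
    have hm := exp_mem_Ioo hr₁ ht
    have h1 := ((h.hasDerivAt hm).comp t (Real.hasDerivAt_exp t)).log (h.pos _ hm).ne'
    refine h1.congr_deriv ?_
    have hφ := h.flux_pos hβ hα hm
    have e1 : deriv u (Real.exp t) =
        Real.exp ((logOf (flux P.α P.β u) t - P.α * t) / P.β) := by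
      rw [h.deriv_eq hβ hα hm, Real.rpow_def_of_pos (div_pos hφ (Real.rpow_pos_of_pos hm.1 _)),
        Real.log_div hφ.ne' (Real.rpow_pos_of_pos hm.1 _).ne', Real.log_rpow hm.1, Real.log_exp,
        logOf]
      ring_nf
    rw [e1, Params.xVar, Real.exp_sub, Real.exp_add, logOf, logOf, Real.exp_log (h.pos _ hm)]
    simp only [Function.comp]
    ring
  · intro t ht
    have hm := exp_mem_Ioo hr₁ ht
    have hφ := h.flux_pos hβ hα hm
    have h1 := ((h.hasDerivAt_flux hm).comp t (Real.hasDerivAt_exp t)).log hφ.ne'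
    refine h1.congr_deriv ?_
    have hlt : Real.log (u (Real.exp t)) < P.C := by
      have := hle t ht
      unfold logOf at this
      linarith
    rw [Params.f, nonlin_eq (h.pos _ hm) hlt, Params.yVar, Real.exp_sub, logOf, logOf,
      Real.exp_log hφ]
    simp only [Function.comp]
    congr 1
    rw [← Real.exp_mul, ← Real.exp_sub, ← Real.exp_add]
    ring_nf
  · have h1 := (h.tendsto_flux hβ hα hr₁).comp tendsto_exp_atBot
    refine h1.congr' ?_
    filter_upwards [eventually_lt_atBot (Real.log r₁)] with t ht
    rw [logOf, Real.exp_log (h.flux_pos hβ hα (exp_mem_Ioo hr₁ ht))]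
    rfl

lemma tendsto_exp_lam (h : IsSolution P.α P.β P.γ P.f a r₁ u) (hr₁ : 0 < r₁) (ha : 0 ≤ a)
    (haC : a < Real.exp P.C) :
    Tendsto (fun t => Real.exp (P.lam (logOf u t))) atBot (𝓝 (P.core a)) := by
  have h1 : Tendsto (fun t => u (Real.exp t)) atBot (𝓝 a) :=
    (h.tendsto_zero hr₁).comp tendsto_exp_atBot
  rcases ha.eq_or_lt with rfl | ha
  · have h2 : Tendsto (fun t => u (Real.exp t)) atBot (𝓝[>] 0) := by
      refine tendsto_nhdsWithin_iff.2 ⟨h1, ?_⟩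
      filter_upwards [eventually_lt_atBot (Real.log r₁)] with t ht
      exact h.pos _ (exp_mem_Ioo hr₁ ht)
    have h3 := Real.tendsto_exp_atBot.comp
      (P.tendsto_lam_atBot.comp (Real.tendsto_log_nhdsGT_zero.comp h2))
    rw [show P.core 0 = 0 by simp [Params.core]]
    exact h3
  · have hlog : Real.log a < P.C := (Real.log_lt_iff_lt_exp ha).2 haC
    rw [← Params.exp_lam_log ha hlog]
    have h2 : Tendsto (logOf u) atBot (𝓝 (Real.log a)) := h1.log ha.ne'
    have h3 : ContinuousAt (fun z => Real.exp (P.lam z)) (Real.log a) := by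
      apply Real.continuous_exp.continuousAt.comp
      exact continuousAt_id.add (continuousAt_const.mul
        ((continuousAt_const.sub continuousAt_id).log (by simp; linarith)))
    exact h3.tendsto.comp h2

lemma eq_exp_logOf (h : IsSolution P.α P.β P.γ P.f a r₁ u) {r : ℝ} (hr : r ∈ Ioo 0 r₁) :
    u r = Real.exp (logOf u (Real.log r)) := by
  rw [logOf, Real.exp_log hr.1, Real.exp_log (h.pos r hr)]

end IsSolution

namespace Traj

variable {P : Params} {L T : ℝ} {z w : ℝ → ℝ}

/-- The function of `r = exp t` with logarithm `z`, extended by `0`. -/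
def profile (z : ℝ → ℝ) (r : ℝ) : ℝ := if 0 < r then Real.exp (z (Real.log r)) else 0

lemma hasDerivAt_profile (h : Traj P L T z w) {r : ℝ} (hr : 0 < r) (hrT : Real.log r < T) :
    HasDerivAt (profile z)
      (Real.exp (z (Real.log r) + P.xVar (Real.log r) (z (Real.log r)) (w (Real.log r))) / r) r := by
  have h1 := ((h.hasDerivAt_z _ hrT).comp r (Real.hasDerivAt_log hr.ne')).exp
  have h2 : HasDerivAt (fun r => Real.exp (z (Real.log r)))
      (Real.exp (z (Real.log r) + P.xVar (Real.log r) (z (Real.log r)) (w (Real.log r))) / r) r := by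
    refine h1.congr_deriv ?_
    rw [Real.exp_add]
    simp only [Function.comp]
    field_simp
  refine h2.congr_of_eventuallyEq ?_
  filter_upwards [lt_mem_nhds hr] with s hs
  rw [profile, if_pos hs]

lemma isSystem (h : Traj P L T z w) {r : ℝ} (hr : 0 < r) (hrT : Real.log r < T) :
    P.IsSystem (fun r => Real.exp (w (Real.log r))) (profile z) r := by
  have hβ := P.β_pos
  have hz := h.C_sub_pos hrT
  have hp : profile z r = Real.exp (z (Real.log r)) := by rw [profile, if_pos hr]
  refine ⟨by rw [hp]; positivity, by rw [hp, Real.log_exp]; linarith, Real.exp_pos _, ?_, ?_⟩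
  · refine (h.hasDerivAt_profile hr hrT).congr_deriv ?_
    rw [Real.rpow_def_of_pos (div_pos (Real.exp_pos _) (Real.rpow_pos_of_pos hr _)),
      Real.log_div (Real.exp_pos _).ne' (Real.rpow_pos_of_pos hr _).ne', Real.log_exp,
      Real.log_rpow hr]
    have h2 : ∀ v, Real.exp v / r = Real.exp (v - Real.log r) := fun v => by
      rw [Real.exp_sub, Real.exp_log hr]
    rw [h2, Params.xVar]
    congr 1
    field_simp
    ring
  · have h1 := ((h.hasDerivAt_w _ hrT).comp r (Real.hasDerivAt_log hr.ne')).exp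
    refine h1.congr_deriv ?_
    rw [hp, Params.f, nonlin_eq (Real.exp_pos _) (by rw [Real.log_exp]; linarith), Real.log_exp,
      Real.rpow_def_of_pos hr, ← Real.exp_sub]
    have h2 : r⁻¹ = Real.exp (-Real.log r) := by rw [Real.exp_neg, Real.exp_log hr]
    rw [h2]
    simp only [Function.comp]
    rw [← Real.exp_add, ← Real.exp_add, Params.yVar]
    congr 1
    ring

lemma isSolution (h : Traj P L T z w) (hz : Tendsto z atBot atBot) :
    IsSolution P.α P.β P.γ P.f 0 (Real.exp T) (profile z) := by
  have hmem : ∀ {r}, r ∈ Ioo 0 (Real.exp T) → Real.log r < T := fun hr =>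
    (Real.log_lt_iff_lt_exp hr.1).2 hr.2
  refine Params.isSolution_of_isSystem (fun r hr => h.isSystem hr.1 (hmem hr)) ?_ (by simp [profile])
  intro r hr
  rcases hr.1.eq_or_lt with rfl | hr0
  · have h1 : Tendsto (profile z) (𝓝[>] 0) (𝓝 (profile z 0)) := by
      have h0 : profile z 0 = 0 := by simp [profile]
      rw [h0]
      refine (Real.tendsto_exp_atBot.comp (hz.comp Real.tendsto_log_nhdsGT_zero)).congr' ?_
      filter_upwards [self_mem_nhdsWithin] with r hr
      rw [profile, if_pos (show 0 < r from hr)]; rfl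
    have h2 : ContinuousWithinAt (profile z) (Ici 0) 0 := continuousWithinAt_Ioi_iff_Ici.1 h1
    exact h2.mono Ico_subset_Ici_self
  · exact (h.isSystem hr0 (hmem ⟨hr0, hr.2⟩)).hasDerivAt.continuousAt.continuousWithinAt

end Traj

/-! ### The integral equation for regular solutions -/

lemma abs_rpow_sub_rpow_le {ρ μ A B : ℝ} (hρ0 : 0 ≤ ρ) (hρ1 : ρ ≤ 1) (hμ : 0 < μ) (hA : μ ≤ A)
    (hB : μ ≤ B) : |A ^ ρ - B ^ ρ| ≤ μ ^ (ρ - 1) * |A - B| := by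
  wlog h : B ≤ A generalizing A B
  · rw [abs_sub_comm, abs_sub_comm A B]
    exact this hB hA (le_of_not_ge h)
  have hB0 : 0 < B := by linarith
  have hA0 : 0 < A := by linarith
  rw [abs_of_nonneg (sub_nonneg.2 h), abs_of_nonneg (sub_nonneg.2 (Real.rpow_le_rpow hB0.le h hρ0))]
  have h1 : (A / B) ^ ρ ≤ A / B := by
    have h2 : 1 ≤ A / B := (one_le_div hB0).2 h
    calc (A / B) ^ ρ ≤ (A / B) ^ (1 : ℝ) := Real.rpow_le_rpow_of_exponent_le h2 hρ1
      _ = A / B := Real.rpow_one _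
  have h2 : A ^ ρ - B ^ ρ ≤ B ^ (ρ - 1) * (A - B) := by
    rw [Real.div_rpow hA0.le hB0.le, div_le_iff₀ (Real.rpow_pos_of_pos hB0 _)] at h1
    rw [Real.rpow_sub_one hB0.ne']
    have : B ^ ρ / B * (A - B) = A / B * B ^ ρ - B ^ ρ := by field_simp
    linarith
  refine h2.trans ?_
  have : B ^ (ρ - 1) ≤ μ ^ (ρ - 1) := Real.rpow_le_rpow_of_nonpos hμ hB (by linarith)
  have : 0 ≤ A - B := by linarith
  gcongr

/-- The right-hand side of the regularized equation: Lipschitz, and bounded between positive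
constants. -/
structure IsRegular (g : ℝ → ℝ) (g₀ g₁ K : ℝ) : Prop where
  pos : 0 < g₀
  K_nonneg : 0 ≤ K
  continuous : Continuous g
  le : ∀ v, g₀ ≤ g v
  ge : ∀ v, g v ≤ g₁
  abs_sub_le : ∀ v v', |g v - g v'| ≤ K * |v - v'|

/-- The flux as a functional of `u`. -/
def fluxOp (P : Params) (g u : ℝ → ℝ) (s : ℝ) : ℝ := ∫ σ in (0 : ℝ)..s, σ ^ (P.γ - 1) * g (u σ)

/-- The derivative of `u` as a functional of `u`. -/
def derivOp (P : Params) (g u : ℝ → ℝ) (s : ℝ) : ℝ := (fluxOp P g u s / s ^ P.α) ^ (1 / P.β)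

/-- The right-hand side of the integral equation `u = intOp u`. The cut-off `max s 0` only serves
to have a continuous integrand on the whole line. -/
def intOp (P : Params) (g : ℝ → ℝ) (a : ℝ) (u : ℝ → ℝ) (r : ℝ) : ℝ :=
  a + ∫ s in (0 : ℝ)..r, derivOp P g u (max s 0)

section

variable {P : Params} {g u v : ℝ → ℝ} {g₀ g₁ K a : ℝ}

lemma continuous_integrand (hg : IsRegular g g₀ g₁ K) (hu : Continuous u) :
    Continuous fun σ : ℝ => σ ^ (P.γ - 1) * g (u σ) := by
  have : 0 ≤ P.γ - 1 := by linarith [P.one_le_β, P.β_lt_α, P.α_lt_γ]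
  exact (Real.continuous_rpow_const this).mul (hg.continuous.comp hu)

lemma hasDerivAt_fluxOp (hg : IsRegular g g₀ g₁ K) (hu : Continuous u) (s : ℝ) :
    HasDerivAt (fluxOp P g u) (s ^ (P.γ - 1) * g (u s)) s :=
  ((continuous_integrand hg hu).integral_hasStrictDerivAt 0 s).hasDerivAt

lemma integral_const_mul_rpow (P : Params) (k s : ℝ) :
    ∫ σ in (0 : ℝ)..s, σ ^ (P.γ - 1) * k = k / P.γ * s ^ P.γ := by
  have hγ := P.γ_pos
  rw [intervalIntegral.integral_mul_const, integral_rpow (Or.inl (by linarith)), sub_add_cancel,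
    Real.zero_rpow hγ.ne']
  ring

lemma continuous_rpow_mul (P : Params) (k : ℝ) :
    Continuous fun σ : ℝ => σ ^ (P.γ - 1) * k := by
  have : 0 ≤ P.γ - 1 := by linarith [P.one_le_β, P.β_lt_α, P.α_lt_γ]
  exact (Real.continuous_rpow_const this).mul continuous_const

lemma le_fluxOp (hg : IsRegular g g₀ g₁ K) (hu : Continuous u) {s : ℝ} (hs : 0 ≤ s) :
    g₀ / P.γ * s ^ P.γ ≤ fluxOp P g u s := by
  rw [← integral_const_mul_rpow P]
  refine intervalIntegral.integral_mono_on hs ((continuous_rpow_mul P _).intervalIntegrable _ _)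
    ((continuous_integrand hg hu).intervalIntegrable _ _) fun σ hσ => ?_
  have := Real.rpow_nonneg hσ.1 (P.γ - 1)
  have := hg.le (u σ)
  gcongr

lemma fluxOp_le (hg : IsRegular g g₀ g₁ K) (hu : Continuous u) {s : ℝ} (hs : 0 ≤ s) :
    fluxOp P g u s ≤ g₁ / P.γ * s ^ P.γ := by
  rw [← integral_const_mul_rpow P]
  refine intervalIntegral.integral_mono_on hs
    ((continuous_integrand hg hu).intervalIntegrable _ _)
    ((continuous_rpow_mul P _).intervalIntegrable _ _) fun σ hσ => ?_
  have := Real.rpow_nonneg hσ.1 (P.γ - 1)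
  have := hg.ge (u σ)
  gcongr

lemma abs_fluxOp_sub_le (hg : IsRegular g g₀ g₁ K) (hu : Continuous u) (hv : Continuous v)
    {s D : ℝ} (hs : 0 ≤ s) (hD : ∀ σ ∈ Icc 0 s, |u σ - v σ| ≤ D) :
    |fluxOp P g u s - fluxOp P g v s| ≤ K * D / P.γ * s ^ P.γ := by
  rw [← integral_const_mul_rpow P, fluxOp, fluxOp, ← intervalIntegral.integral_sub
    ((continuous_integrand hg hu).intervalIntegrable _ _)
    ((continuous_integrand hg hv).intervalIntegrable _ _), ← Real.norm_eq_abs]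
  refine intervalIntegral.norm_integral_le_of_norm_le hs
    (Eventually.of_forall fun σ hσ => ?_) ((continuous_rpow_mul P _).intervalIntegrable _ _)
  rw [Real.norm_eq_abs, ← mul_sub, abs_mul, abs_of_nonneg (Real.rpow_nonneg hσ.1.le _)]
  have := Real.rpow_nonneg hσ.1.le (P.γ - 1)
  have h1 := hD σ ⟨hσ.1.le, hσ.2⟩
  have := hg.K_nonneg
  gcongr
  exact (hg.abs_sub_le _ _).trans (by gcongr)

lemma fluxOp_pos (hg : IsRegular g g₀ g₁ K) (hu : Continuous u) {s : ℝ} (hs : 0 < s) :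
    0 < fluxOp P g u s := by
  refine lt_of_lt_of_le ?_ (le_fluxOp hg hu hs.le)
  have := hg.pos
  have := P.γ_pos
  positivity

lemma derivOp_nonneg (hg : IsRegular g g₀ g₁ K) (hu : Continuous u) {s : ℝ} (hs : 0 ≤ s) :
    0 ≤ derivOp P g u s := by
  have h1 := le_fluxOp (P := P) hg hu hs
  have : 0 ≤ g₀ / P.γ * s ^ P.γ := by
    have := hg.pos
    have := P.γ_pos
    positivity
  exact Real.rpow_nonneg (div_nonneg (this.trans h1) (Real.rpow_nonneg hs _)) _

lemma continuous_derivOp (hg : IsRegular g g₀ g₁ K) (hu : Continuous u) :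
    Continuous fun s => derivOp P g u (max s 0) := by
  have hβ := P.β_pos
  have hγα : 0 < P.γ - P.α := by linarith [P.α_lt_γ]
  have h : ContinuousOn (derivOp P g u) (Ici 0) := by
    intro s hs
    rcases (mem_Ici.1 hs).eq_or_lt with rfl | hs
    · have h0 : derivOp P g u 0 = 0 := by
        rw [derivOp, fluxOp, intervalIntegral.integral_same, zero_div,
          Real.zero_rpow (by positivity)]
      rw [ContinuousWithinAt, h0]
      have hlim : Tendsto (fun s : ℝ => (g₁ / P.γ * s ^ (P.γ - P.α)) ^ (1 / P.β))
          (𝓝[Ici 0] 0) (𝓝 0) := by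
        have hc : Continuous fun s : ℝ => (g₁ / P.γ * s ^ (P.γ - P.α)) ^ (1 / P.β) :=
          (Real.continuous_rpow_const (by positivity)).comp
            (continuous_const.mul (Real.continuous_rpow_const hγα.le))
        have h1 := (hc.tendsto 0).mono_left (nhdsWithin_le_nhds (s := Ici (0 : ℝ)))
        rw [Real.zero_rpow hγα.ne', mul_zero, Real.zero_rpow (by positivity)] at h1
        exact h1
      refine tendsto_of_tendsto_of_tendsto_of_le_of_le' tendsto_const_nhds hlim ?_ ?_
      · filter_upwards [self_mem_nhdsWithin] with s hs using derivOp_nonneg hg hu hs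
      · filter_upwards [self_mem_nhdsWithin] with s hs
        have hs : 0 ≤ s := hs
        rcases hs.eq_or_lt with rfl | hs
        · rw [h0, Real.zero_rpow hγα.ne', mul_zero, Real.zero_rpow (by positivity)]
        · have h2 : fluxOp P g u s / s ^ P.α ≤ g₁ / P.γ * s ^ (P.γ - P.α) := by
            rw [Real.rpow_sub hs, ← mul_div_assoc]
            have := fluxOp_le (P := P) hg hu hs.le
            gcongr
          have := (fluxOp_pos (P := P) hg hu hs).le
          unfold derivOp
          gcongr
    · refine ContinuousAt.continuousWithinAt ?_
      exact ((hasDerivAt_fluxOp hg hu s).continuousAt.div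
        (Real.continuousAt_rpow_const s _ (Or.inl hs.ne'))
        (Real.rpow_pos_of_pos hs _).ne').rpow_const (Or.inr (by positivity))
  exact h.comp_continuous (continuous_id.max continuous_const) fun s => mem_Ici.2 (le_max_right _ _)

lemma hasDerivAt_intOp (hg : IsRegular g g₀ g₁ K) (hu : Continuous u) (r : ℝ) :
    HasDerivAt (intOp P g a u) (derivOp P g u (max r 0)) r :=
  ((continuous_derivOp hg hu).integral_hasStrictDerivAt 0 r).hasDerivAt.const_add a

lemma le_intOp (hg : IsRegular g g₀ g₁ K) (hu : Continuous u) {r : ℝ} (hr : 0 ≤ r) :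
    a ≤ intOp P g a u r := by
  rw [intOp]
  have := intervalIntegral.integral_nonneg (μ := MeasureTheory.volume) hr
    (fun s hs => derivOp_nonneg (P := P) hg hu (le_max_right s 0))
  linarith

lemma abs_derivOp_sub_le (hg : IsRegular g g₀ g₁ K) (hu : Continuous u) (hv : Continuous v)
    {R s D : ℝ} (hs : 0 ≤ s) (hsR : s ≤ R) (hD : ∀ σ ∈ Icc 0 s, |u σ - v σ| ≤ D) :
    |derivOp P g u s - derivOp P g v s| ≤
      (g₀ / P.γ) ^ (1 / P.β - 1) * (K / P.γ) * R ^ ((P.γ - P.α) / P.β) * D := by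
  have hγ := P.γ_pos
  have hβ := P.β_pos
  have hg₀ := hg.pos
  have hK := hg.K_nonneg
  have hD0 : 0 ≤ D := (abs_nonneg _).trans (hD 0 ⟨le_rfl, hs⟩)
  have hR : 0 ≤ R := hs.trans hsR
  rcases hs.eq_or_lt with rfl | hs
  · have : ∀ u, derivOp P g u 0 = 0 := fun u => by
      rw [derivOp, fluxOp, intervalIntegral.integral_same, zero_div,
        Real.zero_rpow (by positivity)]
    rw [this, this, sub_zero, abs_zero]
    positivity
  · have hsα := Real.rpow_pos_of_pos hs P.α
    have hμ : 0 < g₀ / P.γ * s ^ (P.γ - P.α) := by positivity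
    have hlow : ∀ {u}, Continuous u → g₀ / P.γ * s ^ (P.γ - P.α) ≤ fluxOp P g u s / s ^ P.α := by
      intro u hu
      rw [Real.rpow_sub hs, ← mul_div_assoc]
      have := le_fluxOp (P := P) hg hu hs.le
      gcongr
    have hρ : 1 / P.β ≤ 1 := by rw [div_le_one hβ]; exact P.one_le_β
    refine (abs_rpow_sub_rpow_le (one_div_pos.2 hβ).le hρ hμ (hlow hu) (hlow hv)).trans ?_
    rw [← sub_div, abs_div, abs_of_pos hsα]
    have h1 : |fluxOp P g u s - fluxOp P g v s| / s ^ P.α ≤ K * D / P.γ * s ^ (P.γ - P.α) := by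
      rw [Real.rpow_sub hs, ← mul_div_assoc]
      have := abs_fluxOp_sub_le (P := P) hg hu hv hs.le hD
      gcongr
    have hsp := Real.rpow_pos_of_pos hs (P.γ - P.α)
    calc _ ≤ (g₀ / P.γ * s ^ (P.γ - P.α)) ^ (1 / P.β - 1) * (K * D / P.γ * s ^ (P.γ - P.α)) := by
          gcongr
      _ = (g₀ / P.γ) ^ (1 / P.β - 1) * (K / P.γ) * s ^ ((P.γ - P.α) / P.β) * D := by
          rw [Real.mul_rpow (by positivity) hsp.le, ← Real.rpow_mul hs.le]
          have : s ^ ((P.γ - P.α) / P.β) =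
              s ^ ((P.γ - P.α) * (1 / P.β - 1)) * s ^ (P.γ - P.α) := by
            rw [← Real.rpow_add hs]; congr 1; ring
          rw [this]; ring
      _ ≤ _ := by
          have : 0 ≤ (P.γ - P.α) / P.β := div_nonneg (by linarith [P.α_lt_γ]) hβ.le
          gcongr

/-- The integral operator is a contraction for the weight `exp (-Λ r)`, for a suitable `Λ`. -/
lemma exists_abs_intOp_sub_le (P : Params) (hg : IsRegular g g₀ g₁ K) {R : ℝ} (hR : 0 ≤ R) :
    ∃ Λ : ℝ, ∀ (a : ℝ) (u v : ℝ → ℝ) (D : ℝ), Continuous u → Continuous v →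
    (∀ σ ∈ Icc 0 R, |u σ - v σ| ≤ D * Real.exp (Λ * σ)) →
    ∀ r ∈ Icc 0 R, |intOp P g a u r - intOp P g a v r| ≤ D / 2 * Real.exp (Λ * r) := by
  have hγ := P.γ_pos
  have hg₀ := hg.pos
  have hK := hg.K_nonneg
  set M := (g₀ / P.γ) ^ (1 / P.β - 1) * (K / P.γ) * R ^ ((P.γ - P.α) / P.β) with hM
  set Λ := 2 * M + 1 with hΛ
  have hΛ0 : 0 < Λ := by positivity
  refine ⟨Λ, fun a u v D hu hv hD r hr => ?_⟩
  have hD0 : 0 ≤ D := by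
    have := (abs_nonneg _).trans (hD 0 ⟨le_rfl, hR⟩)
    simpa using this
  have hJ : ∀ s ∈ Icc 0 r, |derivOp P g u (max s 0) - derivOp P g v (max s 0)| ≤
      M * (D * Real.exp (Λ * s)) := by
    intro s hs
    rw [max_eq_left hs.1]
    refine abs_derivOp_sub_le hg hu hv hs.1 (hs.2.trans hr.2) fun σ hσ => ?_
    refine (hD σ ⟨hσ.1, hσ.2.trans (hs.2.trans hr.2)⟩).trans ?_
    have := hσ.2
    gcongr
  have hint : ∫ s in (0 : ℝ)..r, M * (D * Real.exp (Λ * s)) =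
      M * D / Λ * (Real.exp (Λ * r) - 1) := by
    have : ∀ s ∈ uIcc 0 r, HasDerivAt (fun s => M * D / Λ * Real.exp (Λ * s))
        (M * (D * Real.exp (Λ * s))) s := by
      intro s _
      have h1 : HasDerivAt (fun s => Real.exp (Λ * s)) (Real.exp (Λ * s) * Λ) s := by
        simpa using ((hasDerivAt_id s).const_mul Λ).exp
      refine (h1.const_mul _).congr_deriv ?_
      field_simp
    rw [intervalIntegral.integral_eq_sub_of_hasDerivAt this
      ((by fun_prop : Continuous fun s => M * (D * Real.exp (Λ * s))).intervalIntegrable _ _)]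
    simp
    ring
  rw [intOp, intOp, add_sub_add_left_eq_sub, ← intervalIntegral.integral_sub
    ((continuous_derivOp hg hu).intervalIntegrable _ _)
    ((continuous_derivOp hg hv).intervalIntegrable _ _), ← Real.norm_eq_abs]
  have h1 := intervalIntegral.norm_integral_le_of_norm_le hr.1
    (f := fun s => derivOp P g u (max s 0) - derivOp P g v (max s 0))
    (g := fun s => M * (D * Real.exp (Λ * s))) (μ := MeasureTheory.volume)
    (Eventually.of_forall fun s hs => hJ s ⟨hs.1.le, hs.2⟩)
    ((by fun_prop : Continuous fun s => M * (D * Real.exp (Λ * s))).intervalIntegrable _ _)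
  refine h1.trans ?_
  rw [hint]
  have h2 : M * D / Λ ≤ D / 2 := by
    rw [div_le_div_iff₀ hΛ0 two_pos, hΛ]
    linarith
  have h3 : 0 ≤ M * D / Λ := by positivity
  have h4 : 0 ≤ Real.exp (Λ * r) := (Real.exp_pos _).le
  nlinarith

lemma intOp_eq_unique (hg : IsRegular g g₀ g₁ K) {R : ℝ} (hR : 0 ≤ R) (hu : Continuous u)
    (hv : Continuous v) (hu' : EqOn u (intOp P g a u) (Icc 0 R))
    (hv' : EqOn v (intOp P g a v) (Icc 0 R)) : EqOn u v (Icc 0 R) := by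
  obtain ⟨Λ, hΛ⟩ := exists_abs_intOp_sub_le P hg hR
  obtain ⟨D, hD⟩ : ∃ D, ∀ σ ∈ Icc 0 R, |u σ - v σ| * Real.exp (-(Λ * σ)) ≤ D := by
    have : ContinuousOn (fun σ => |u σ - v σ| * Real.exp (-(Λ * σ))) (Icc 0 R) := by fun_prop
    obtain ⟨x, _, hx⟩ := isCompact_Icc.exists_isMaxOn (nonempty_Icc.2 hR) this
    exact ⟨_, fun σ hσ => hx hσ⟩
  have key : ∀ n : ℕ, ∀ σ ∈ Icc 0 R, |u σ - v σ| ≤ D * (1 / 2) ^ n * Real.exp (Λ * σ) := by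
    intro n
    induction n with
    | zero =>
      intro σ hσ
      have h1 := hD σ hσ
      rw [Real.exp_neg, ← div_eq_mul_inv, div_le_iff₀ (Real.exp_pos _)] at h1
      simpa using h1
    | succ n ih =>
      intro σ hσ
      have h1 := hΛ a u v _ hu hv ih σ hσ
      rw [← hu' hσ, ← hv' hσ] at h1
      refine h1.trans (le_of_eq ?_)
      ring
  intro σ hσ
  have hlim : Tendsto (fun n : ℕ => D * (1 / 2) ^ n * Real.exp (Λ * σ)) atTop (𝓝 0) := by
    have := ((tendsto_pow_atTop_nhds_zero_of_lt_one (r := (1 / 2 : ℝ)) (by norm_num)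
      (by norm_num)).const_mul D).mul_const (Real.exp (Λ * σ))
    simpa using this
  have h1 : |u σ - v σ| ≤ 0 := ge_of_tendsto' hlim fun n => key n σ hσ
  exact sub_eq_zero.1 (abs_nonpos_iff.1 h1)

lemma exists_eq_intOp (P : Params) (hg : IsRegular g g₀ g₁ K) {R : ℝ} (hR : 0 ≤ R) (a : ℝ) :
    ∃ u : ℝ → ℝ, Continuous u ∧ EqOn u (intOp P g a u) (Icc 0 R) := by
  obtain ⟨Λ, hΛ⟩ := exists_abs_intOp_sub_le P hg hR
  -- the weight is absorbed in the unknown: `u = exp (Λ r) * w`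
  set ext : C(Icc 0 R, ℝ) → ℝ → ℝ := fun w σ => Real.exp (Λ * σ) * IccExtend hR w σ with hext
  have hextc : ∀ w, Continuous (ext w) := fun w =>
    (by fun_prop : Continuous fun σ => Real.exp (Λ * σ)).mul w.continuous.Icc_extend'
  set Φ : C(Icc 0 R, ℝ) → C(Icc 0 R, ℝ) := fun w =>
    ⟨fun r => Real.exp (-(Λ * r)) * intOp P g a (ext w) r, by
      have h1 : Continuous (intOp P g a (ext w)) := continuous_iff_continuousAt.2
        fun r => (hasDerivAt_intOp hg (hextc w) r).continuousAt
      fun_prop⟩ with hΦ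
  have hlip : LipschitzWith (1 / 2) Φ := by
    refine LipschitzWith.of_dist_le_mul fun w₁ w₂ => ?_
    rw [ContinuousMap.dist_le (by positivity)]
    intro r
    have h1 := hΛ a (ext w₁) (ext w₂) (dist w₁ w₂) (hextc w₁) (hextc w₂) ?_ r r.2
    · simp only [hΦ, ContinuousMap.coe_mk]
      rw [Real.dist_eq, ← mul_sub, abs_mul, abs_of_pos (Real.exp_pos _)]
      have h2 : Real.exp (-(Λ * r)) * Real.exp (Λ * r) = 1 := by rw [← Real.exp_add]; simp
      calc _ ≤ Real.exp (-(Λ * r)) * (dist w₁ w₂ / 2 * Real.exp (Λ * r)) := by gcongr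
        _ = dist w₁ w₂ / 2 * (Real.exp (-(Λ * r)) * Real.exp (Λ * r)) := by ring
        _ = dist w₁ w₂ / 2 := by rw [h2, mul_one]
        _ = _ := by simp; ring
    · intro σ hσ
      simp only [hext]
      rw [← mul_sub, abs_mul, abs_of_pos (Real.exp_pos _), mul_comm]
      gcongr
      rw [IccExtend_of_mem hR _ hσ, IccExtend_of_mem hR _ hσ, ← Real.dist_eq]
      exact ContinuousMap.dist_apply_le_dist _
  have hcon : ContractingWith (1 / 2) Φ := ⟨by
    rw [← NNReal.coe_lt_coe]; norm_num, hlip⟩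
  refine ⟨ext (ContractingWith.fixedPoint Φ hcon), hextc _, fun r hr => ?_⟩
  have h1 := hcon.fixedPoint_isFixedPt
  set w := ContractingWith.fixedPoint Φ hcon
  have h2 : (Φ w) ⟨r, hr⟩ = w ⟨r, hr⟩ := congrArg (fun w : C(Icc 0 R, ℝ) => w ⟨r, hr⟩) h1
  simp only [hΦ, ContinuousMap.coe_mk] at h2
  have h3 : ext w r = Real.exp (Λ * r) * w ⟨r, hr⟩ := by
    simp only [hext]
    rw [IccExtend_of_mem hR _ hr]
  rw [h3, ← h2, ← mul_assoc, ← Real.exp_add]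
  simp

end

/-! ### Truncation of the nonlinearity -/

/-- The function `1 / f`, truncated outside `[a, b]`. -/
def truncInv (P : Params) (a b v : ℝ) : ℝ := 1 / P.f (max a (min v b))

lemma exists_isRegular_truncInv (P : Params) {a b : ℝ} (ha : 0 < a) (hab : a ≤ b)
    (hb : Real.log b < P.C) : ∃ g₀ g₁ K, IsRegular (truncInv P a b) g₀ g₁ K := by
  have hmem : ∀ v, max a (min v b) ∈ Icc a b := fun v => ⟨le_max_left _ _, max_le hab (min_le_right _ _)⟩
  have hpos : ∀ x ∈ Icc a b, 0 < x := fun x hx => ha.trans_le hx.1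
  have hlog : ∀ x ∈ Icc a b, 0 < P.C - Real.log x := fun x hx => by
    have := Real.log_le_log (hpos x hx) hx.2
    linarith
  set G : ℝ → ℝ := fun x => Real.exp (-(P.m * Real.log x + P.d * Real.log (P.C - Real.log x)))
    with hG
  set G' : ℝ → ℝ := fun x => G x * -(P.m * x⁻¹ + P.d * (-x⁻¹ / (P.C - Real.log x)))
  have hGd : ∀ x ∈ Icc a b, HasDerivAt G (G' x) x := by
    intro x hx
    have h1 := Real.hasDerivAt_log (hpos x hx).ne'
    exact ((h1.const_mul P.m).add
      (((h1.const_sub P.C).log (hlog x hx).ne').const_mul P.d)).neg.exp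
  have hGc : ContinuousOn G (Icc a b) := fun x hx => (hGd x hx).continuousAt.continuousWithinAt
  have hlc : ContinuousOn Real.log (Icc a b) := fun x hx =>
    (Real.continuousAt_log (hpos x hx).ne').continuousWithinAt
  have hG'c : ContinuousOn G' (Icc a b) := by
    have hi : ContinuousOn (fun x : ℝ => x⁻¹) (Icc a b) :=
      continuousOn_id.inv₀ fun x hx => (hpos x hx).ne'
    exact hGc.mul ((continuousOn_const.mul hi).add (continuousOn_const.mul
      (hi.neg.div (continuousOn_const.sub hlc) fun x hx => (hlog x hx).ne'))).neg
  have hGe : ∀ v, truncInv P a b v = G (max a (min v b)) := by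
    intro v
    have hm := hmem v
    rw [truncInv, Params.f, nonlin_eq (hpos _ hm) (by linarith [hlog _ hm]), one_div,
      ← Real.exp_neg]
  have hne : (Icc a b).Nonempty := nonempty_Icc.2 hab
  obtain ⟨x₀, hx₀, hmin⟩ := isCompact_Icc.exists_isMinOn hne hGc
  obtain ⟨x₁, hx₁, hmax⟩ := isCompact_Icc.exists_isMaxOn hne hGc
  obtain ⟨x₂, hx₂, hK⟩ := isCompact_Icc.exists_isMaxOn hne hG'c.norm
  have hclip : ∀ v v', |max a (min v b) - max a (min v' b)| ≤ |v - v'| := by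
    intro v v'
    refine (abs_max_sub_max_le_max _ _ _ _).trans ?_
    rw [sub_self, abs_zero, max_eq_right (abs_nonneg _)]
    refine (abs_min_sub_min_le_max _ _ _ _).trans ?_
    rw [sub_self, abs_zero, max_eq_left (abs_nonneg _)]
  refine ⟨G x₀, G x₁, ‖G' x₂‖, Real.exp_pos _, norm_nonneg _, ?_, ?_, ?_, ?_⟩
  · have : truncInv P a b = G ∘ fun v => max a (min v b) := funext hGe
    rw [this]
    exact hGc.comp_continuous (by fun_prop) hmem
  · intro v
    rw [hGe]; exact hmin (hmem v)
  · intro v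
    rw [hGe]; exact hmax (hmem v)
  · intro v v'
    rw [hGe, hGe]
    have h1 := (convex_Icc a b).norm_image_sub_le_of_norm_hasDerivWithin_le
      (fun x hx => (hGd x hx).hasDerivWithinAt) (fun x hx => hK hx) (hmem v') (hmem v)
    rw [Real.norm_eq_abs, Real.norm_eq_abs (max a (min v b) - _)] at h1
    exact h1.trans (mul_le_mul_of_nonneg_left (hclip v v') (norm_nonneg _))

lemma truncInv_eq {P : Params} {a b v : ℝ} (hav : a ≤ v) (hvb : v ≤ b) :
    truncInv P a b v = 1 / P.f v := by
  rw [truncInv, min_eq_left hvb, max_eq_right hav]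

/-- As long as it stays below `b`, a fixed point of the integral operator solves the equation. -/
lemma isSolution_of_eq_intOp {P : Params} {a b R r₂ : ℝ} {u : ℝ → ℝ} (ha : 0 < a) (hab : a ≤ b)
    (hb : Real.log b < P.C) (hr₂R : r₂ ≤ R) (hr₂ : 0 < r₂) (hu : Continuous u)
    (hfix : EqOn u (intOp P (truncInv P a b) a u) (Icc 0 R)) (hub : ∀ r ∈ Ioo 0 r₂, u r ≤ b) :
    IsSolution P.α P.β P.γ P.f a r₂ u := by
  obtain ⟨g₀, g₁, K, hg⟩ := exists_isRegular_truncInv P ha hab hb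
  refine Params.isSolution_of_isSystem (φ := fluxOp P (truncInv P a b) u) (fun r hr => ?_)
    hu.continuousOn ?_
  · have hrR : r ∈ Icc 0 R := ⟨hr.1.le, hr.2.le.trans hr₂R⟩
    have hau : a ≤ u r := by rw [hfix hrR]; exact le_intOp hg hu hr.1.le
    have hpos : 0 < u r := ha.trans_le hau
    have hlog : Real.log (u r) < P.C := (Real.log_le_log hpos (hub r hr)).trans_lt hb
    refine ⟨hpos, hlog, fluxOp_pos hg hu hr.1, ?_, ?_⟩
    · have h1 := hasDerivAt_intOp (P := P) (a := a) hg hu r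
      rw [max_eq_left hr.1.le] at h1
      refine h1.congr_of_eventuallyEq ?_
      filter_upwards [isOpen_Ioo.mem_nhds hr] with s hs
      exact hfix ⟨hs.1.le, hs.2.le.trans hr₂R⟩
    · refine (hasDerivAt_fluxOp hg hu r).congr_deriv ?_
      rw [truncInv_eq hau (hub r hr)]
      ring
  · have := hfix ⟨le_rfl, hr₂.le.trans hr₂R⟩
    rw [this, intOp, intervalIntegral.integral_same, add_zero]

/-- A solution below `b` is a fixed point of the integral operator. -/
lemma IsSolution.eq_intOp {P : Params} {a b R r₁ : ℝ} {u v : ℝ → ℝ} (ha : 0 < a) (hab : a ≤ b)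
    (hb : Real.log b < P.C) (hR : R < r₁) (h : IsSolution P.α P.β P.γ P.f a r₁ u)
    (hub : ∀ r ∈ Ioo 0 r₁, u r ≤ b) (hv : Continuous v) (huv : EqOn v u (Icc 0 R)) :
    EqOn v (intOp P (truncInv P a b) a v) (Icc 0 R) := by
  obtain ⟨g₀, g₁, K, hg⟩ := exists_isRegular_truncInv P ha hab hb
  have hβ := P.one_le_β
  have hα := P.β_lt_α.le
  intro r hr
  have hr₁ : 0 < r₁ := (hr.1.trans hr.2).trans_lt hR
  have hau : ∀ s ∈ Ioo 0 r₁, a ≤ u s := by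
    intro s hs
    rw [← h.init]
    exact (h.strictMonoOn hβ hα).monotoneOn ⟨le_rfl, hr₁⟩ ⟨hs.1.le, hs.2⟩ hs.1.le
  have hφ0 : flux P.α P.β u 0 = 0 := by
    rw [flux, Real.zero_rpow P.α_pos.ne', zero_mul, zero_mul]
  have hflux : ∀ s ∈ Icc 0 r, fluxOp P (truncInv P a b) v s = flux P.α P.β u s := by
    intro s hs
    have hsR : s < r₁ := (hs.2.trans hr.2).trans_lt hR
    have h1 := intervalIntegral.integral_eq_sub_of_hasDerivAt_of_le (f := flux P.α P.β u)
      (f' := fun σ => σ ^ (P.γ - 1) * truncInv P a b (v σ)) hs.1 ?_ ?_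
      ((continuous_integrand hg hv).intervalIntegrable _ _)
    · rw [fluxOp, h1, hφ0, sub_zero]
    · intro σ hσ
      rcases hσ.1.eq_or_lt with rfl | hσ0
      · have h2 : ContinuousWithinAt (flux P.α P.β u) (Ici 0) 0 :=
          continuousWithinAt_Ioi_iff_Ici.1 (by
            rw [ContinuousWithinAt, hφ0]; exact h.tendsto_flux hβ hα hr₁)
        exact h2.mono Icc_subset_Ici_self
      · exact (h.hasDerivAt_flux ⟨hσ0, hσ.2.trans_lt hsR⟩).continuousAt.continuousWithinAt
    · intro σ hσ
      have hσ' : σ ∈ Ioo 0 r₁ := ⟨hσ.1, hσ.2.trans hsR⟩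
      refine (h.hasDerivAt_flux hσ').congr_deriv ?_
      rw [huv ⟨hσ.1.le, (hσ.2.le.trans hs.2).trans hr.2⟩,
        truncInv_eq (hau σ hσ') (hub σ hσ')]
      ring
  have h1 := intervalIntegral.integral_eq_sub_of_hasDerivAt_of_le (f := u)
    (f' := fun s => derivOp P (truncInv P a b) v (max s 0)) hr.1 ?_ ?_
    ((continuous_derivOp hg hv).intervalIntegrable _ _)
  · rw [intOp, h1, h.init, huv hr]; ring
  · exact h.continuousOn.mono fun s hs => ⟨hs.1, (hs.2.trans hr.2).trans_lt hR⟩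
  · intro s hs
    have hs' : s ∈ Ioo 0 r₁ := ⟨hs.1, (hs.2.le.trans hr.2).trans_lt hR⟩
    refine (h.hasDerivAt hs').congr_deriv ?_
    rw [h.deriv_eq hβ hα hs', max_eq_left hs.1.le, derivOp, hflux s ⟨hs.1.le, hs.2.le⟩]

/-! ### Existence and uniqueness -/

/-- Choice of the scales: `k` is a constant of the a priori bound of `Traj.exists_exp_lam_le`, and
for `r₀`, `a₀` small this bound keeps solutions below `exp (C - L)`. -/
structure Admissible (P : Params) (k L r₀ a₀ : ℝ) : Prop where
  one_le_L : 1 ≤ L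
  d_le : P.d ≤ P.m * L
  r₀_pos : 0 < r₀
  a₀_pos : 0 < a₀
  a₀_le : a₀ ≤ Real.exp (P.C - L)
  k_pos : 0 < k
  bound : ∀ {L T h₀ : ℝ} {z w : ℝ → ℝ}, Traj P L T z w →
    Tendsto (fun t => Real.exp (P.lam (z t))) atBot (𝓝 h₀) →
    ∀ t < T, Real.exp (P.lam (z t)) ≤ h₀ + k * Real.exp (P.p * t)
  small : ∀ a ∈ Ico 0 a₀, ∀ r ∈ Icc 0 r₀,
    P.core a + k * r ^ P.p ≤ Real.exp (P.lam (P.C - L)) / 2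

lemma Params.core_zero (P : Params) : P.core 0 = 0 := by simp [Params.core]

lemma exists_admissible (P : Params) (L₀ : ℝ) :
    ∃ k L r₀ a₀, L₀ ≤ L ∧ Admissible P k L r₀ a₀ := by
  obtain ⟨k, hk, hbound⟩ := Traj.exists_exp_lam_le P
  have hm := P.m_pos
  have hp := P.p_pos
  set L := max (max 1 L₀) (P.d / P.m)
  have hL1 : 1 ≤ L := (le_max_left _ _).trans (le_max_left _ _)
  have hL0 : L₀ ≤ L := (le_max_right _ _).trans (le_max_left _ _)
  have hLd : P.d ≤ P.m * L := by
    have : P.d / P.m ≤ L := le_max_right _ _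
    rwa [div_le_iff₀ hm, mul_comm] at this
  set H := Real.exp (P.lam (P.C - L))
  have hH0 : 0 < H := Real.exp_pos _
  obtain ⟨a₁, ha₁, ha₁'⟩ : ∃ a₁ > 0, ∀ a ∈ Ioo 0 a₁, P.core a < H / 4 := by
    have h1 := P.tendsto_core.eventually_lt_const (show 0 < H / 4 by positivity)
    obtain ⟨a₁, ha₁, h2⟩ := mem_nhdsGT_iff_exists_Ioo_subset.1 h1
    exact ⟨a₁, ha₁, fun a ha => h2 ha⟩
  obtain ⟨r₀, hr₀, hr₀'⟩ : ∃ r₀ > 0, k * r₀ ^ P.p ≤ H / 4 := by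
    refine ⟨(H / (4 * k)) ^ (1 / P.p), by positivity, ?_⟩
    rw [← Real.rpow_mul (by positivity), one_div_mul_cancel hp.ne', Real.rpow_one]
    apply le_of_eq
    field_simp
  refine ⟨k, L, r₀, min a₁ (Real.exp (P.C - L)), hL0, hL1, hLd, hr₀,
    lt_min ha₁ (Real.exp_pos _), min_le_right _ _, hk, hbound, fun a ha r hr => ?_⟩
  have h1 : P.core a ≤ H / 4 := by
    rcases ha.1.eq_or_lt with rfl | ha0
    · rw [P.core_zero]; positivity
    · exact (ha₁' a ⟨ha0, ha.2.trans_le (min_le_left _ _)⟩).le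
  have h2 : k * r ^ P.p ≤ k * r₀ ^ P.p := by
    have := Real.rpow_le_rpow hr.1 hr.2 hp.le
    gcongr
  linarith

namespace Admissible

variable {P : Params} {k L r₀ a₀ a r₁ : ℝ} {u : ℝ → ℝ}

lemma lt_exp_C (h : Admissible P k L r₀ a₀) (ha : a < a₀) : a < Real.exp P.C :=
  ha.trans_le (h.a₀_le.trans (Real.exp_le_exp.2 (by linarith [h.one_le_L])))

lemma traj (h : Admissible P k L r₀ a₀) (hr₁ : 0 < r₁)
    (hu : IsSolution P.α P.β P.γ P.f a r₁ u) (hle : ∀ r ∈ Ioo 0 r₁, u r ≤ Real.exp (P.C - L)) :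
    Traj P L (Real.log r₁) (logOf u) (logOf (flux P.α P.β u)) :=
  hu.traj hr₁ (by linarith [h.one_le_L]) h.d_le hle

lemma exp_lam_le (h : Admissible P k L r₀ a₀) (ha : a ∈ Ico 0 a₀)
    (hu : IsSolution P.α P.β P.γ P.f a r₁ u) (hle : ∀ r ∈ Ioo 0 r₁, u r ≤ Real.exp (P.C - L))
    {r : ℝ} (hr : r ∈ Ioo 0 r₁) : Real.exp (P.lam (Real.log (u r))) ≤ P.core a + k * r ^ P.p := by
  have hr₁ := hr.1.trans hr.2
  have h1 := h.bound (h.traj hr₁ hu hle) (hu.tendsto_exp_lam hr₁ ha.1 (h.lt_exp_C ha.2))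
    (Real.log r) (Real.log_lt_log hr.1 hr.2)
  rwa [logOf, Real.exp_log hr.1, mul_comm P.p, ← Real.rpow_def_of_pos hr.1] at h1

/-- A solution cannot reach the value `exp (C - L)` up to `r = r₀`. -/
lemma ne_of_continuousAt (h : Admissible P k L r₀ a₀) (ha : a ∈ Ico 0 a₀) (hr₁ : 0 < r₁)
    (hr₁' : r₁ ≤ r₀) (hu : IsSolution P.α P.β P.γ P.f a r₁ u)
    (hle : ∀ r ∈ Ioo 0 r₁, u r ≤ Real.exp (P.C - L)) (hc : ContinuousAt u r₁) :
    u r₁ ≠ Real.exp (P.C - L) := by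
  intro heq
  have hL := h.one_le_L
  have h1 : ContinuousAt (fun r => Real.exp (P.lam (Real.log (u r)))) r₁ := by
    have h2 : ContinuousAt (fun r => Real.log (u r)) r₁ :=
      hc.log (by rw [heq]; positivity)
    have h3 : P.C - Real.log (u r₁) ≠ 0 := by rw [heq, Real.log_exp]; linarith
    exact Real.continuous_exp.continuousAt.comp
      (h2.add (continuousAt_const.mul ((continuousAt_const.sub h2).log h3)))
  have h2 : Real.exp (P.lam (Real.log (u r₁))) ≤ Real.exp (P.lam (P.C - L)) / 2 := by
    refine le_of_tendsto (h1.mono_left (nhdsWithin_le_nhds (s := Iio r₁))) ?_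
    filter_upwards [Ioo_mem_nhdsLT hr₁] with r hr
    exact (h.exp_lam_le ha hu hle hr).trans (h.small a ha r ⟨hr.1.le, hr.2.le.trans hr₁'⟩)
  rw [heq, Real.log_exp] at h2
  linarith [Real.exp_pos (P.lam (P.C - L))]

lemma lt_of_isSolution (h : Admissible P k L r₀ a₀) (ha : a ∈ Ico 0 a₀) (hr₁' : r₁ ≤ r₀)
    (hu : IsSolution P.α P.β P.γ P.f a r₁ u) {r : ℝ} (hr : r ∈ Ioo 0 r₁) :
    u r < Real.exp (P.C - L) := by
  by_contra! hcon
  have h0 : u 0 < Real.exp (P.C - L) := by rw [hu.init]; exact ha.2.trans_le h.a₀_le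
  obtain ⟨r₂, hr₂, heq⟩ := intermediate_value_Icc hr.1.le
    (hu.continuousOn.mono fun s hs => ⟨hs.1, hs.2.trans_lt hr.2⟩) ⟨h0.le, hcon⟩
  have hr₂0 : 0 < r₂ := by
    rcases hr₂.1.eq_or_lt with rfl | h
    · exact absurd heq h0.ne
    · exact h
  have hr₂1 : r₂ < r₁ := hr₂.2.trans_lt hr.2
  refine h.ne_of_continuousAt ha hr₂0 (hr₂1.le.trans hr₁') (hu.mono hr₂1.le) (fun s hs => ?_)
    (hu.hasDerivAt ⟨hr₂0, hr₂1⟩).continuousAt heq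
  rw [← heq]
  exact (hu.strictMonoOn P.one_le_β P.β_lt_α.le).monotoneOn ⟨hs.1.le, hs.2.trans hr₂1⟩
    ⟨hr₂0.le, hr₂1⟩ hs.2.le

lemma log_exp_lt (h : Admissible P k L r₀ a₀) : Real.log (Real.exp (P.C - L)) < P.C := by
  rw [Real.log_exp]; linarith [h.one_le_L]

lemma exists_regular (h : Admissible P k L r₀ a₀) (ha : a ∈ Ioo 0 a₀) :
    ∃ u, IsSolution P.α P.β P.γ P.f a r₀ u := by
  set b := Real.exp (P.C - L)
  have hab : a < b := ha.2.trans_le h.a₀_le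
  obtain ⟨g₀, g₁, K, hg⟩ := exists_isRegular_truncInv P ha.1 hab.le h.log_exp_lt
  obtain ⟨u, hu, hfix⟩ := exists_eq_intOp P hg h.r₀_pos.le a
  have hmono : Monotone (intOp P (truncInv P a b) a u) := by
    refine monotone_of_deriv_nonneg (fun r => (hasDerivAt_intOp hg hu r).differentiableAt)
      fun r => ?_
    rw [(hasDerivAt_intOp hg hu r).deriv]
    exact derivOp_nonneg hg hu (le_max_right _ _)
  have hu0 : u 0 = a := by
    rw [hfix ⟨le_rfl, h.r₀_pos.le⟩, intOp, intervalIntegral.integral_same, add_zero]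
  refine ⟨u, isSolution_of_eq_intOp ha.1 hab.le h.log_exp_lt le_rfl h.r₀_pos hu hfix
    fun r hr => ?_⟩
  by_contra! hcon
  obtain ⟨r₂, hr₂, heq⟩ := intermediate_value_Icc hr.1.le hu.continuousOn
    (show b ∈ Icc (u 0) (u r) from ⟨hu0 ▸ hab.le, hcon.le⟩)
  have hr₂0 : 0 < r₂ := by
    rcases hr₂.1.eq_or_lt with rfl | h
    · exact absurd (hu0 ▸ heq) hab.ne
    · exact h
  have hr₂1 : r₂ ≤ r₀ := hr₂.2.trans hr.2.le
  have hle : ∀ s ∈ Ioo 0 r₂, u s ≤ b := fun s hs => by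
    rw [← heq, hfix ⟨hs.1.le, hs.2.le.trans hr₂1⟩, hfix ⟨hr₂0.le, hr₂1⟩]
    exact hmono hs.2.le
  exact h.ne_of_continuousAt ⟨ha.1.le, ha.2⟩ hr₂0 hr₂1
    (isSolution_of_eq_intOp ha.1 hab.le h.log_exp_lt hr₂1 hr₂0 hu hfix hle) hle
    hu.continuousAt heq

lemma regular_unique (h : Admissible P k L r₀ a₀) (ha : a ∈ Ioo 0 a₀) {v : ℝ → ℝ}
    (hu : IsSolution P.α P.β P.γ P.f a r₀ u) (hv : IsSolution P.α P.β P.γ P.f a r₀ v) :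
    EqOn v u (Ico 0 r₀) := by
  intro r hr
  have hab : a < Real.exp (P.C - L) := ha.2.trans_le h.a₀_le
  obtain ⟨g₀, g₁, K, hg⟩ := exists_isRegular_truncInv P ha.1 hab.le h.log_exp_lt
  have key : ∀ {w : ℝ → ℝ}, IsSolution P.α P.β P.γ P.f a r₀ w →
      ∃ w', Continuous w' ∧ EqOn w' w (Icc 0 r) ∧
        EqOn w' (intOp P (truncInv P a (Real.exp (P.C - L))) a w') (Icc 0 r) := by
    intro w hw
    have hc : ContinuousOn w (Icc 0 r) :=
      hw.continuousOn.mono fun s hs => ⟨hs.1, hs.2.trans_lt hr.2⟩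
    have hc' : Continuous (IccExtend hr.1 ((Icc 0 r).domRestrict w)) :=
      (continuousOn_iff_continuous_domRestrict.1 hc).Icc_extend'
    have heq : EqOn (IccExtend hr.1 ((Icc 0 r).domRestrict w)) w (Icc 0 r) := fun s hs => by
      rw [IccExtend_of_mem hr.1 _ hs, domRestrict_apply]
    exact ⟨_, hc', heq, hw.eq_intOp ha.1 hab.le h.log_exp_lt hr.2
      (fun s hs => (h.lt_of_isSolution ⟨ha.1.le, ha.2⟩ le_rfl hw hs).le) hc' heq⟩
  obtain ⟨u', hu'c, hu'e, hu'f⟩ := key hu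
  obtain ⟨v', hv'c, hv'e, hv'f⟩ := key hv
  have hmem : r ∈ Icc 0 r := ⟨hr.1, le_rfl⟩
  rw [← hu'e hmem, ← hv'e hmem]
  exact (intOp_eq_unique hg hr.1 hu'c hv'c hu'f hv'f hmem).symm

end Admissible

/-- The conclusion of `Traj.exists_abs_sub_le` for the size `L` of the cut-off: two solutions
approach each other at the rate `c` outside their cores. -/
def Contracts (P : Params) (L K c : ℝ) : Prop :=
  ∀ {T h₁ h₂ : ℝ} {z₁ w₁ z₂ w₂ : ℝ → ℝ}, Traj P L T z₁ w₁ → Traj P L T z₂ w₂ →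
    Tendsto (fun t => Real.exp (P.lam (z₁ t))) atBot (𝓝 h₁) →
    Tendsto (fun t => Real.exp (P.lam (z₂ t))) atBot (𝓝 h₂) →
    ∀ {s t : ℝ}, s ≤ t → t < T → h₁ ≤ Real.exp (P.p * s) → h₂ ≤ Real.exp (P.p * s) →
    |P.xVar t (z₂ t) (w₂ t) - P.xVar t (z₁ t) (w₁ t)| ≤ K * Real.exp (-c * (t - s)) ∧
    |P.yVar t (z₂ t) (w₂ t) - P.yVar t (z₁ t) (w₁ t)| ≤ K * Real.exp (-c * (t - s)) ∧
    |z₂ t - z₁ t| ≤ K * Real.exp (-c * (t - s))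

lemma tendsto_exp_decay {c : ℝ} (hc : 0 < c) (K t : ℝ) :
    Tendsto (fun s => K * Real.exp (-c * (t - s))) atBot (𝓝 0) := by
  have h1 : Tendsto (fun s : ℝ => -c * (t - s)) atBot atBot := by
    have : (fun s : ℝ => -c * (t - s)) = fun s => -c * t + c * s := by ext s; ring
    rw [this]
    exact tendsto_atBot_add_const_left _ _ (tendsto_id.const_mul_atBot hc)
  simpa using (Real.tendsto_exp_atBot.comp h1).const_mul K

lemma Admissible.singular_unique {P : Params} {k L r₀ a₀ r₁ K c : ℝ} {u v : ℝ → ℝ}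
    (h : Admissible P k L r₀ a₀) (hc : 0 < c) (hK : Contracts P L K c) (hr₁' : r₁ ≤ r₀)
    (hu : IsSolution P.α P.β P.γ P.f 0 r₁ u) (hv : IsSolution P.α P.β P.γ P.f 0 r₁ v) :
    EqOn v u (Ico 0 r₁) := by
  intro r hr
  rcases hr.1.eq_or_lt with rfl | hr0
  · rw [hu.init, hv.init]
  have hr' : r ∈ Ioo 0 r₁ := ⟨hr0, hr.2⟩
  have hr₁ := hr0.trans hr.2
  have h0 : (0 : ℝ) ∈ Ico 0 a₀ := ⟨le_rfl, h.a₀_pos⟩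
  have hul := h.traj hr₁ hu fun s hs => (h.lt_of_isSolution h0 hr₁' hu hs).le
  have hvl := h.traj hr₁ hv fun s hs => (h.lt_of_isSolution h0 hr₁' hv hs).le
  have hut := hu.tendsto_exp_lam hr₁ le_rfl (Real.exp_pos _)
  have hvt := hv.tendsto_exp_lam hr₁ le_rfl (Real.exp_pos _)
  rw [P.core_zero] at hut hvt
  have key : |logOf v (Real.log r) - logOf u (Real.log r)| ≤ 0 := by
    refine ge_of_tendsto (tendsto_exp_decay hc K (Real.log r)) ?_
    filter_upwards [eventually_le_atBot (Real.log r)] with s hs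
    exact (hK hul hvl hut hvt hs (Real.log_lt_log hr0 hr.2) (Real.exp_pos _).le
      (Real.exp_pos _).le).2.2
  rw [hu.eq_exp_logOf hr', hv.eq_exp_logOf hr', sub_eq_zero.1 (abs_nonpos_iff.1 key)]

/-! ### The singular solution as a limit of regular solutions -/

/-- Continuous convergence at every point, for a limit that is continuous, is locally uniform
convergence. -/
lemma tendstoLocallyUniformlyOn_of_tendsto {ι : Type*} {l : Filter ι} {F : ι → ℝ → ℝ} {f : ℝ → ℝ}
    {s : Set ℝ} (hf : ContinuousOn f s)
    (h : ∀ x ∈ s, Tendsto (fun y : ι × ℝ => F y.1 y.2) (l ×ˢ 𝓝[s] x) (𝓝 (f x))) :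
    TendstoLocallyUniformlyOn F f l s := by
  rw [tendstoLocallyUniformlyOn_iff_forall_tendsto]
  intro x hx
  refine (((hf x hx).tendsto.comp tendsto_snd).prodMk_nhds (h x hx)).mono_right ?_
  exact nhds_le_uniformity (f x)

lemma tendsto_of_tendstoLocallyUniformlyOn {ι : Type*} {l : Filter ι} {F : ι → ℝ → ℝ}
    {f : ℝ → ℝ} {s : Set ℝ} (hf : ContinuousOn f s) (h : TendstoLocallyUniformlyOn F f l s)
    {x : ℝ} (hx : x ∈ s) : Tendsto (fun y : ι × ℝ => F y.1 y.2) (l ×ˢ 𝓝[s] x) (𝓝 (f x)) := by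
  rw [tendstoLocallyUniformlyOn_iff_forall_tendsto] at h
  exact (Uniform.tendsto_congr (h x hx)).1 ((hf x hx).tendsto.comp tendsto_snd)

/-- A limit of solutions whose cores shrink to the origin is a singular solution. -/
lemma Traj.of_tendsto {ι : Type*} {l : Filter ι} [l.NeBot] {P : Params} {L T k : ℝ} {h : ι → ℝ}
    {Z W : ι → ℝ → ℝ} {z w : ℝ → ℝ} (hL1 : 1 ≤ L) (hdL : P.d ≤ P.m * L)
    (hTraj : ∀ i, Traj P L T (Z i) (W i))
    (hh : Tendsto h l (𝓝 0)) (hk : 0 < k)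
    (hb : ∀ i, ∀ t < T, Real.exp (P.lam (Z i t)) ≤ h i + k * Real.exp (P.p * t))
    (hZ : TendstoLocallyUniformlyOn Z z l (Iio T)) (hW : TendstoLocallyUniformlyOn W w l (Iio T)) :
    Traj P L T z w ∧ Tendsto z atBot atBot := by
  have hp := P.p_pos
  have hβ := P.β_pos
  obtain ⟨k2, hk2⟩ := Traj.exists_x_add_lam_le P
  have hzc : ContinuousOn z (Iio T) := hZ.continuousOn (Frequently.of_forall fun i t ht =>
    ((hTraj i).hasDerivAt_z t ht).continuousAt.continuousWithinAt)
  have hwc : ContinuousOn w (Iio T) := hW.continuousOn (Frequently.of_forall fun i t ht =>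
    ((hTraj i).hasDerivAt_w t ht).continuousAt.continuousWithinAt)
  have hz1 : ∀ t < T, Tendsto (fun i => Z i t) l (𝓝 (z t)) := fun t ht => hZ.tendsto_at ht
  have hw1 : ∀ t < T, Tendsto (fun i => W i t) l (𝓝 (w t)) := fun t ht => hW.tendsto_at ht
  have hle : ∀ t < T, z t ≤ P.C - L := fun t ht =>
    le_of_tendsto (hz1 t ht) (Eventually.of_forall fun i => (hTraj i).le t ht)
  have hCz : ∀ t < T, 1 ≤ P.C - z t := fun t ht => by linarith [hle t ht]
  have hlamc : ∀ t < T, ContinuousAt P.lam (z t) := fun t ht => by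
    have := hCz t ht
    exact continuousAt_id.add (continuousAt_const.mul
      ((continuousAt_const.sub continuousAt_id).log (by simp; linarith)))
  have hlam1 : ∀ t < T, Tendsto (fun i => P.lam (Z i t)) l (𝓝 (P.lam (z t))) :=
    fun t ht => (hlamc t ht).tendsto.comp (hz1 t ht)
  have hlamz : ∀ t < T, z t ≤ P.lam (z t) := fun t ht => by
    have h1 : 0 ≤ Real.log (P.C - z t) := Real.log_nonneg (hCz t ht)
    have h2 : 0 ≤ P.d / (P.m + P.β) := div_nonneg P.d_nonneg P.mβ_pos.le
    have := mul_nonneg h2 h1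
    unfold Params.lam
    linarith
  -- convergence of the right-hand sides of the system
  have hx2 : ∀ t ∈ Iio T, Tendsto (fun y : ι × ℝ => P.xVar y.2 (Z y.1 y.2) (W y.1 y.2))
      (l ×ˢ 𝓝[Iio T] t) (𝓝 (P.xVar t (z t) (w t))) := by
    intro t ht
    have hz2 := tendsto_of_tendstoLocallyUniformlyOn hzc hZ ht
    have hw2 := tendsto_of_tendstoLocallyUniformlyOn hwc hW ht
    have ht2 : Tendsto (fun y : ι × ℝ => y.2) (l ×ˢ 𝓝[Iio T] t) (𝓝 t) :=
      (tendsto_nhdsWithin_iff.1 tendsto_snd).1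
    exact (ht2.add ((hw2.sub (ht2.const_mul P.α)).div_const P.β)).sub hz2
  have hy2 : ∀ t ∈ Iio T, Tendsto (fun y : ι × ℝ => P.yVar y.2 (Z y.1 y.2) (W y.1 y.2))
      (l ×ˢ 𝓝[Iio T] t) (𝓝 (P.yVar t (z t) (w t))) := by
    intro t ht
    have hz2 := tendsto_of_tendstoLocallyUniformlyOn hzc hZ ht
    have hw2 := tendsto_of_tendstoLocallyUniformlyOn hwc hW ht
    have ht2 : Tendsto (fun y : ι × ℝ => y.2) (l ×ˢ 𝓝[Iio T] t) (𝓝 t) :=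
      (tendsto_nhdsWithin_iff.1 tendsto_snd).1
    have := hCz t ht
    exact (((ht2.const_mul P.γ).sub (hz2.const_mul P.m)).sub
      (((hz2.const_sub P.C).log (by linarith)).const_mul P.d)).sub hw2
  have hxc : ContinuousOn (fun t => P.xVar t (z t) (w t)) (Iio T) :=
    (continuousOn_id.add ((hwc.sub (continuousOn_const.mul continuousOn_id)).div_const _)).sub hzc
  have hyc : ContinuousOn (fun t => P.yVar t (z t) (w t)) (Iio T) :=
    (((continuousOn_const.mul continuousOn_id).sub (continuousOn_const.mul hzc)).sub
      (continuousOn_const.mul ((continuousOn_const.sub hzc).log fun t ht => by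
        have h1 := hCz t ht
        have h2 : (0 : ℝ) < P.C - z t := by linarith
        exact h2.ne'))).sub hwc
  have hzlim : Tendsto z atBot atBot := by
    have h1 : ∀ t < T, Real.exp (z t) ≤ k * Real.exp (P.p * t) := by
      intro t ht
      have h2 : Tendsto (fun i => h i + k * Real.exp (P.p * t)) l
          (𝓝 (0 + k * Real.exp (P.p * t))) := hh.add_const _
      rw [zero_add] at h2
      have h3 := le_of_tendsto_of_tendsto (hlam1 t ht).rexp h2
        (Eventually.of_forall fun i => hb i t ht)
      exact (Real.exp_le_exp.2 (hlamz t ht)).trans h3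
    have h4 : Tendsto (fun t => Real.log k + P.p * t) atBot atBot :=
      tendsto_atBot_add_const_left _ _ (tendsto_id.const_mul_atBot hp)
    refine tendsto_atBot_mono' _ ?_ h4
    filter_upwards [eventually_lt_atBot T] with t ht
    rw [← Real.exp_le_exp, Real.exp_add, Real.exp_log hk]
    exact h1 t ht
  refine ⟨⟨by linarith, hdL, hle, ?_, ?_, ?_⟩, hzlim⟩
  · intro t ht
    exact hasDerivAt_of_tendstoLocallyUniformlyOn isOpen_Iio
      (tendstoLocallyUniformlyOn_of_tendsto (F := fun i t => Real.exp (P.xVar t (Z i t) (W i t)))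
        hxc.rexp fun t ht => (hx2 t ht).rexp)
      (Eventually.of_forall fun i => (hTraj i).hasDerivAt_z) hz1 ht
  · intro t ht
    exact hasDerivAt_of_tendstoLocallyUniformlyOn isOpen_Iio
      (tendstoLocallyUniformlyOn_of_tendsto (F := fun i t => Real.exp (P.yVar t (Z i t) (W i t)))
        hyc.rexp fun t ht => (hy2 t ht).rexp)
      (Eventually.of_forall fun i => (hTraj i).hasDerivAt_w) hw1 ht
  · have h1 : ∀ t < T, w t ≤ P.β * k2 + P.q * t := by
      intro t ht
      have h2 : Tendsto (fun i => P.xVar t (Z i t) (W i t) + P.lam (Z i t)) l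
          (𝓝 (P.xVar t (z t) (w t) + P.lam (z t))) :=
        ((tendsto_const_nhds.add (((hw1 t ht).sub_const _).div_const _)).sub (hz1 t ht)).add
          (hlam1 t ht)
      have h3 := le_of_tendsto h2 (Eventually.of_forall fun i => hk2 (hTraj i) t ht)
      have h4 : P.xVar t (z t) (w t) + z t ≤ P.p * t + k2 := by linarith [hlamz t ht]
      have h5 : w t = P.β * (P.xVar t (z t) (w t) + z t) + (P.α - P.β) * t := by
        unfold Params.xVar; field_simp; ring
      have h6 := mul_le_mul_of_nonneg_left h4 hβ.le
      have h7 : P.q * t = P.β * (P.p * t) + (P.α - P.β) * t := by rw [P.q_eq]; ring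
      rw [h5, h7]
      linarith
    have h2 : Tendsto (fun t => P.β * k2 + P.q * t) atBot atBot :=
      tendsto_atBot_add_const_left _ _ (tendsto_id.const_mul_atBot P.q_pos)
    have h3 := Real.tendsto_exp_atBot.comp h2
    refine tendsto_of_tendsto_of_tendsto_of_le_of_le' tendsto_const_nhds h3
      (Eventually.of_forall fun t => (Real.exp_pos _).le) ?_
    filter_upwards [eventually_lt_atBot T] with t ht
    exact Real.exp_le_exp.2 (h1 t ht)

/-- Existence of the singular solution: regular solutions `u(·, a)` form a Cauchy family as
`a → 0⁺`. -/
lemma Admissible.exists_singular {P : Params} {k L r₀ a₀ K c : ℝ}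
    (h : Admissible P k L r₀ a₀) (hc : 0 < c) (hK : Contracts P L K c) :
    ∃ u, IsSolution P.α P.β P.γ P.f 0 r₀ u := by
  have hβ := P.β_pos
  set a : ℕ → ℝ := fun n => a₀ / (n + 2) with ha
  have ha' : ∀ n, a n ∈ Ioo 0 a₀ := fun n => by
    have := h.a₀_pos
    refine ⟨by positivity, ?_⟩
    rw [ha]
    simp only
    rw [div_lt_iff₀ (by positivity)]
    nlinarith [(Nat.cast_nonneg n : (0 : ℝ) ≤ n)]
  have halim : Tendsto a atTop (𝓝[>] 0) := by
    refine tendsto_nhdsWithin_iff.2 ⟨?_, Eventually.of_forall fun n => (ha' n).1⟩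
    exact tendsto_const_nhds.div_atTop
      (tendsto_atTop_add_const_right _ _ tendsto_natCast_atTop_atTop)
  have hcore := P.tendsto_core.comp halim
  choose u hu using fun n => h.exists_regular (ha' n)
  have hTraj : ∀ n, Traj P L (Real.log r₀) (logOf (u n)) (logOf (flux P.α P.β (u n))) := fun n =>
    h.traj h.r₀_pos (hu n) fun r hr =>
      (h.lt_of_isSolution ⟨(ha' n).1.le, (ha' n).2⟩ le_rfl (hu n) hr).le
  have hlam : ∀ n, Tendsto (fun t => Real.exp (P.lam (logOf (u n) t))) atBot
      (𝓝 (P.core (a n))) := fun n =>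
    (hu n).tendsto_exp_lam h.r₀_pos (ha' n).1.le (h.lt_exp_C (ha' n).2)
  set T := Real.log r₀ with hT
  set Z : ℕ → ℝ → ℝ := fun n => logOf (u n) with hZdef
  set W : ℕ → ℝ → ℝ := fun n => logOf (flux P.α P.β (u n)) with hWdef
  have hpair : ∀ n m : ℕ, ∀ {s t : ℝ}, s ≤ t → t < T → P.core (a n) ≤ Real.exp (P.p * s) →
      P.core (a m) ≤ Real.exp (P.p * s) →
      |Z m t - Z n t| ≤ K * Real.exp (-c * (t - s)) ∧
      |W m t - W n t| ≤ 2 * P.β * K * Real.exp (-c * (t - s)) := by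
    intro n m s t hst ht hn hm
    obtain ⟨h1, -, h3⟩ := hK (hTraj n) (hTraj m) (hlam n) (hlam m) hst ht hn hm
    refine ⟨h3, ?_⟩
    have h4 : W m t - W n t = P.β * ((P.xVar t (Z m t) (W m t) - P.xVar t (Z n t) (W n t)) +
        (Z m t - Z n t)) := by
      unfold Params.xVar; field_simp; ring
    rw [h4, abs_mul, abs_of_pos hβ]
    calc P.β * _ ≤ P.β * (K * Real.exp (-c * (t - s)) + K * Real.exp (-c * (t - s))) := by
          gcongr
          exact (abs_add_le _ _).trans (add_le_add h1 h3)
      _ = _ := by ring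
  have hev : ∀ s, ∀ᶠ n in atTop, P.core (a n) ≤ Real.exp (P.p * s) := fun s =>
    (hcore.eventually_lt_const (Real.exp_pos (P.p * s))).mono fun n hn => le_of_lt hn
  have hcauchy : ∀ (V : ℕ → ℝ → ℝ) (M : ℝ), (∀ n m : ℕ, ∀ {s t : ℝ}, s ≤ t → t < T →
      P.core (a n) ≤ Real.exp (P.p * s) → P.core (a m) ≤ Real.exp (P.p * s) →
      |V m t - V n t| ≤ M * Real.exp (-c * (t - s))) →
      ∃ v : ℝ → ℝ, TendstoLocallyUniformlyOn V v atTop (Iio T) := by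
    intro V M hV
    have hex : ∀ t < T, ∃ x, Tendsto (fun n => V n t) atTop (𝓝 x) := by
      intro t ht
      apply cauchySeq_tendsto_of_complete
      rw [Metric.cauchySeq_iff]
      intro ε hε
      obtain ⟨s, hs, hst⟩ := (((tendsto_exp_decay hc M t).eventually_lt_const hε).and
        (eventually_le_atBot t)).exists
      obtain ⟨N, hN⟩ := eventually_atTop.1 (hev s)
      refine ⟨N, fun m hm n hn => ?_⟩
      rw [Real.dist_eq]
      exact (hV n m hst ht (hN n hn) (hN m hm)).trans_lt hs
    choose! v hv using hex
    refine ⟨v, ?_⟩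
    rw [Metric.tendstoLocallyUniformlyOn_iff]
    intro ε hε t ht
    obtain ⟨s, hs, hst⟩ := (((tendsto_exp_decay hc M (t - 1)).eventually_lt_const
      (half_pos hε)).and (eventually_le_atBot (t - 1))).exists
    have hM : 0 ≤ M := by
      obtain ⟨n, hn⟩ := (hev s).exists
      have := (abs_nonneg _).trans (hV n n (hst.trans (by linarith)) ht hn hn)
      exact nonneg_of_mul_nonneg_left this (Real.exp_pos _)
    refine ⟨Ioo (t - 1) T, ?_, ?_⟩
    · exact mem_nhdsWithin_of_mem_nhds (isOpen_Ioo.mem_nhds ⟨by linarith, ht⟩)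
    · filter_upwards [hev s] with n hn τ hτ
      have hsτ : s ≤ τ := hst.trans hτ.1.le
      have h1 : |v τ - V n τ| ≤ M * Real.exp (-c * (τ - s)) := by
        refine le_of_tendsto ((hv τ hτ.2).sub_const (V n τ)).abs ?_
        filter_upwards [hev s] with m hm using hV n m hsτ hτ.2 hn hm
      rw [Real.dist_eq]
      refine h1.trans_lt (lt_of_le_of_lt ?_ (hs.trans (half_lt_self hε)))
      gcongr M * Real.exp ?_
      nlinarith [hτ.1]
  obtain ⟨z, hz⟩ := hcauchy Z K fun n m {s t} hst ht hn hm => (hpair n m hst ht hn hm).1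
  obtain ⟨w, hw⟩ := hcauchy W (2 * P.β * K) fun n m {s t} hst ht hn hm => (hpair n m hst ht hn hm).2
  obtain ⟨h1, h2⟩ := Traj.of_tendsto h.one_le_L h.d_le hTraj hcore h.k_pos
    (fun n => h.bound (hTraj n) (hlam n)) hz hw
  refine ⟨Traj.profile z, ?_⟩
  have := h1.isSolution h2
  rwa [hT, Real.exp_log h.r₀_pos] at this

/-! ### Behaviour of the singular solution at the origin -/

namespace Params

variable (P : Params)

/-- The exponent of the logarithm in the leading term of the singular solution. -/
def logExp : ℝ := P.d / (P.m + P.β)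

lemma logExp_nonneg : 0 ≤ P.logExp := div_nonneg P.d_nonneg P.mβ_pos.le

lemma kappa_base_pos : 0 < (P.m + P.β) / (P.β * P.γ + P.m * (P.α - P.β)) *
    ((P.m + P.β) / (P.γ - P.α + P.β)) ^ (P.d + P.β) := by
  have h1 := P.mβ_pos
  have h2 : 0 < P.γ - P.α + P.β := P.θ_pos
  have h3 := mul_pos P.β_pos P.γ_pos
  have h4 := mul_pos P.m_pos (sub_pos.2 P.β_lt_α)
  positivity

lemma kappa_pos : 0 < kappa P.α P.β P.γ P.m P.d := Real.rpow_pos_of_pos P.kappa_base_pos _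

lemma log_kappa : Real.log (kappa P.α P.β P.γ P.m P.d) =
    -(P.β * Real.log P.p + Real.log P.q) / (P.m + P.β) - P.logExp * Real.log P.p := by
  have h1 := P.mβ_pos
  have h3 : 0 < P.β * P.γ + P.m * (P.α - P.β) := by
    have h3 := mul_pos P.β_pos P.γ_pos
    have h4 := mul_pos P.m_pos (sub_pos.2 P.β_lt_α)
    linarith
  have hq : (P.m + P.β) / (P.β * P.γ + P.m * (P.α - P.β)) = P.q⁻¹ := by
    rw [← one_div, div_eq_div_iff h3.ne' P.q_pos.ne']
    have := P.p_mul
    rw [Params.q]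
    unfold Params.θ at this
    linear_combination (-P.m) * this
  have hp : (P.m + P.β) / (P.γ - P.α + P.β) = P.p⁻¹ := by
    rw [Params.p, inv_div, Params.θ]
  rw [kappa, hq, hp, Real.log_rpow (by
    have := P.q_pos; have := P.p_pos; positivity), Real.log_mul (inv_ne_zero P.q_pos.ne')
    (Real.rpow_pos_of_pos (inv_pos.2 P.p_pos) _).ne', Real.log_rpow (inv_pos.2 P.p_pos),
    Real.log_inv, Real.log_inv, Params.logExp]
  field_simp
  ring

end Params

namespace Traj

variable {P : Params} {L T : ℝ} {z w : ℝ → ℝ}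

lemma tendsto_of_singular (h : Traj P L T z w) (hz : Tendsto z atBot atBot)
    (hlam : Tendsto (fun t => Real.exp (P.lam (z t))) atBot (𝓝 0)) :
    Tendsto (fun t => P.xVar t (z t) (w t)) atBot (𝓝 (Real.log P.p)) ∧
    Tendsto (fun t => P.yVar t (z t) (w t)) atBot (𝓝 (Real.log P.q)) := by
  obtain ⟨K, c, hK, hc, H⟩ := exists_dist2_le P
  have h1 : ∀ t < T, dist2 P t (z t) (w t) ≤ K / (P.C - z t) := by
    intro t ht
    have h2 := (tendsto_exp_decay hc K t).add_const (K / (P.C - z t))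
    rw [zero_add] at h2
    refine ge_of_tendsto h2 ?_
    filter_upwards [eventually_le_atBot t] with s hs
    exact H h hlam hs ht (Real.exp_pos _).le
  have h2 : Tendsto (fun t => K / (P.C - z t)) atBot (𝓝 0) :=
    tendsto_const_nhds.div_atTop (tendsto_atTop_add_const_left _ _ (tendsto_neg_atBot_atTop.comp hz))
  have h3 : Tendsto (fun t => √(K / (P.C - z t))) atBot (𝓝 0) := by
    simpa using h2.sqrt
  have key : ∀ (f : ℝ → ℝ) (a : ℝ), 0 < a →
      (∀ t < T, (Real.exp (f t) - a) ^ 2 ≤ dist2 P t (z t) (w t)) →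
      Tendsto f atBot (𝓝 (Real.log a)) := by
    intro f a ha hf
    have h4 : Tendsto (fun t => Real.exp (f t) - a) atBot (𝓝 0) := by
      refine squeeze_zero_norm' ?_ h3
      filter_upwards [eventually_lt_atBot T] with t ht
      exact Real.abs_le_sqrt ((hf t ht).trans (h1 t ht))
    have h5 : Tendsto (fun t => Real.exp (f t)) atBot (𝓝 a) := by
      simpa using h4.add_const a
    simpa using h5.log ha.ne'
  refine ⟨key _ _ P.p_pos fun t _ => ?_, key _ _ P.q_pos fun t _ => ?_⟩
  · unfold dist2; linarith [sq_nonneg (Real.exp (P.yVar t (z t) (w t)) - P.q)]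
  · unfold dist2; linarith [sq_nonneg (Real.exp (P.xVar t (z t) (w t)) - P.p)]

/-- Asymptotics of the singular solution in logarithmic variables. -/
lemma tendsto_z_sub (h : Traj P L T z w) (hz : Tendsto z atBot atBot)
    (hlam : Tendsto (fun t => Real.exp (P.lam (z t))) atBot (𝓝 0)) :
    Tendsto (fun t => z t - P.p * t + P.logExp * Real.log (-t)) atBot
      (𝓝 (Real.log (kappa P.α P.β P.γ P.m P.d))) := by
  obtain ⟨hx, hy⟩ := h.tendsto_of_singular hz hlam
  have hp := P.p_pos
  have hmβ := P.mβ_pos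
  set f : ℝ → ℝ := fun t =>
    -(P.β * P.xVar t (z t) (w t) + P.yVar t (z t) (w t)) / (P.m + P.β) with hf
  have hflim : Tendsto f atBot (𝓝 (-(P.β * Real.log P.p + Real.log P.q) / (P.m + P.β))) :=
    (((hx.const_mul P.β).add hy).neg).div_const _
  have hfeq : ∀ t, P.lam (z t) = P.p * t + f t := by
    intro t
    rw [hf]
    simp only
    rw [P.xVar_yVar, ← P.p_mul]
    field_simp
    ring
  have hy1 : Tendsto (fun t => P.C - z t) atBot atTop :=
    tendsto_atTop_add_const_left _ _ (tendsto_neg_atBot_atTop.comp hz)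
  -- `p * (-t) / (C - z) → 1`
  have hratio : Tendsto (fun t => P.p * (-t) / (P.C - z t)) atBot (𝓝 1) := by
    have e1 : Tendsto (fun t => Real.log (P.C - z t) / (P.C - z t)) atBot (𝓝 0) :=
      (Real.isLittleO_log_id_atTop.tendsto_div_nhds_zero).comp hy1
    have e2 : Tendsto (fun t => (f t - P.C) / (P.C - z t)) atBot (𝓝 0) :=
      (hflim.sub_const P.C).div_atTop hy1
    have e3 := ((e1.const_mul P.logExp).const_sub 1).add e2
    rw [mul_zero, sub_zero, add_zero] at e3
    refine e3.congr' ?_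
    filter_upwards [hy1.eventually_gt_atTop 0] with t ht
    have e4 := hfeq t
    unfold Params.lam at e4
    rw [Params.logExp, ← mul_div_assoc, ← div_self ht.ne', ← sub_div, ← add_div]
    congr 1
    linarith
  have hlog := hratio.log one_ne_zero
  rw [Real.log_one] at hlog
  have hfin := (hflim.add (hlog.const_mul P.logExp)).sub_const (P.logExp * Real.log P.p)
  rw [mul_zero, add_zero, ← P.log_kappa] at hfin
  refine hfin.congr' ?_
  filter_upwards [hy1.eventually_gt_atTop 0, eventually_lt_atBot 0] with t ht ht0
  have e4 := hfeq t
  unfold Params.lam at e4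
  rw [Real.log_div (by nlinarith) ht.ne', Real.log_mul hp.ne' (by linarith), Params.logExp]
  linarith

end Traj

namespace IsSolution

variable {P : Params} {r₁ : ℝ} {u : ℝ → ℝ}

lemma tendsto_logOf (h : IsSolution P.α P.β P.γ P.f 0 r₁ u) (hr₁ : 0 < r₁) :
    Tendsto (logOf u) atBot atBot := by
  refine Real.tendsto_log_nhdsGT_zero.comp (tendsto_nhdsWithin_iff.2
    ⟨(h.tendsto_zero hr₁).comp tendsto_exp_atBot, ?_⟩)
  filter_upwards [eventually_lt_atBot (Real.log r₁)] with t ht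
  exact h.pos _ (exp_mem_Ioo hr₁ ht)

/-- `log u` against `t = log r`, for the singular solution. -/
lemma tendsto_logOf_sub (h : IsSolution P.α P.β P.γ P.f 0 r₁ u) (hr₁ : 0 < r₁) {L : ℝ}
    (ht : Traj P L (Real.log r₁) (logOf u) (logOf (flux P.α P.β u))) :
    Tendsto (fun t => logOf u t - P.p * t + P.logExp * Real.log (-t)) atBot
      (𝓝 (Real.log (kappa P.α P.β P.γ P.m P.d))) := by
  have h1 := h.tendsto_exp_lam hr₁ le_rfl (Real.exp_pos _)
  rw [P.core_zero] at h1
  exact ht.tendsto_z_sub (h.tendsto_logOf hr₁) h1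

lemma isEquivalent (h : IsSolution P.α P.β P.γ P.f 0 r₁ u) (hr₁ : 0 < r₁) {L : ℝ}
    (ht : Traj P L (Real.log r₁) (logOf u) (logOf (flux P.α P.β u))) :
    Asymptotics.IsEquivalent (𝓝[>] 0) u (fun r => kappa P.α P.β P.γ P.m P.d *
      (r ^ (P.γ - P.α + P.β) / |Real.log r| ^ P.d) ^ (1 / (P.m + P.β))) := by
  apply Asymptotics.isEquivalent_of_tendsto_one
  have h1 := (h.tendsto_logOf_sub hr₁ ht).comp Real.tendsto_log_nhdsGT_zero
  have h2 := (h1.sub_const (Real.log (kappa P.α P.β P.γ P.m P.d))).rexp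
  rw [sub_self, Real.exp_zero] at h2
  refine h2.congr' ?_
  filter_upwards [Ioo_mem_nhdsGT hr₁, Ioo_mem_nhdsGT one_pos] with r hr hr1
  have hlog : Real.log r < 0 := Real.log_neg hr.1 hr1.2
  have hmβ := P.mβ_pos
  have hθ : P.γ - P.α + P.β = P.p * (P.m + P.β) := by rw [P.p_mul]; rfl
  have hA : 0 < r ^ (P.γ - P.α + P.β) := Real.rpow_pos_of_pos hr.1 _
  have hB : 0 < |Real.log r| ^ P.d := Real.rpow_pos_of_pos (abs_pos.2 hlog.ne) _
  have e1 : (r ^ (P.γ - P.α + P.β) / |Real.log r| ^ P.d) ^ (1 / (P.m + P.β)) =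
      Real.exp (P.p * Real.log r - P.logExp * Real.log (-Real.log r)) := by
    rw [Real.rpow_def_of_pos (div_pos hA hB), Real.log_div hA.ne' hB.ne', Real.log_rpow hr.1,
      Real.log_rpow (abs_pos.2 hlog.ne), abs_of_neg hlog, hθ, Params.logExp]
    congr 1
    field_simp
  simp only [Function.comp, Pi.div_apply]
  rw [e1, h.eq_exp_logOf hr, eq_div_iff (mul_pos P.kappa_pos (Real.exp_pos _)).ne', Real.exp_sub,
    Real.exp_log P.kappa_pos]
  have e2 := P.kappa_pos.ne'
  rw [div_mul_eq_mul_div, mul_left_comm, mul_div_cancel_left₀ _ e2, ← Real.exp_add]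
  congr 1
  ring

lemma deriv_eq_mul_exp {a : ℝ} (h : IsSolution P.α P.β P.γ P.f a r₁ u) {L : ℝ}
    (ht : Traj P L (Real.log r₁) (logOf u) (logOf (flux P.α P.β u))) {r : ℝ}
    (hr : r ∈ Ioo 0 r₁) : deriv u r = u r / r * Real.exp (P.xVar (Real.log r)
      (logOf u (Real.log r)) (logOf (flux P.α P.β u) (Real.log r))) := by
  have h1 := ((ht.hasDerivAt_z _ (Real.log_lt_log hr.1 hr.2)).comp r
    (Real.hasDerivAt_log hr.1.ne')).exp
  have h2 : u =ᶠ[𝓝 r] fun r => Real.exp ((logOf u ∘ Real.log) r) := by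
    filter_upwards [isOpen_Ioo.mem_nhds hr] with s hs using h.eq_exp_logOf hs
  rw [(h1.congr_of_eventuallyEq h2).deriv, Function.comp, ← h.eq_exp_logOf hr]
  ring

lemma tendsto_atTop_mul_neg_sub_log {a b : ℝ} (ha : 0 < a) :
    Tendsto (fun s : ℝ => a * s - b * Real.log s) atTop atTop := by
  have h1 : Tendsto (fun s : ℝ => a - b * (Real.log s / s)) atTop (𝓝 a) := by
    simpa using (Real.isLittleO_log_id_atTop.tendsto_div_nhds_zero.const_mul b).const_sub a
  refine (tendsto_id.atTop_mul_pos ha h1).congr' ?_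
  filter_upwards [eventually_gt_atTop 0] with s hs
  simp only [id]
  field_simp

lemma slope_zero_eq (h : u 0 = 0) (r : ℝ) : slope u 0 r = u r / r := by
  rw [slope_def_field, h, sub_zero, sub_zero]

lemma hasDerivWithinAt_iff (h : u 0 = 0) (l : ℝ) :
    HasDerivWithinAt u l (Ici 0) 0 ↔ Tendsto (fun r => u r / r) (𝓝[>] 0) (𝓝 l) := by
  rw [hasDerivWithinAt_iff_tendsto_slope, Ici_sdiff_left]
  exact tendsto_congr fun r => slope_zero_eq h r

lemma isC1AtZero_iff (h : IsSolution P.α P.β P.γ P.f 0 r₁ u) (hr₁ : 0 < r₁) {L : ℝ}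
    (ht : Traj P L (Real.log r₁) (logOf u) (logOf (flux P.α P.β u))) :
    IsC1AtZero u ↔ P.m + P.α ≤ P.γ := by
  have hmβ := P.mβ_pos
  have hp1 : P.m + P.α ≤ P.γ ↔ 1 ≤ P.p := by
    rw [Params.p, one_le_div hmβ, Params.θ]
    constructor <;> intro h <;> linarith
  have hS := h.tendsto_logOf_sub hr₁ ht
  set κ := Real.log (kappa P.α P.β P.γ P.m P.d)
  have hdiv : ∀ᶠ r in 𝓝[>] (0 : ℝ), Real.exp (logOf u (Real.log r) - Real.log r) = u r / r := by
    filter_upwards [Ioo_mem_nhdsGT hr₁] with r hr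
    rw [Real.exp_sub, Real.exp_log hr.1, ← h.eq_exp_logOf hr]
  have hneg : Tendsto (fun t : ℝ => -t) atBot atTop := tendsto_neg_atBot_atTop
  have hlogneg : Tendsto (fun t : ℝ => Real.log (-t)) atBot atTop :=
    Real.tendsto_log_atTop.comp hneg
  rw [hp1]
  constructor
  · rintro ⟨l, hl, -⟩
    by_contra! hlt
    rw [hasDerivWithinAt_iff h.init] at hl
    -- for `p < 1` the quotient `u r / r` is unbounded
    have h1 : Tendsto (fun t => logOf u t - t) atBot atTop := by
      have h2 := (tendsto_atTop_mul_neg_sub_log (b := P.logExp) (sub_pos.2 hlt)).comp hneg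
      refine (hS.add_atTop h2).congr fun t => ?_
      simp only [Function.comp]
      ring
    have h3 := (Real.tendsto_exp_atTop.comp h1).comp Real.tendsto_log_nhdsGT_zero
    exact not_tendsto_nhds_of_tendsto_atTop (h3.congr' hdiv) l hl
  · intro hp
    obtain ⟨l, hl, hlp⟩ : ∃ l : ℝ,
        Tendsto (fun t => Real.exp (logOf u t - t)) atBot (𝓝 l) ∧ l * P.p = l := by
      have hnonneg : Tendsto (fun t : ℝ => -((P.p - 1) * (-t) + P.logExp * Real.log (-t)))
          atBot atBot → ∃ l : ℝ, Tendsto (fun t => Real.exp (logOf u t - t)) atBot (𝓝 l) ∧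
            l * P.p = l := by
        intro h2
        refine ⟨0, Real.tendsto_exp_atBot.comp ((hS.add_atBot h2).congr fun t => ?_), by simp⟩
        ring
      rcases hp.eq_or_lt with hp | hp
      · rcases P.logExp_nonneg.eq_or_lt with he | he
        · refine ⟨Real.exp κ, (hS.congr fun t => ?_).rexp, by rw [← hp, mul_one]⟩
          rw [← he, ← hp]
          ring
        · apply hnonneg
          rw [← hp]
          refine (tendsto_neg_atTop_atBot.comp (hlogneg.const_mul_atTop he)).congr fun t => ?_
          simp
      · apply hnonneg
        refine tendsto_neg_atTop_atBot.comp
          (tendsto_atTop_mono' _ ?_ (hneg.const_mul_atTop (sub_pos.2 hp)))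
        filter_upwards [hlogneg.eventually_ge_atTop 0] with t ht
        exact le_add_of_nonneg_right (mul_nonneg P.logExp_nonneg ht)
    have hl' := (hl.comp Real.tendsto_log_nhdsGT_zero).congr' hdiv
    refine ⟨l, (hasDerivWithinAt_iff h.init l).2 hl', ?_⟩
    have h1 := h.tendsto_exp_lam hr₁ le_rfl (Real.exp_pos _)
    rw [P.core_zero] at h1
    have hx := (ht.tendsto_of_singular (h.tendsto_logOf hr₁) h1).1.rexp.comp
      Real.tendsto_log_nhdsGT_zero
    rw [Real.exp_log P.p_pos] at hx
    have h2 := hl'.mul hx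
    rw [hlp] at h2
    refine h2.congr' ?_
    filter_upwards [Ioo_mem_nhdsGT hr₁] with r hr
    rw [h.deriv_eq_mul_exp ht hr]
    rfl

end IsSolution

/-! ### Convergence of the regular solutions -/

namespace IsSolution

variable {P : Params} {a r₁ L : ℝ} {u : ℝ → ℝ}

lemma deriv_deriv_eq (h : IsSolution P.α P.β P.γ P.f a r₁ u)
    (ht : Traj P L (Real.log r₁) (logOf u) (logOf (flux P.α P.β u))) {r : ℝ}
    (hr : r ∈ Ioo 0 r₁) : deriv (deriv u) r = u r / r ^ 2 *
      Real.exp (P.xVar (Real.log r) (logOf u (Real.log r)) (logOf (flux P.α P.β u) (Real.log r))) *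
      ((Real.exp (P.yVar (Real.log r) (logOf u (Real.log r))
        (logOf (flux P.α P.β u) (Real.log r))) - P.q) / P.β + P.p - 1) := by
  have h1 : deriv u =ᶠ[𝓝 r] fun r => u r / r * Real.exp (((fun t => P.xVar t (logOf u t)
      (logOf (flux P.α P.β u) t)) ∘ Real.log) r) := by
    filter_upwards [isOpen_Ioo.mem_nhds hr] with s hs using h.deriv_eq_mul_exp ht hs
  have h2 := ((h.hasDerivAt hr).div (hasDerivAt_id r) hr.1.ne').mul
    (((ht.hasDerivAt_x (Real.log_lt_log hr.1 hr.2)).comp r (Real.hasDerivAt_log hr.1.ne')).exp)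
  rw [(h2.congr_of_eventuallyEq h1).deriv, h.deriv_eq_mul_exp ht hr]
  have hr0 := hr.1.ne'
  simp only [Function.comp, id, Pi.div_apply]
  field_simp
  ring

end IsSolution

/-- Continuous convergence from an estimate that improves as the core shrinks. -/
lemma tendsto_prod_of_abs_sub_le {P : Params} {T K c a₀ t₀ : ℝ} {F : ℝ → ℝ → ℝ} {f : ℝ → ℝ}
    (hc : 0 < c) (ha₀ : 0 < a₀) (ht₀ : t₀ < T) (hf : ContinuousAt f t₀)
    (h : ∀ a ∈ Ioo 0 a₀, ∀ {s t : ℝ}, s ≤ t → t < T → P.core a ≤ Real.exp (P.p * s) →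
      |F a t - f t| ≤ K * Real.exp (-c * (t - s))) :
    Tendsto (fun y : ℝ × ℝ => F y.1 y.2) (𝓝[>] 0 ×ˢ 𝓝 t₀) (𝓝 (f t₀)) := by
  have h1 : Tendsto (fun y : ℝ × ℝ => F y.1 y.2 - f y.2) (𝓝[>] 0 ×ˢ 𝓝 t₀) (𝓝 0) := by
    rw [Metric.tendsto_nhds]
    intro ε hε
    obtain ⟨s, hs, hst⟩ := (((tendsto_exp_decay hc |K| (t₀ - 1)).eventually_lt_const hε).and
      (eventually_le_atBot (t₀ - 1))).exists
    have e1 : ∀ᶠ a in 𝓝[>] (0 : ℝ), P.core a < Real.exp (P.p * s) :=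
      P.tendsto_core.eventually_lt_const (Real.exp_pos _)
    have e2 : ∀ᶠ t in 𝓝 t₀, t ∈ Ioo (t₀ - 1) T := isOpen_Ioo.mem_nhds ⟨by linarith, ht₀⟩
    filter_upwards [(e1.and (Ioo_mem_nhdsGT ha₀)).prod_mk e2] with y hy
    obtain ⟨⟨hy1, hy2⟩, hy3⟩ := hy
    rw [Real.dist_eq, sub_zero]
    refine (h y.1 hy2 (hst.trans hy3.1.le) hy3.2 hy1.le).trans_lt (lt_of_le_of_lt ?_ hs)
    have hexp : Real.exp (-c * (y.2 - s)) ≤ Real.exp (-c * (t₀ - 1 - s)) := by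
      apply Real.exp_le_exp.2
      nlinarith [hy3.1]
    calc K * Real.exp (-c * (y.2 - s)) ≤ |K| * Real.exp (-c * (y.2 - s)) := by
          gcongr; exact le_abs_self K
      _ ≤ _ := by gcongr
  have h2 := h1.add (hf.tendsto.comp (tendsto_snd (f := 𝓝[>] (0 : ℝ)) (g := 𝓝 t₀)))
  rw [zero_add] at h2
  refine h2.congr fun y => ?_
  simp only [Function.comp]
  ring

namespace Admissible

variable {P : Params} {k L r₀ a₀ K c : ℝ} {u : ℝ → ℝ} {U : ℝ → ℝ → ℝ}

lemma le_core_add (h : Admissible P k L r₀ a₀) {a : ℝ} (ha : a ∈ Ico 0 a₀) {v : ℝ → ℝ}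
    (hv : IsSolution P.α P.β P.γ P.f a r₀ v) {r : ℝ} (hr : r ∈ Ioo 0 r₀) :
    v r ≤ P.core a + k * r ^ P.p := by
  have hlt : ∀ s ∈ Ioo 0 r₀, v s ≤ Real.exp (P.C - L) := fun s hs =>
    (h.lt_of_isSolution ha le_rfl hv hs).le
  refine le_trans ?_ (h.exp_lam_le ha hv hlt hr)
  have hpos := hv.pos r hr
  have h1 : Real.log (v r) ≤ P.C - L := by
    rw [Real.log_le_iff_le_exp hpos]; exact hlt r hr
  have h2 : 0 ≤ Real.log (P.C - Real.log (v r)) := Real.log_nonneg (by linarith [h.one_le_L])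
  have h3 : Real.log (v r) ≤ P.lam (Real.log (v r)) := by
    have := mul_nonneg (div_nonneg P.d_nonneg P.mβ_pos.le) h2
    unfold Params.lam
    linarith
  rwa [← Real.exp_le_exp, Real.exp_log hpos] at h3

lemma tendsto_iteratedDeriv (h : Admissible P k L r₀ a₀) (hc : 0 < c) (hK : Contracts P L K c)
    (hu : IsSolution P.α P.β P.γ P.f 0 r₀ u)
    (hU : ∀ a ∈ Ioo 0 a₀, IsSolution P.α P.β P.γ P.f a r₀ (U a)) {i : ℕ} (hi : i ≤ 2) {r : ℝ}
    (hr : r ∈ Ioo 0 r₀) : Tendsto (fun y : ℝ × ℝ => iteratedDeriv i (U y.1) y.2)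
      (𝓝[>] 0 ×ˢ 𝓝 r) (𝓝 (iteratedDeriv i u r)) := by
  have h0 : (0 : ℝ) ∈ Ico 0 a₀ := ⟨le_rfl, h.a₀_pos⟩
  have hut := h.traj h.r₀_pos hu fun s hs => (h.lt_of_isSolution h0 le_rfl hu hs).le
  have hUt : ∀ a ∈ Ioo 0 a₀, Traj P L (Real.log r₀) (logOf (U a)) (logOf (flux P.α P.β (U a))) :=
    fun a ha => h.traj h.r₀_pos (hU a ha) fun s hs =>
      (h.lt_of_isSolution ⟨ha.1.le, ha.2⟩ le_rfl (hU a ha) hs).le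
  have hul := hu.tendsto_exp_lam h.r₀_pos le_rfl (Real.exp_pos _)
  rw [P.core_zero] at hul
  have hlog := Real.log_lt_log hr.1 hr.2
  have hbd : ∀ a ∈ Ioo 0 a₀, ∀ {s t : ℝ}, s ≤ t → t < Real.log r₀ →
      P.core a ≤ Real.exp (P.p * s) → _ := fun a ha {s t} hst ht hs =>
    hK hut (hUt a ha) hul ((hU a ha).tendsto_exp_lam h.r₀_pos ha.1.le (h.lt_exp_C ha.2)) hst ht
      (Real.exp_pos _).le hs
  have hmap : Tendsto (fun y : ℝ × ℝ => (y.1, Real.log y.2)) (𝓝[>] 0 ×ˢ 𝓝 r)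
      (𝓝[>] 0 ×ˢ 𝓝 (Real.log r)) :=
    tendsto_fst.prodMk ((Real.continuousAt_log hr.1.ne').tendsto.comp tendsto_snd)
  have hz := (tendsto_prod_of_abs_sub_le (P := P) (F := fun a t => logOf (U a) t) (f := logOf u)
    hc h.a₀_pos hlog (hut.hasDerivAt_z _ hlog).continuousAt
    fun a ha {s t} hst ht hs => (hbd a ha hst ht hs).2.2).comp hmap
  have hx := (tendsto_prod_of_abs_sub_le (P := P)
    (F := fun a t => P.xVar t (logOf (U a) t) (logOf (flux P.α P.β (U a)) t))
    (f := fun t => P.xVar t (logOf u t) (logOf (flux P.α P.β u) t))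
    hc h.a₀_pos hlog (hut.hasDerivAt_x hlog).continuousAt
    fun a ha {s t} hst ht hs => (hbd a ha hst ht hs).1).comp hmap
  have hy := (tendsto_prod_of_abs_sub_le (P := P)
    (F := fun a t => P.yVar t (logOf (U a) t) (logOf (flux P.α P.β (U a)) t))
    (f := fun t => P.yVar t (logOf u t) (logOf (flux P.α P.β u) t))
    hc h.a₀_pos hlog (hut.hasDerivAt_y hlog).continuousAt
    fun a ha {s t} hst ht hs => (hbd a ha hst ht hs).2.1).comp hmap
  have hsnd : Tendsto (fun y : ℝ × ℝ => y.2) (𝓝[>] 0 ×ˢ 𝓝 r) (𝓝 r) := tendsto_snd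
  have ha_near : ∀ᶠ a in 𝓝[>] (0 : ℝ), a ∈ Ioo 0 a₀ := Ioo_mem_nhdsGT h.a₀_pos
  have hr_near : ∀ᶠ s in 𝓝 r, s ∈ Ioo 0 r₀ := isOpen_Ioo.mem_nhds hr
  have hev : ∀ᶠ y in 𝓝[>] (0 : ℝ) ×ˢ 𝓝 r, y.1 ∈ Ioo 0 a₀ ∧ y.2 ∈ Ioo 0 r₀ :=
    ha_near.prod_mk hr_near
  have hval : Tendsto (fun y : ℝ × ℝ => U y.1 y.2) (𝓝[>] 0 ×ˢ 𝓝 r) (𝓝 (u r)) := by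
    rw [hu.eq_exp_logOf hr]
    refine hz.rexp.congr' ?_
    filter_upwards [hev] with y hy
    exact ((hU y.1 hy.1).eq_exp_logOf hy.2).symm
  have hr0 := hr.1.ne'
  interval_cases i
  · simpa only [iteratedDeriv_zero] using hval
  · simp only [iteratedDeriv_one]
    rw [hu.deriv_eq_mul_exp hut hr]
    refine ((hval.div hsnd hr0).mul hx.rexp).congr' ?_
    filter_upwards [hev] with y hy
    exact ((hU y.1 hy.1).deriv_eq_mul_exp (hUt y.1 hy.1) hy.2).symm
  · simp only [iteratedDeriv_succ, iteratedDeriv_zero]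
    rw [hu.deriv_deriv_eq hut hr]
    refine (((hval.div (hsnd.pow 2) (pow_ne_zero 2 hr0)).mul hx.rexp).mul
      ((((hy.rexp.sub_const P.q).div_const P.β).add_const P.p).sub_const 1)).congr' ?_
    filter_upwards [hev] with y hy
    exact ((hU y.1 hy.1).deriv_deriv_eq (hUt y.1 hy.1) hy.2).symm

lemma convergesC2Loc (h : Admissible P k L r₀ a₀) (hc : 0 < c) (hK : Contracts P L K c)
    (hu : IsSolution P.α P.β P.γ P.f 0 r₀ u)
    (hU : ∀ a ∈ Ioo 0 a₀, IsSolution P.α P.β P.γ P.f a r₀ (U a)) : ConvergesC2Loc U u r₀ := by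
  constructor
  · intro i hi S hS hSc
    rw [← tendstoLocallyUniformlyOn_iff_tendstoUniformlyOn_of_compact hSc]
    refine tendstoLocallyUniformlyOn_of_tendsto (fun r hr => ?_) fun r hr =>
      (h.tendsto_iteratedDeriv hc hK hu hU hi (hS hr)).mono_left
        (Filter.prod_mono le_rfl nhdsWithin_le_nhds)
    have h1 := hu.contDiffOn.continuousOn_iteratedDerivWithin (m := i) (by exact_mod_cast hi)
      isOpen_Ioo.uniqueDiffOn
    exact ((h1.congr (iteratedDerivWithin_of_isOpen isOpen_Ioo).symm).mono hS) r hr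
  · intro S hS hSc
    rw [← tendstoLocallyUniformlyOn_iff_tendstoUniformlyOn_of_compact hSc]
    refine tendstoLocallyUniformlyOn_of_tendsto (hu.continuousOn.mono hS) fun r hr => ?_
    rcases (hS hr).1.eq_or_lt with rfl | hr0
    · rw [hu.init]
      have hfst : Tendsto (fun y : ℝ × ℝ => y.1) (𝓝[>] 0 ×ˢ 𝓝[S] 0) (𝓝 0) :=
        (tendsto_nhdsWithin_iff.1 tendsto_fst).1
      have hsnd : Tendsto (fun y : ℝ × ℝ => y.2) (𝓝[>] 0 ×ˢ 𝓝[S] 0) (𝓝 0) :=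
        (tendsto_nhdsWithin_iff.1 tendsto_snd).1
      have hcore : Tendsto (fun y : ℝ × ℝ => P.core y.1) (𝓝[>] 0 ×ˢ 𝓝[S] 0) (𝓝 0) :=
        P.tendsto_core.comp tendsto_fst
      have hpow := ((Real.continuous_rpow_const P.p_pos.le).tendsto 0).comp hsnd
      rw [Real.zero_rpow P.p_pos.ne'] at hpow
      have hub : Tendsto (fun y : ℝ × ℝ => |P.core y.1| + k * y.2 ^ P.p + y.1)
          (𝓝[>] 0 ×ˢ 𝓝[S] 0) (𝓝 0) := by
        have := (hcore.abs.add (hpow.const_mul k)).add hfst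
        simpa using this
      refine squeeze_zero_norm' ?_ hub
      have ha_near : ∀ᶠ a in 𝓝[>] (0 : ℝ), a ∈ Ioo 0 a₀ := Ioo_mem_nhdsGT h.a₀_pos
      have hs_near : ∀ᶠ s in 𝓝[S] (0 : ℝ), s ∈ S := self_mem_nhdsWithin
      have hev : ∀ᶠ y in 𝓝[>] (0 : ℝ) ×ˢ 𝓝[S] 0, y.1 ∈ Ioo 0 a₀ ∧ y.2 ∈ S :=
        ha_near.prod_mk hs_near
      filter_upwards [hev] with y hy
      obtain ⟨hy1, hy2⟩ := hy
      have hy2' := hS hy2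
      have hk := h.k_pos
      rw [Real.norm_eq_abs]
      rcases hy2'.1.eq_or_lt with h2 | h2
      · rw [← h2, (hU _ hy1).init, abs_of_pos hy1.1, h2]
        have := abs_nonneg (P.core y.1)
        have : 0 ≤ k * y.2 ^ P.p := by positivity
        linarith
      · rw [abs_of_pos ((hU _ hy1).pos _ ⟨h2, hy2'.2⟩)]
        have := h.le_core_add ⟨hy1.1.le, hy1.2⟩ (hU _ hy1) ⟨h2, hy2'.2⟩
        linarith [le_abs_self (P.core y.1), hy1.1]
    · have := h.tendsto_iteratedDeriv hc hK hu hU (Nat.zero_le 2) ⟨hr0, (hS hr).2⟩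
      simp only [iteratedDeriv_zero] at this
      exact this.mono_left (Filter.prod_mono le_rfl nhdsWithin_le_nhds)

/-! ### Intersections with the singular solution -/

/-- Many intersections: for small `a`, both solutions stay near the equilibrium on a long interval
of `t = log r`, which contains many disjoint intervals too long to be free of intersections. -/
lemma tendsto_zeroNumber (h : Admissible P k L r₀ a₀)
    (hu : IsSolution P.α P.β P.γ P.f 0 r₀ u)
    (hU : ∀ a ∈ Ioo 0 a₀, IsSolution P.α P.β P.γ P.f a r₀ (U a))
    (hdisc : (P.q + P.p) ^ 2 < 4 * P.p * (P.q * (P.m + P.β) / P.β)) {ρ : ℝ} (hρ : ρ ∈ Ioo 0 r₀) :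
    Tendsto (fun a => zeroNumber (Ioo 0 ρ) (fun r => U a r - u r)) (𝓝[>] 0) (𝓝 ⊤) := by
  obtain ⟨η, L₁, Λ, hη, hL₁, hΛ, hrot⟩ := Traj.exists_length_le P hdisc
  obtain ⟨K', c', hK', hc', hdist⟩ := Traj.exists_dist2_le P
  have hp := P.p_pos
  have hk := h.k_pos
  set L₂ := max L₁ (2 * K' / η ^ 2) with hL₂
  obtain ⟨t₁, ht₁, ht₁ρ⟩ : ∃ t₁ : ℝ, k * Real.exp (P.p * t₁) < Real.exp (P.C - L₂) / 2 ∧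
      t₁ < Real.log ρ := by
    have h1 : Tendsto (fun t => k * Real.exp (P.p * t)) atBot (𝓝 (k * 0)) :=
      (Real.tendsto_exp_atBot.comp (tendsto_id.const_mul_atBot hp)).const_mul k
    rw [mul_zero] at h1
    exact ((h1.eventually_lt_const (by positivity)).and (eventually_lt_atBot _)).exists
  obtain ⟨R, hR⟩ : ∃ R : ℝ, K' * Real.exp (-c' * R) ≤ η ^ 2 / 2 := by
    obtain ⟨s, hs⟩ := ((tendsto_exp_decay hc' K' 0).eventually_lt_const
      (show 0 < η ^ 2 / 2 by positivity)).exists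
    exact ⟨0 - s, hs.le⟩
  have ht₁r₀ : t₁ < Real.log r₀ := ht₁ρ.trans (Real.log_lt_log hρ.1 hρ.2)
  rw [ENat.tendsto_nhds_top_iff_natCast_lt]
  intro n
  set s₁ := t₁ - (n + 1) * (Λ + 1) with hs₁
  set s₀ := s₁ - max R 0 with hs₀
  have hcore : ∀ᶠ a in 𝓝[>] (0 : ℝ), P.core a < min (Real.exp (P.p * s₀))
      (Real.exp (P.C - L₂) / 2) :=
    P.tendsto_core.eventually_lt_const (lt_min (Real.exp_pos _) (by positivity))
  filter_upwards [hcore, Ioo_mem_nhdsGT h.a₀_pos] with a hacore ha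
  have hnear : ∀ {b : ℝ} {v : ℝ → ℝ}, b ∈ Ico 0 a₀ → IsSolution P.α P.β P.γ P.f b r₀ v →
      P.core b < min (Real.exp (P.p * s₀)) (Real.exp (P.C - L₂) / 2) →
      Traj P L (Real.log r₀) (logOf v) (logOf (flux P.α P.β v)) ∧
      ∀ τ ∈ Icc s₁ t₁, Traj.dist2 P τ (logOf v τ) (logOf (flux P.α P.β v) τ) ≤ η ^ 2 ∧
        logOf v τ ≤ P.C - L₂ := by
    intro b v hb hv hbc
    have htr := h.traj h.r₀_pos hv fun s hs => (h.lt_of_isSolution hb le_rfl hv hs).le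
    refine ⟨htr, fun τ hτ => ?_⟩
    have hτr₀ := hτ.2.trans_lt ht₁r₀
    have hmem := exp_mem_Ioo h.r₀_pos hτr₀
    have hz : logOf v τ ≤ P.C - L₂ := by
      rw [logOf, Real.log_le_iff_le_exp (hv.pos _ hmem)]
      have e1 := h.le_core_add hb hv hmem
      rw [← Real.exp_mul, mul_comm τ] at e1
      have e2 : k * Real.exp (P.p * τ) ≤ k * Real.exp (P.p * t₁) := by
        have := hτ.2
        gcongr
      have e3 := hbc.trans_le (min_le_right _ _)
      linarith
    refine ⟨?_, hz⟩
    have hsτ : s₀ ≤ τ := by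
      have := le_max_right R 0
      linarith [hτ.1]
    refine (hdist htr (hv.tendsto_exp_lam h.r₀_pos hb.1 (h.lt_exp_C hb.2)) hsτ hτr₀
      (hbc.trans_le (min_le_left _ _)).le).trans ?_
    have e1 : K' * Real.exp (-c' * (τ - s₀)) ≤ η ^ 2 / 2 := by
      refine le_trans ?_ hR
      have : R ≤ τ - s₀ := by
        have := le_max_left R 0
        linarith [hτ.1]
      gcongr K' * Real.exp ?_
      nlinarith
    have e2 : K' / (P.C - logOf v τ) ≤ η ^ 2 / 2 := by
      have h2 : 2 * K' / η ^ 2 ≤ P.C - logOf v τ := by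
        have := le_max_right L₁ (2 * K' / η ^ 2)
        linarith
      rw [div_le_iff₀ (by positivity)] at h2
      rw [div_le_iff₀ (htr.C_sub_pos hτr₀)]
      linarith
    linarith
  have h0 : (0 : ℝ) ∈ Ico 0 a₀ := ⟨le_rfl, h.a₀_pos⟩
  obtain ⟨hut, hun⟩ := hnear h0 hu (by
    rw [P.core_zero]; exact lt_min (Real.exp_pos _) (by positivity))
  obtain ⟨hUt, hUn⟩ := hnear ⟨ha.1.le, ha.2⟩ (hU a ha) hacore
  have hzero : ∀ i : Fin (n + 1), ∃ τ, t₁ - ((i : ℕ) + 1) * (Λ + 1) ≤ τ ∧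
      τ ≤ t₁ - (i : ℕ) * (Λ + 1) - 1 / 2 ∧ logOf (U a) τ = logOf u τ := by
    intro i
    by_contra! hcon
    have hi : ((i : ℕ) : ℝ) ≤ n := by exact_mod_cast Nat.lt_succ_iff.1 i.2
    have := hrot hut hUt (s := t₁ - ((i : ℕ) + 1) * (Λ + 1))
      (t := t₁ - (i : ℕ) * (Λ + 1) - 1 / 2) (by linarith) (by nlinarith) fun τ hτ => by
        have hτ' : τ ∈ Icc s₁ t₁ := ⟨by nlinarith [hτ.1], by nlinarith [hτ.2]⟩
        have hLL : P.C - L₂ ≤ P.C - L₁ := by linarith [le_max_left L₁ (2 * K' / η ^ 2)]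
        exact ⟨(hun τ hτ').1, (hUn τ hτ').1, (hun τ hτ').2.trans hLL, (hUn τ hτ').2.trans hLL,
          hcon τ hτ.1 hτ.2⟩
    linarith
  choose τ hτ1 hτ2 hτ3 using hzero
  have hanti : ∀ i j : Fin (n + 1), i < j → τ j < τ i := by
    intro i j hij
    have : ((i : ℕ) : ℝ) + 1 ≤ (j : ℕ) := by exact_mod_cast hij
    have := hτ1 i
    have := hτ2 j
    nlinarith
  have hinj : Function.Injective fun i => Real.exp (τ i) := by
    intro i j hij
    have hij' : τ i = τ j := Real.exp_injective hij
    rcases lt_trichotomy i j with hlt | heq | hlt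
    · exact absurd hij' (hanti i j hlt).ne'
    · exact heq
    · exact absurd hij' (hanti j i hlt).ne
  have hsub : range (fun i => Real.exp (τ i)) ⊆ {r ∈ Ioo 0 ρ | U a r - u r = 0} := by
    rintro _ ⟨i, rfl⟩
    have hi0 : (0 : ℝ) ≤ (i : ℕ) * (Λ + 1) := by positivity
    have hlt : τ i < t₁ := by linarith [hτ2 i]
    have hmem : Real.exp (τ i) ∈ Ioo 0 ρ := exp_mem_Ioo hρ.1 (hlt.trans ht₁ρ)
    have hmem' : Real.exp (τ i) ∈ Ioo 0 r₀ := ⟨hmem.1, hmem.2.trans hρ.2⟩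
    refine ⟨hmem, ?_⟩
    rw [(hU a ha).eq_exp_logOf hmem', hu.eq_exp_logOf hmem', Real.log_exp, hτ3 i, sub_self]
  have hcard := (hinj.encard_range).trans (encard_le_encard hsub)
  rw [ENat.card_eq_coe_natCard, Nat.card_fin] at hcard
  exact lt_of_lt_of_le (by exact_mod_cast Nat.lt_succ_self n) hcard

end Admissible

end MEMS

end

theorem proposition2p1 (α β γ m d C : ℝ) (hβ : 1 ≤ β) (hβα : β < α) (hαγ : α < γ)
    (hm : β < m) (hd : 0 ≤ d) :
    0 < MEMS.kappa α β γ m d ∧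
    ∃ r₀ : ℝ, 0 < r₀ ∧ ∃ u : ℝ → ℝ,
      -- existence and uniqueness, on `(0,r₀)` and on every smaller interval
      MEMS.IsSolution α β γ (MEMS.nonlin m d C) 0 r₀ u ∧
      (∀ r₁ ∈ Ioc 0 r₀, ∀ v : ℝ → ℝ,
        MEMS.IsSolution α β γ (MEMS.nonlin m d C) 0 r₁ v → EqOn v u (Ico 0 r₁)) ∧
      -- behaviour at the origin
      Asymptotics.IsEquivalent (𝓝[>] 0) u
        (fun r => MEMS.kappa α β γ m d *
          (r ^ (γ - α + β) / |Real.log r| ^ d) ^ (1 / (m + β))) ∧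
      (MEMS.IsC1AtZero u ↔ m + α ≤ γ) ∧
      -- the regular solutions `U a = u(·,a)` for small `a > 0`
      ∃ a₀ : ℝ, 0 < a₀ ∧ ∃ U : ℝ → ℝ → ℝ,
        (∀ a ∈ Ioo 0 a₀,
          MEMS.IsSolution α β γ (MEMS.nonlin m d C) a r₀ (U a) ∧
          ∀ v : ℝ → ℝ, MEMS.IsSolution α β γ (MEMS.nonlin m d C) a r₀ v →
            EqOn v (U a) (Ico 0 r₀)) ∧
        MEMS.ConvergesC2Loc U u r₀ ∧
        (((m / (m - β) : ℝ) : EReal) < MEMS.qc α β γ →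
          ∀ ρ ∈ Ioo 0 r₀,
            Tendsto (fun a => MEMS.zeroNumber (Ioo 0 ρ) (fun r => U a r - u r))
              (𝓝[>] 0) (𝓝 ⊤)) := by
  let P : MEMS.Params := ⟨α, β, γ, m, d, C, hβ, hβα, hαγ, hm, hd⟩
  obtain ⟨L₀, K, c, -, -, hc, hK₀⟩ := MEMS.Traj.exists_abs_sub_le P
  obtain ⟨k, L, r₀, a₀, hL, h⟩ := MEMS.exists_admissible P L₀
  have hK : MEMS.Contracts P L K c := fun h₁ h₂ => hK₀ hL h₁ h₂
  obtain ⟨u, hu⟩ := h.exists_singular hc hK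
  choose! U hU using fun a (ha : a ∈ Ioo 0 a₀) => h.exists_regular ha
  have ht := h.traj h.r₀_pos hu fun s hs =>
    (h.lt_of_isSolution ⟨le_rfl, h.a₀_pos⟩ le_rfl hu hs).le
  exact ⟨P.kappa_pos, r₀, h.r₀_pos, u, hu,
    fun r₁ hr₁ v hv => h.singular_unique hc hK hr₁.2 (hu.mono hr₁.2) hv,
    hu.isEquivalent h.r₀_pos ht, hu.isC1AtZero_iff h.r₀_pos ht, a₀, h.a₀_pos, U,
    fun a ha => ⟨hU a ha, fun v hv => h.regular_unique ha (hU a ha) hv⟩,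
    h.convergesC2Loc hc hK hu hU,
    fun hq ρ hρ => h.tendsto_zeroNumber hu hU (P.disc_of_lt_qc hq) hρ⟩
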